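/- **Setting.** Let $q=q(k)$ be a prime for each security parameter $k$. A model consists of $L\ge 1$ layers; layer $l$ is a matrix $M_l\in\mathbb Z_q^{n\times n}$, followed, in a non-linear layer, by a function $\varphi_l:\mathbb Z_q^n\to\mathbb Z_q^n$, for which a public Boolean circuit $C_l$ computing $(w,z,r)\mapsto \varphi_l(w+z)-r$ on binary representations is given. Write $M(x)$ for the result of applying all layers to $x\in\mathbb Z_q^n$. The layers are distributed as consecutive blocks over $P$ clusters; each cluster has $T\ge1$ computing servers, a garbler and an evaluator. All of $n,T,L,\log q$ and the circuit sizes may grow polynomially in $k$. **Protocol privateMDI.** *Offline.* The client generates keys $(pk,sk)$ and sends to the cloud the componentwise encryption $c_1^{enc}$ of a uniform mask $r_1=c_1$. For each layer $l$ the cloud draws a uniform $s_l\in\mathbb Z_q^n$, shares $M_l$ and $s_l$ additively among the $T$ computing servers and the garbler of the cluster responsible for $l$, and computes homomorphically an encryption of $M_lc_l+s_l$ from $c_l^{enc}$ and an encryption of $s_l$ (the entries of $M_l$ are coefficients of linear functions). If $l$ is linear, this is $c_{l+1}^{enc}$, with $c_{l+1}=M_lc_l+s_l$; it is sent to the client if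 $l=L$. If $l$ is non-linear, it is sent to the client, who decrypts it to $z_l$, draws a uniform $r_{l+1}=c_{l+1}$ and sends its encryption $c_{l+1}^{enc}$ to the cloud; the garbler garbles $C_l$ and sends the garbled circuit to the evaluator, and for each bit $i$ of $(z_l,r_{l+1})$, with labels $k_0,k_1$, the three-party oblivious transfer is run: the client sends $i\oplus b$ to the garbler, the garbler sends $k_0\oplus u_{i\oplus b},\ k_1\oplus u_{\overline{i\oplus b}}$ to the client, the client sends $k_i\oplus u_b$ to the evaluator, where $b$ is a uniform bit shared by client and evaluator, and $u_0,u_1$ are uniform strings shared by garbler and evaluator. *Online.* The client sends $x-r_1$ to the first garbler. For each layer $l$, with $d=x_l-c_l$ held by the garbler of its cluster, the garbler sends $d$ to the computing servers, every server $v$ of the cluster other than the evaluator computes $[M_l]_v d-[s_l]_v$, the computing servers send their results to the garbler, and the garbler adds all of them up to $w=M_ld-s_l$. If $l$ is linear, $w$ is the next masked value; otherwise the garbler sends the labels of $w$ to the evaluator, who evaluates the garbled circuit and returns its value $x_{l+1}-r_{l+1}$. Garblers pass the masked value on to the next cluster; the last one sends it to the client, who adds $c_{L+1}$. **Assumptions.**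 Algorithms are probabilistic polynomial time; $\approx_c$ denotes computational indistinguishability against probabilistic polynomial-time distinguishers with polynomial-length advice. (1) A linearly homomorphic encryption scheme with message space $\mathbb Z_q$ and ciphertexts of polynomially bounded fixed length such that: every ciphertext obtained by encryption and (possibly repeated) evaluation of linear functions $f(m_1,m_2)=am_1+bm_2$ decrypts correctly; it is semantically secure; it is function-private: there is an efficient simulator $S_{FP}$ such that, for all keys generated by the scheme and all such ciphertexts $ct_1,ct_2$ of $m_1,m_2$, the evaluated ciphertext satisfies $\mathrm{Eval}(pk,ct_1,ct_2,f)\approx_c S_{FP}(1^k,pk,sk,f(m_1,m_2))$, even for a distinguisher knowing $pk,sk,ct_1,ct_2$. (2) A garbling scheme that is perfectly correct and secure: there is an efficient $S_{GS}$ such that, for every circuit $C$ and input $y$ of polynomial size, the garbled circuit together with the labels of $y$ is $\approx_c S_{GS}(1^k,1^{|C|},C(y))$, where $|C|$ comprises the numbers of inputs, gates and outputs. **Theorem.** privateMDI is correct: the client always outputs $M(x)$. It is secure against each single semi-honest party: there are probabilistic polynomial-time simulators such that, for all polynomial-size families of models, inputs $x$, and choices of the compromised server, the real view (input, randomness and received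 messages) of * the cloud server is $\approx_c S_{CS}(M)$, * the client is $\approx_c S_{C}(x,y)$ with $y=M(x)$, * a computing edge server is $\approx_c S_{ES,C}$, a garbler is $\approx_c S_{ES,G}$, and an evaluator is $\approx_c S_{ES,E}$, where these three simulators get neither $x$ nor $M$. Besides the stated arguments, each simulator gets $1^k$ and only the public parameters that concern its party: $q$ and $1^n$, and moreover $T$ and the kinds (linear or non-linear) of the layers (cloud); the number of non-linear layers and the kind of the last layer (client); the number of layers of the cluster (computing server); $T$, that number and the circuits it garbles (garbler); the sizes of the circuits it evaluates (evaluator). -/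

import Mathlib

open Filter

/-! ### A machine model with a step count

Data are S-expressions whose atoms are natural numbers written in binary.  Programs are terms of a
loop language on data with number arithmetic, a primitive measuring the length of a datum, and
random choices.  Every step is charged the length of the data it reads and writes. -/

/-- S-expressions with natural numbers as atoms. -/
inductive Data : Type
  | num (n : ℕ) : Data
  | pair (a b : Data) : Data

namespace Data

/-- Length of a datum; numbers are measured in binary. -/
def size : Data → ℕ
  | num n => Nat.size n + 1
  | pair a b => a.size + b.size + 1

/-- The number `n` written in unary (the string `1ⁿ`): a list of `n` atoms. -/
def unary : ℕ → Data
  | 0 => num 0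
  | n + 1 => pair (num 0) (unary n)

/-- Lists of data. -/
def ofList : List Data → Data
  | [] => num 0
  | d :: l => pair d (ofList l)

def fst : Data → Data
  | num _ => num 0
  | pair a _ => a

def snd : Data → Data
  | num _ => num 0
  | pair _ b => b

/-- Apply a binary operation to a pair of numbers; ill-formed arguments give `0`. -/
def arith (f : ℕ → ℕ → ℕ) : Data → Data
  | pair (num a) (num b) => num (f a b)
  | _ => num 0

/-- `1` on atoms, `0` on pairs. -/
def isNum : Data → Data
  | num _ => num 1
  | pair _ _ => num 0

/-- The number of repetitions of a loop, read from the first component. -/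
def loopCount : Data → ℕ
  | pair (num k) _ => k
  | _ => 0

/-- Truth value of a datum: everything except the atom `0` counts as true. -/
def truth : Data → Bool
  | num 0 => false
  | _ => true

end Data

/-- Probabilistic programs on data. -/
inductive Code : Type
  | id : Code
  | const (n : ℕ) : Code
  | fst : Code
  | snd : Code
  | pair (f g : Code) : Code
  | comp (f g : Code) : Code
  | add : Code
  | sub : Code
  | mul : Code
  | div : Code
  | mod : Code
  | xor : Code
  | lt : Code
  | isNum : Code
  | size : Code
  | rand : Code
  | ite (c f g : Code) : Code
  | loop (f : Code) : Code

namespace Code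

/-- One basic step turning `d` into `e`, together with its cost. -/
noncomputable def step (d e : Data) : PMF (Data × ℕ) :=
  PMF.pure (e, 1 + d.size + e.size)

/-- The random step: a uniform element of `{0, …, m - 1}` on input `m` (and `0` if `m = 0`). -/
noncomputable def randStep : Data → PMF (Data × ℕ)
  | Data.num (m + 1) =>
      (PMF.uniformOfFintype (Fin (m + 1))).bind fun i => step (Data.num (m + 1)) (Data.num i)
  | d => step d (Data.num 0)

/-- Repeat `F` a given number of times, adding up the costs. -/
noncomputable def iterate (F : Data → PMF (Data × ℕ)) : ℕ → Data × ℕ → PMF (Data × ℕ)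
  | 0, s => PMF.pure s
  | k + 1, s => (F s.1).bind fun t => iterate F k (t.1, s.2 + t.2 + 1)

/-- Joint distribution of the output and of the number of steps of a program on an input.
`comp f g` runs `g` first; `ite c f g` runs `f` if `c` returns a true datum and `g` otherwise;
`loop f` on `(k, s)` applies `f` to `s` exactly `k` times. -/
noncomputable def run : Code → Data → PMF (Data × ℕ)
  | id, d => step d d
  | const n, d => step d (Data.num n)
  | fst, d => step d d.fst
  | snd, d => step d d.snd
  | pair f g, d =>
      (f.run d).bind fun a => (g.run d).bind fun b =>
        PMF.pure (Data.pair a.1 b.1, a.2 + b.2 + 1)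
  | comp f g, d =>
      (g.run d).bind fun a => (f.run a.1).bind fun b => PMF.pure (b.1, a.2 + b.2 + 1)
  | add, d => step d (d.arith fun a b => a + b)
  | sub, d => step d (d.arith fun a b => a - b)
  | mul, d => step d (d.arith fun a b => a * b)
  | div, d => step d (d.arith fun a b => a / b)
  | mod, d => step d (d.arith fun a b => a % b)
  | xor, d => step d (d.arith fun a b => a ^^^ b)
  | lt, d => step d (d.arith fun a b => if a < b then 1 else 0)
  | isNum, d => step d d.isNum
  | size, d => step d (Data.num d.size)
  | rand, d => randStep d
  | ite c f g, d =>
      (c.run d).bind fun a =>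
        (if a.1.truth then f.run d else g.run d).bind fun b => PMF.pure (b.1, a.2 + b.2 + 1)
  | loop f, d => iterate f.run d.loopCount (d.snd, 1 + d.size)

/-- Distribution of the output of a program. -/
noncomputable def out (c : Code) (d : Data) : PMF Data := (c.run d).map Prod.fst

/-- Strict probabilistic polynomial time: on every input and for all random choices the number of
steps is at most a fixed polynomial in the length of the input. -/
def PolyTime (c : Code) : Prop :=
  ∃ p : Polynomial ℕ, ∀ d : Data, ∀ r ∈ (c.run d).support, r.2 ≤ p.eval d.size

end Code

/-! ### Encodings -/

/-- Types with a standard encoding as data. -/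
class ToData (α : Type*) where
  toData : α → Data


instance instToDataData : ToData Data := ⟨fun d => d⟩

instance instToDataNat : ToData ℕ := ⟨Data.num⟩

instance instToDataBool : ToData Bool := ⟨fun b => Data.num b.toNat⟩

instance instToDataBitVec (m : ℕ) : ToData (BitVec m) := ⟨fun v => Data.num v.toNat⟩

instance instToDataZMod (q : ℕ) : ToData (ZMod q) := ⟨fun a => Data.num a.val⟩

instance instToDataProd {α β : Type*} [ToData α] [ToData β] : ToData (α × β) :=
  ⟨fun p => Data.pair (ToData.toData p.1) (ToData.toData p.2)⟩

instance instToDataOption {α : Type*} [ToData α] : ToData (Option α) :=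
  ⟨fun o => o.elim (Data.num 0) fun a => Data.pair (Data.num 1) (ToData.toData a)⟩

instance instToDataList {α : Type*} [ToData α] : ToData (List α) :=
  ⟨fun l => Data.ofList (l.map ToData.toData)⟩

/-- A finite family is encoded as the list of its members, in increasing order of the indices. -/
instance instToDataPi {ι : Type*} [Fintype ι] [LinearOrder ι] {α : ι → Type*}
    [∀ i, ToData (α i)] :
    ToData ((i : ι) → α i) :=
  ⟨fun f => Data.ofList ((Finset.univ.sort fun a b : ι => a ≤ b).map fun i => ToData.toData (f i))⟩

instance instToDataMatrix {m n : ℕ} {α : Type*} [ToData α] : ToData (Matrix (Fin m) (Fin n) α) :=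
  ⟨fun A => ToData.toData fun i => fun j => A i j⟩

instance instFintypeBitVec (m : ℕ) : Fintype (BitVec m) :=
  Fintype.ofEquiv (Fin (2 ^ m)) ⟨BitVec.ofFin, BitVec.toFin, fun _ => rfl, fun _ => rfl⟩

/-- The uniform distribution. -/
noncomputable abbrev unif (α : Type*) [Fintype α] [Nonempty α] : PMF α := PMF.uniformOfFintype α

/-! ### Asymptotic notions -/

/-- Polynomially bounded functions of the security parameter. -/
def PolyBounded (f : ℕ → ℕ) : Prop := ∃ p : Polynomial ℕ, ∀ k, f k ≤ p.eval k

/-- The probability that the distinguisher `D` with advice `a` outputs `1` on a sample of `X`. -/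
noncomputable def acceptProb (D : Code) (k : ℕ) (a : Data) (X : PMF Data) : ℝ :=
  ((X.bind fun d => D.out (ToData.toData (Data.unary k, a, d))) (Data.num 1)).toReal

/-- Computational indistinguishability of two ensembles: the advantage of every probabilistic
polynomial-time distinguisher with polynomial-length advice is negligible. -/
def CompIndist (X Y : ℕ → PMF Data) : Prop :=
  ∀ D : Code, D.PolyTime → ∀ a : ℕ → Data, PolyBounded (fun k => (a k).size) →
    Asymptotics.SuperpolynomialDecay atTop (fun k : ℕ => (k : ℝ))
      fun k => |acceptProb D k (a k) (X k) - acceptProb D k (a k) (Y k)|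

/-! ### Linearly homomorphic encryption -/

/-- Syntax of a linearly homomorphic encryption scheme with message space `ℤ_q`, where `q` may
depend on the security parameter `k`.  Randomized algorithms read `coins(k)` random bits, and
ciphertexts have `ctLen(k)` bits.  A linear function `f (m₁, m₂) = a * m₁ + b * m₂` is given by its
coefficients `(a, b)`. -/
structure LHE (q : ℕ → ℕ) where
  coins : Polynomial ℕ
  ctLen : Polynomial ℕ
  /-- the pair `(pk, sk)` -/
  keygen : (k : ℕ) → BitVec (coins.eval k) → Data × Data
  enc : (k : ℕ) → Data → ZMod (q k) → BitVec (coins.eval k) → BitVec (ctLen.eval k)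
  dec : (k : ℕ) → Data → BitVec (ctLen.eval k) → ZMod (q k)
  eval : (k : ℕ) → Data → BitVec (ctLen.eval k) → BitVec (ctLen.eval k) →
    ZMod (q k) × ZMod (q k) → BitVec (coins.eval k) → BitVec (ctLen.eval k)

namespace LHE

variable {q : ℕ → ℕ}

/-- Random bits for one call. -/
abbrev Coin (HE : LHE q) (k : ℕ) : Type := BitVec (HE.coins.eval k)

/-- Ciphertexts. -/
abbrev Ct (HE : LHE q) (k : ℕ) : Type := BitVec (HE.ctLen.eval k)

/-- The four algorithms run in polynomial time. -/
def Efficient (HE : LHE q) : Prop :=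
  (∃ c : Code, c.PolyTime ∧ ∀ (k : ℕ) (ω : HE.Coin k),
    c.out (ToData.toData (Data.unary k, ω)) = PMF.pure (ToData.toData (HE.keygen k ω))) ∧
  (∃ c : Code, c.PolyTime ∧ ∀ (k : ℕ) (pk : Data) (m : ZMod (q k)) (ρ : HE.Coin k),
    c.out (ToData.toData (Data.unary k, pk, m, ρ)) =
      PMF.pure (ToData.toData (HE.enc k pk m ρ))) ∧
  (∃ c : Code, c.PolyTime ∧ ∀ (k : ℕ) (sk : Data) (ct : HE.Ct k),
    c.out (ToData.toData (Data.unary k, sk, ct)) = PMF.pure (ToData.toData (HE.dec k sk ct))) ∧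
  (∃ c : Code, c.PolyTime ∧ ∀ (k : ℕ) (pk : Data) (ct₁ ct₂ : HE.Ct k)
      (f : ZMod (q k) × ZMod (q k)) (ρ : HE.Coin k),
    c.out (ToData.toData (Data.unary k, pk, ct₁, ct₂, f, ρ)) =
      PMF.pure (ToData.toData (HE.eval k pk ct₁ ct₂ f ρ)))

/-- `HE.Encrypts k pk ct m`: the ciphertext `ct` encrypts `m` under `pk`, i.e. it is an output of
the encryption algorithm on `m`, or results from homomorphic evaluations that lead to `m`. -/
inductive Encrypts (HE : LHE q) (k : ℕ) (pk : Data) : HE.Ct k → ZMod (q k) → Prop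
  | enc (m : ZMod (q k)) (ρ : HE.Coin k) : Encrypts HE k pk (HE.enc k pk m ρ) m
  | eval {ct₁ ct₂ : HE.Ct k} {m₁ m₂ : ZMod (q k)} (a b : ZMod (q k)) (ρ : HE.Coin k) :
      Encrypts HE k pk ct₁ m₁ → Encrypts HE k pk ct₂ m₂ →
      Encrypts HE k pk (HE.eval k pk ct₁ ct₂ (a, b) ρ) (a * m₁ + b * m₂)

/-- Correctness and homomorphism: a ciphertext that encrypts `m` is decrypted to `m`. -/
def Correct (HE : LHE q) : Prop :=
  ∀ (k : ℕ) (ω : HE.Coin k) (ct : HE.Ct k) (m : ZMod (q k)),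
    HE.Encrypts k (HE.keygen k ω).1 ct m → HE.dec k (HE.keygen k ω).2 ct = m

/-- Semantic security: encryptions of any two messages are indistinguishable given `pk`. -/
def SemanticallySecure (HE : LHE q) : Prop :=
  ∀ m₀ m₁ : (k : ℕ) → ZMod (q k),
    CompIndist
      (fun k => (unif (HE.Coin k × HE.Coin k)).map fun ω =>
        ToData.toData ((HE.keygen k ω.1).1, HE.enc k (HE.keygen k ω.1).1 (m₀ k) ω.2))
      (fun k => (unif (HE.Coin k × HE.Coin k)).map fun ω =>
        ToData.toData ((HE.keygen k ω.1).1, HE.enc k (HE.keygen k ω.1).1 (m₁ k) ω.2))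

/-- Function privacy: even for the owner of the secret key and for known input ciphertexts, an
evaluated ciphertext can be simulated from the keys and the value `f (m₁, m₂)` alone. -/
def FunctionPrivate (HE : LHE q) : Prop :=
  ∃ S : Code, S.PolyTime ∧
    ∀ (ω : (k : ℕ) → HE.Coin k) (ct₁ ct₂ : (k : ℕ) → HE.Ct k) (m₁ m₂ a b : (k : ℕ) → ZMod (q k)),
      (∀ k, HE.Encrypts k (HE.keygen k (ω k)).1 (ct₁ k) (m₁ k)) →
      (∀ k, HE.Encrypts k (HE.keygen k (ω k)).1 (ct₂ k) (m₂ k)) →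
      CompIndist
        (fun k => (unif (HE.Coin k)).map fun ρ =>
          ToData.toData (HE.eval k (HE.keygen k (ω k)).1 (ct₁ k) (ct₂ k) (a k, b k) ρ))
        (fun k => S.out (ToData.toData
          (Data.unary k, (HE.keygen k (ω k)).1, (HE.keygen k (ω k)).2, a k * m₁ k + b k * m₂ k)))

/-- A secure linearly homomorphic encryption scheme. -/
structure Secure (HE : LHE q) : Prop where
  efficient : HE.Efficient
  correct : HE.Correct
  semanticallySecure : HE.SemanticallySecure
  functionPrivate : HE.FunctionPrivate

end LHE

/-! ### Boolean circuits and garbling schemes -/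

/-- Boolean circuits with `m` input and `r` output bits: a list of NAND gates, each reading two
earlier wires (wires are numbered from the inputs on; a nonexistent wire carries `false`). -/
structure Circuit (m r : ℕ) where
  gates : List (ℕ × ℕ)
  outputs : Fin r → ℕ

namespace Circuit

variable {m r : ℕ}

/-- The values on all wires. -/
def wires (C : Circuit m r) (inp : Fin m → Bool) : List Bool :=
  C.gates.foldl (fun ws g => ws ++ [!(ws.getD g.1 false && ws.getD g.2 false)]) (List.ofFn inp)

def eval (C : Circuit m r) (inp : Fin m → Bool) : Fin r → Bool :=
  fun j => (C.wires inp).getD (C.outputs j) false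

/-- `|C|`: the number of inputs, gates and outputs. -/
def size (C : Circuit m r) : ℕ := m + C.gates.length + r

/-- Length of the description of the circuit. -/
def descLen (C : Circuit m r) : ℕ :=
  m + (ToData.toData C.gates).size + (ToData.toData C.outputs).size

instance instToDataCircuit : ToData (Circuit m r) := ⟨fun C => ToData.toData (C.gates, C.outputs)⟩

/-- The string `1^|C|`, as the numbers of inputs, gates and outputs in unary. -/
def sizeData (C : Circuit m r) : Data :=
  ToData.toData (Data.unary m, Data.unary C.gates.length, Data.unary r)

end Circuit

/-- Syntax of a garbling scheme.  Labels have `labelLen(k)` bits; garbling `C` uses `coins(k + |C|)`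
random bits and yields the garbled circuit and two labels for each input bit. -/
structure GarblingScheme where
  coins : Polynomial ℕ
  labelLen : Polynomial ℕ
  garble : (k : ℕ) → {m r : ℕ} → (C : Circuit m r) → BitVec (coins.eval (k + C.size)) →
    Data × (Fin m → Bool → BitVec (labelLen.eval k))
  eval : (k m r : ℕ) → Data → (Fin m → BitVec (labelLen.eval k)) → Fin r → Bool

namespace GarblingScheme

/-- Labels of input bits. -/
abbrev Label (GS : GarblingScheme) (k : ℕ) : Type := BitVec (GS.labelLen.eval k)

/-- Random bits for garbling a circuit. -/
abbrev Coin (GS : GarblingScheme) (k : ℕ) {m r : ℕ} (C : Circuit m r) : Type :=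
  BitVec (GS.coins.eval (k + C.size))

/-- Both algorithms run in polynomial time. -/
def Efficient (GS : GarblingScheme) : Prop :=
  (∃ c : Code, c.PolyTime ∧ ∀ (k m r : ℕ) (C : Circuit m r) (ρ : GS.Coin k C),
    c.out (ToData.toData (Data.unary k, Data.unary m, Data.unary r, C, ρ)) =
      PMF.pure (ToData.toData (GS.garble k C ρ))) ∧
  (∃ c : Code, c.PolyTime ∧ ∀ (k m r : ℕ) (gc : Data) (lab : Fin m → GS.Label k),
    c.out (ToData.toData (Data.unary k, Data.unary m, Data.unary r, gc, lab)) =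
      PMF.pure (ToData.toData (GS.eval k m r gc lab)))

/-- The garbled circuit evaluates to `C(inp)` on the labels of `inp`. -/
def Correct (GS : GarblingScheme) : Prop :=
  ∀ (k m r : ℕ) (C : Circuit m r) (ρ : GS.Coin k C) (inp : Fin m → Bool),
    GS.eval k m r (GS.garble k C ρ).1 (fun i => (GS.garble k C ρ).2 i (inp i)) = C.eval inp

/-- The garbled circuit and the labels of one input can be simulated from `|C|` and `C(inp)`. -/
def Private (GS : GarblingScheme) : Prop :=
  ∃ S : Code, S.PolyTime ∧
    ∀ (m r : ℕ → ℕ) (C : (k : ℕ) → Circuit (m k) (r k)) (inp : (k : ℕ) → Fin (m k) → Bool),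
      PolyBounded (fun k => (C k).descLen) →
      CompIndist
        (fun k => (unif (GS.Coin k (C k))).map fun ρ =>
          ToData.toData ((GS.garble k (C k) ρ).1, fun i => (GS.garble k (C k) ρ).2 i (inp k i)))
        (fun k => S.out (ToData.toData
          (Data.unary k, (C k).sizeData, (C k).eval (inp k))))

/-- A secure garbling scheme. -/
structure Secure (GS : GarblingScheme) : Prop where
  efficient : GS.Efficient
  correct : GS.Correct
  priv : GS.Private

end GarblingScheme

/-! ### Additive secret sharing -/

/-- The `T + 1` shares of `x`: the first `T` are the random values `a`, the last one makes the sum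
equal to `x`. -/
def addShr {G : Type*} [AddCommGroup G] {T : ℕ} (x : G) (a : Fin T → G) : Fin (T + 1) → G :=
  Fin.snoc (α := fun _ => G) a (x - ∑ v, a v)

/-- Reconstruction. -/
def addRe {G : Type*} [AddCommGroup G] {T : ℕ} (a : Fin (T + 1) → G) : G := ∑ v, a v

/-! ### Three-party oblivious transfer

The client holds `i` and `b`, the garbler `k₀, k₁, u₀, u₁`, the evaluator `u₀, u₁, b`. -/

namespace OT

/-- client to garbler -/
def msg₁ (i b : Bool) : Bool := Bool.xor i b

/-- garbler to client, on receiving the bit `e` -/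
def msg₂ {κ : ℕ} (K u : Bool → BitVec κ) (e : Bool) : BitVec κ × BitVec κ :=
  (K false ^^^ u e, K true ^^^ u (!e))

/-- client to evaluator, on receiving the masked labels `c` -/
def msg₃ {κ : ℕ} (i : Bool) (c : BitVec κ × BitVec κ) : BitVec κ := if i then c.2 else c.1

/-- the label obtained by the evaluator from the message `c` -/
def output {κ : ℕ} (u : Bool → BitVec κ) (b : Bool) (c : BitVec κ) : BitVec κ := c ^^^ u b

end OT

/-! ### Models and their distribution over clusters -/

/-- Vectors over `ℤ_q`. -/
abbrev Vec (q n : ℕ) : Type := Fin n → ZMod q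

/-- Number of bits of an element of `ℤ_q`. -/
def bitLen (q : ℕ) : ℕ := Nat.clog 2 q

/-- Binary representation of a vector. -/
def toBits {q n : ℕ} (v : Vec q n) : Fin (n * bitLen q) → Bool :=
  fun j => (v (finProdFinEquiv.symm j).1).val.testBit (finProdFinEquiv.symm j).2

/-- The vector with a given binary representation. -/
def ofBits {q n : ℕ} (w : Fin (n * bitLen q) → Bool) : Vec q n :=
  fun i => ∑ t : Fin (bitLen q), if w (finProdFinEquiv (i, t)) then 2 ^ (t : ℕ) else 0

/-- A non-linear component of a layer: the function itself, and the boolean circuit that gets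
`w` (from the garbler), `z` and `r` (from the client) and returns `fn (w + z) - r`. -/
structure Nonlin (q n : ℕ) where
  fn : Vec q n → Vec q n
  circuit : Circuit (n * bitLen q + (n * bitLen q + n * bitLen q)) (n * bitLen q)
  spec : ∀ w z r : Vec q n,
    circuit.eval (Fin.append (toBits w) (Fin.append (toBits z) (toBits r))) =
      toBits (fn (w + z) - r)

/-- The public parameters: dimension `n`, `T` computing servers in each of `P` clusters, `L` layers;
cluster `j` processes the layers `l` with `bd j ≤ l < bd (j + 1)`; a layer consists of a linear map
followed by a non-linear component, if it has one. -/
structure Arch (q : ℕ) where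
  n : ℕ
  T : ℕ
  P : ℕ
  L : ℕ
  T_pos : 0 < T
  L_pos : 0 < L
  bd : ℕ → ℕ
  bd_zero : bd 0 = 0
  bd_last : bd P = L
  bd_mono : Monotone bd
  layer : Fin L → Option (Nonlin q n)

namespace Arch

variable {q : ℕ}

/-- Layer `l` has a non-linear component. -/
abbrev IsNL (A : Arch q) (l : Fin A.L) : Prop := (A.layer l).isSome = true

/-- Layer `l` is assigned to cluster `j`. -/
abbrev InCluster (A : Arch q) (j : Fin A.P) (l : Fin A.L) : Prop :=
  A.bd j ≤ l ∧ (l : ℕ) < A.bd (j + 1)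

/-- The layers with a non-linear component. -/
abbrev NL (A : Arch q) : Type := {l : Fin A.L // A.IsNL l}

/-- The layers of a cluster. -/
abbrev CL (A : Arch q) (j : Fin A.P) : Type := {l : Fin A.L // A.InCluster j l}

/-- The layers of a cluster with a non-linear component. -/
abbrev CNL (A : Arch q) (j : Fin A.P) : Type := {l : A.NL // A.InCluster j l.1}

/-- The last layer. -/
def last (A : Arch q) : Fin A.L := ⟨A.L - 1, Nat.sub_lt A.L_pos Nat.one_pos⟩

/-- The non-linear component of a layer that has one. -/
def nonlin (A : Arch q) (l : A.NL) : Nonlin q A.n := (A.layer l.1).get l.2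

/-- Number of bits of a vector. -/
abbrev bits (A : Arch q) : ℕ := A.n * bitLen q

/-- Size of the public parameters. -/
def size (A : Arch q) : ℕ :=
  A.n + A.T + A.L + Nat.size q + ∑ l : A.NL, (A.nonlin l).circuit.descLen

/-- Model parameters: one matrix for each layer. -/
abbrev Model (A : Arch q) : Type := Fin A.L → Matrix (Fin A.n) (Fin A.n) (ZMod q)

/-- The input of layer `l` (counted from `0`) in the plain evaluation of the model on `x`. -/
def act (A : Arch q) (M : A.Model) (x : Vec q A.n) : ℕ → Vec q A.n
  | 0 => x
  | l + 1 =>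
      if h : l < A.L then
        if hn : A.IsNL ⟨l, h⟩ then
          (A.nonlin ⟨⟨l, h⟩, hn⟩).fn ((M ⟨l, h⟩).mulVec (A.act M x l))
        else (M ⟨l, h⟩).mulVec (A.act M x l)
      else A.act M x l

/-- The inference result `M(x)`. -/
def infer (A : Arch q) (M : A.Model) (x : Vec q A.n) : Vec q A.n := A.act M x A.L

end Arch

/-! ### Inference protocols and their security -/

/-- What a run of an inference protocol produces for security parameter `k`: the output of the
client and the views of the parties, as probability distributions. -/
structure InferenceProtocol (q : ℕ → ℕ) where
  output : (k : ℕ) → (A : Arch (q k)) → A.Model → Vec (q k) A.n → PMF (Vec (q k) A.n)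
  viewCloud : (k : ℕ) → (A : Arch (q k)) → A.Model → Vec (q k) A.n → PMF Data
  viewClient : (k : ℕ) → (A : Arch (q k)) → A.Model → Vec (q k) A.n → PMF Data
  viewComputing : (k : ℕ) → (A : Arch (q k)) → A.Model → Vec (q k) A.n →
    Fin A.P → Fin A.T → PMF Data
  viewGarbler : (k : ℕ) → (A : Arch (q k)) → A.Model → Vec (q k) A.n → Fin A.P → PMF Data
  viewEvaluator : (k : ℕ) → (A : Arch (q k)) → A.Model → Vec (q k) A.n → Fin A.P → PMF Data

/-- Public information of the cloud server: dimension, number of computing servers per cluster,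
kinds of the layers. -/
def infoCloud {q : ℕ} (k : ℕ) (A : Arch q) : Data :=
  ToData.toData (Data.unary k, q, Data.unary A.n, Data.unary A.T,
    fun l : Fin A.L => (A.layer l).isSome)

/-- Public information of the client: dimension, number of non-linear layers, kind of the last
layer. -/
def infoClient {q : ℕ} (k : ℕ) (A : Arch q) : Data :=
  ToData.toData (Data.unary k, q, Data.unary A.n, Data.unary (Fintype.card A.NL),
    (A.layer A.last).isSome)

/-- Public information of a computing server: dimension, number of layers of its cluster. -/
def infoComputing {q : ℕ} (k : ℕ) (A : Arch q) (j : Fin A.P) : Data :=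
  ToData.toData (Data.unary k, q, Data.unary A.n, Data.unary (Fintype.card (A.CL j)))

/-- Public information of a garbler: dimension, number of computing servers, number of layers of its
cluster, and the circuits that it garbles. -/
def infoGarbler {q : ℕ} (k : ℕ) (A : Arch q) (j : Fin A.P) : Data :=
  ToData.toData (Data.unary k, q, Data.unary A.n, Data.unary A.T,
    Data.unary (Fintype.card (A.CL j)), fun l : A.CNL j => (A.nonlin l.1).circuit)

/-- Public information of an evaluator: dimension, and the sizes of the circuits that it
evaluates. -/
def infoEvaluator {q : ℕ} (k : ℕ) (A : Arch q) (j : Fin A.P) : Data :=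
  ToData.toData (Data.unary k, q, Data.unary A.n,
    fun l : A.CNL j => (A.nonlin l.1).circuit.sizeData)

namespace InferenceProtocol

variable {q : ℕ → ℕ}

/-- The client always obtains `M(x)`. -/
def Correct (Pi : InferenceProtocol q) : Prop :=
  ∀ (k : ℕ) (A : Arch (q k)) (M : A.Model) (x : Vec (q k) A.n),
    Pi.output k A M x = PMF.pure (A.infer M x)

/-- The view of the cloud server is simulated from `M`. -/
def SecureCloud (Pi : InferenceProtocol q) : Prop :=
  ∃ S : Code, S.PolyTime ∧
    ∀ (A : (k : ℕ) → Arch (q k)) (M : (k : ℕ) → (A k).Model) (x : (k : ℕ) → Vec (q k) (A k).n),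
      PolyBounded (fun k => (A k).size) →
      CompIndist (fun k => Pi.viewCloud k (A k) (M k) (x k))
        (fun k => S.out (ToData.toData (infoCloud k (A k), M k)))

/-- The view of the client is simulated from `x` and the output of the inference. -/
def SecureClient (Pi : InferenceProtocol q) : Prop :=
  ∃ S : Code, S.PolyTime ∧
    ∀ (A : (k : ℕ) → Arch (q k)) (M : (k : ℕ) → (A k).Model) (x : (k : ℕ) → Vec (q k) (A k).n),
      PolyBounded (fun k => (A k).size) →
      CompIndist (fun k => Pi.viewClient k (A k) (M k) (x k))
        (fun k => S.out (ToData.toData (infoClient k (A k), x k, (A k).infer (M k) (x k))))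

/-- The view of a computing server is simulated without any input. -/
def SecureComputing (Pi : InferenceProtocol q) : Prop :=
  ∃ S : Code, S.PolyTime ∧
    ∀ (A : (k : ℕ) → Arch (q k)) (M : (k : ℕ) → (A k).Model) (x : (k : ℕ) → Vec (q k) (A k).n)
      (j : (k : ℕ) → Fin (A k).P) (v : (k : ℕ) → Fin (A k).T),
      PolyBounded (fun k => (A k).size) →
      CompIndist (fun k => Pi.viewComputing k (A k) (M k) (x k) (j k) (v k))
        (fun k => S.out (infoComputing k (A k) (j k)))

/-- The view of a garbler is simulated without any input. -/
def SecureGarbler (Pi : InferenceProtocol q) : Prop :=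
  ∃ S : Code, S.PolyTime ∧
    ∀ (A : (k : ℕ) → Arch (q k)) (M : (k : ℕ) → (A k).Model) (x : (k : ℕ) → Vec (q k) (A k).n)
      (j : (k : ℕ) → Fin (A k).P),
      PolyBounded (fun k => (A k).size) →
      CompIndist (fun k => Pi.viewGarbler k (A k) (M k) (x k) (j k))
        (fun k => S.out (infoGarbler k (A k) (j k)))

/-- The view of an evaluator is simulated without any input. -/
def SecureEvaluator (Pi : InferenceProtocol q) : Prop :=
  ∃ S : Code, S.PolyTime ∧
    ∀ (A : (k : ℕ) → Arch (q k)) (M : (k : ℕ) → (A k).Model) (x : (k : ℕ) → Vec (q k) (A k).n)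
      (j : (k : ℕ) → Fin (A k).P),
      PolyBounded (fun k => (A k).size) →
      CompIndist (fun k => Pi.viewEvaluator k (A k) (M k) (x k) (j k))
        (fun k => S.out (infoEvaluator k (A k) (j k)))

/-- Correctness, and security against each semi-honest party. -/
structure Secure (Pi : InferenceProtocol q) : Prop where
  correct : Pi.Correct
  cloud : Pi.SecureCloud
  client : Pi.SecureClient
  computing : Pi.SecureComputing
  garbler : Pi.SecureGarbler
  evaluator : Pi.SecureEvaluator

end InferenceProtocol

/-! ### The protocol privateMDI -/

namespace PrivateMDI

variable {q : ℕ → ℕ}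

/-- Randomness of the cloud server: the masks `s_l`, the first `T` shares of `M_l` and of `s_l`, and
the coins of the encryptions of `s_l` and of the homomorphic evaluations. -/
abbrev CloudTape (HE : LHE q) (k : ℕ) (A : Arch (q k)) : Type :=
  (Fin A.L → Vec (q k) A.n) ×
  (Fin A.L → Fin A.T → Matrix (Fin A.n) (Fin A.n) (ZMod (q k))) ×
  (Fin A.L → Fin A.T → Vec (q k) A.n) ×
  (Fin A.L → Fin A.n → HE.Coin k) ×
  (Fin A.L → Fin A.n → Fin A.n → HE.Coin k)

/-- Randomness of the client: the coins of the key generation, the first mask and the coins of its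
encryption, and for each non-linear layer the mask of its output and the coins of its encryption. -/
abbrev ClientTape (HE : LHE q) (k : ℕ) (A : Arch (q k)) : Type :=
  HE.Coin k × (Vec (q k) A.n × (Fin A.n → HE.Coin k)) ×
    (A.NL → Vec (q k) A.n × (Fin A.n → HE.Coin k))

/-- Randomness of the garblers: the coins for garbling the circuit of each non-linear layer. -/
abbrev GarblerTape (GS : GarblingScheme) (k : ℕ) (A : Arch (q k)) : Type :=
  (l : A.NL) → GS.Coin k (A.nonlin l).circuit

/-- The bits `b` shared by client and evaluator: one for each oblivious transfer. -/
abbrev TapeB {q₀ : ℕ} (A : Arch q₀) : Type := A.NL → Fin (A.bits + A.bits) → Bool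

/-- The strings `u₀, u₁` shared by garbler and evaluator: one pair for each oblivious transfer. -/
abbrev TapeU (GS : GarblingScheme) (k : ℕ) {q₀ : ℕ} (A : Arch q₀) : Type :=
  A.NL → Fin (A.bits + A.bits) → Bool → GS.Label k

/-- The randomness of all parties. -/
abbrev Tape (HE : LHE q) (GS : GarblingScheme) (k : ℕ) (A : Arch (q k)) : Type :=
  CloudTape HE k A × ClientTape HE k A × GarblerTape GS k A × TapeB A × TapeU GS k A

section Tape

variable {HE : LHE q} {GS : GarblingScheme} {k : ℕ} {A : Arch (q k)}

def cloudT (t : Tape HE GS k A) : CloudTape HE k A := t.1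
def s (t : Tape HE GS k A) : Fin A.L → Vec (q k) A.n := t.1.1
def randM (t : Tape HE GS k A) : Fin A.L → Fin A.T → Matrix (Fin A.n) (Fin A.n) (ZMod (q k)) :=
  t.1.2.1
def randS (t : Tape HE GS k A) : Fin A.L → Fin A.T → Vec (q k) A.n := t.1.2.2.1
def encSCoin (t : Tape HE GS k A) : Fin A.L → Fin A.n → HE.Coin k := t.1.2.2.2.1
def evalCoin (t : Tape HE GS k A) : Fin A.L → Fin A.n → Fin A.n → HE.Coin k := t.1.2.2.2.2
def clientT (t : Tape HE GS k A) : ClientTape HE k A := t.2.1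
def keyCoin (t : Tape HE GS k A) : HE.Coin k := t.2.1.1
def rFirst (t : Tape HE GS k A) : Vec (q k) A.n := t.2.1.2.1.1
def encFirstCoin (t : Tape HE GS k A) : Fin A.n → HE.Coin k := t.2.1.2.1.2
/-- `r t l` is the mask of the output of the non-linear layer `l`. -/
def r (t : Tape HE GS k A) (l : A.NL) : Vec (q k) A.n := (t.2.1.2.2 l).1
def encRCoin (t : Tape HE GS k A) (l : A.NL) : Fin A.n → HE.Coin k := (t.2.1.2.2 l).2
def garbleCoin (t : Tape HE GS k A) (l : A.NL) : GS.Coin k (A.nonlin l).circuit := t.2.2.1 l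
def b (t : Tape HE GS k A) : TapeB A := t.2.2.2.1
def u (t : Tape HE GS k A) : TapeU GS k A := t.2.2.2.2

/-! #### Offline phase -/

def pk (t : Tape HE GS k A) : Data := (HE.keygen k (keyCoin t)).1
def sk (t : Tape HE GS k A) : Data := (HE.keygen k (keyCoin t)).2

/-- client to cloud: the encryption of the first mask -/
def encFirst (t : Tape HE GS k A) : Fin A.n → HE.Ct k :=
  fun i => HE.enc k (pk t) (rFirst t i) (encFirstCoin t i)

/-- client to cloud: the encryption of the mask of the output of a non-linear layer -/
def encR (t : Tape HE GS k A) (l : A.NL) : Fin A.n → HE.Ct k :=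
  fun i => HE.enc k (pk t) (r t l i) (encRCoin t l i)

/-- The encryption of `M_l · c + s_l`, computed by the cloud from the encryption `ct` of `c`:
for each row, start with the encryption of the entry of `s_l` and add up the multiples of the
entries of `c` one after the other. -/
def linEnc (M : A.Model) (t : Tape HE GS k A) (l : Fin A.L) (ct : Fin A.n → HE.Ct k) :
    Fin A.n → HE.Ct k :=
  fun i => (List.finRange A.n).foldl
    (fun acc i' => HE.eval k (pk t) acc (ct i') (1, M l i i') (evalCoin t l i i'))
    (HE.enc k (pk t) (s t l i) (encSCoin t l i))

/-- The ciphertexts `c_l^enc` (with layers counted from `0`). -/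
def cEnc (M : A.Model) (t : Tape HE GS k A) : ℕ → Fin A.n → HE.Ct k
  | 0 => encFirst t
  | l + 1 =>
      if h : l < A.L then
        if hn : A.IsNL ⟨l, h⟩ then encR t ⟨⟨l, h⟩, hn⟩
        else linEnc M t ⟨l, h⟩ (cEnc M t l)
      else cEnc M t l

/-- cloud to client, for a non-linear layer: the encryption of `M_l · c_l + s_l` -/
def zEnc (M : A.Model) (t : Tape HE GS k A) (l : A.NL) : Fin A.n → HE.Ct k :=
  linEnc M t l.1 (cEnc M t l.1)

/-- The vector `M_l · c_l + s_l` decrypted by the client. -/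
def z (M : A.Model) (t : Tape HE GS k A) (l : A.NL) : Vec (q k) A.n :=
  fun i => HE.dec k (sk t) (zEnc M t l i)

/-- cloud to client, if the last layer is linear: the ciphertext `c_{L+1}^enc` -/
def finalEnc (M : A.Model) (t : Tape HE GS k A) : Option (Fin A.n → HE.Ct k) :=
  if A.IsNL A.last then none else some (cEnc M t A.L)

/-- cloud to server `v`: its share of `M_l`; the servers `v < T` are the computing servers, and
`v = T` is the garbler -/
def shareM (M : A.Model) (t : Tape HE GS k A) (l : Fin A.L) :
    Fin (A.T + 1) → Matrix (Fin A.n) (Fin A.n) (ZMod (q k)) :=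
  addShr (M l) (randM t l)

/-- cloud to server `v`: its share of `s_l` -/
def shareS (t : Tape HE GS k A) (l : Fin A.L) : Fin (A.T + 1) → Vec (q k) A.n :=
  addShr (s t l) (randS t l)

/-- garbler to evaluator: the garbled circuit -/
def gc (t : Tape HE GS k A) (l : A.NL) : Data :=
  (GS.garble k (A.nonlin l).circuit (garbleCoin t l)).1

/-- The labels of the input bits of the garbler. -/
def garblerLabels (t : Tape HE GS k A) (l : A.NL) : Fin A.bits → Bool → GS.Label k :=
  fun i => (GS.garble k (A.nonlin l).circuit (garbleCoin t l)).2 (Fin.castAdd (A.bits + A.bits) i)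

/-- The labels of the input bits of the client. -/
def clientLabels (t : Tape HE GS k A) (l : A.NL) : Fin (A.bits + A.bits) → Bool → GS.Label k :=
  fun i => (GS.garble k (A.nonlin l).circuit (garbleCoin t l)).2 (Fin.natAdd A.bits i)

/-- The input bits of the client: `M_l · c_l + s_l` and the mask of the output. -/
def clientBits (M : A.Model) (t : Tape HE GS k A) (l : A.NL) : Fin (A.bits + A.bits) → Bool :=
  Fin.append (toBits (z M t l)) (toBits (r t l))

/-- client to garbler -/
def ot₁ (M : A.Model) (t : Tape HE GS k A) (l : A.NL) : Fin (A.bits + A.bits) → Bool :=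
  fun i => OT.msg₁ (clientBits M t l i) (b t l i)

/-- garbler to client -/
def ot₂ (M : A.Model) (t : Tape HE GS k A) (l : A.NL) :
    Fin (A.bits + A.bits) → GS.Label k × GS.Label k :=
  fun i => OT.msg₂ (clientLabels t l i) (u t l i) (ot₁ M t l i)

/-- client to evaluator -/
def ot₃ (M : A.Model) (t : Tape HE GS k A) (l : A.NL) : Fin (A.bits + A.bits) → GS.Label k :=
  fun i => OT.msg₃ (clientBits M t l i) (ot₂ M t l i)

/-! #### Online phase -/

/-- The result of server `v` on the masked input `d` of layer `l` (for a computing server: its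
message to the garbler). -/
def linOut (M : A.Model) (t : Tape HE GS k A) (l : Fin A.L) (d : Vec (q k) A.n)
    (v : Fin (A.T + 1)) : Vec (q k) A.n :=
  (shareM M t l v).mulVec d - shareS t l v

/-- The vector `M_l · d - s_l` reconstructed by the garbler. -/
def lin (M : A.Model) (t : Tape HE GS k A) (l : Fin A.L) (d : Vec (q k) A.n) : Vec (q k) A.n :=
  addRe (linOut M t l d)

/-- garbler to evaluator: the labels of its input `w` -/
def onlineLabels (t : Tape HE GS k A) (l : A.NL) (w : Vec (q k) A.n) : Fin A.bits → GS.Label k :=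
  fun i => garblerLabels t l i (toBits w i)

/-- evaluator to garbler: the result of the evaluation of the garbled circuit -/
def evalOut (M : A.Model) (t : Tape HE GS k A) (l : A.NL) (w : Vec (q k) A.n) : Vec (q k) A.n :=
  ofBits (GS.eval k _ _ (gc t l)
    (Fin.append (onlineLabels t l w) fun i => OT.output (u t l i) (b t l i) (ot₃ M t l i)))

/-- The masked input `x_l - c_l` of layer `l` (counted from `0`), as it is computed in the
protocol. -/
def masked (M : A.Model) (x : Vec (q k) A.n) (t : Tape HE GS k A) : ℕ → Vec (q k) A.n
  | 0 => x - rFirst t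
  | l + 1 =>
      if h : l < A.L then
        if hn : A.IsNL ⟨l, h⟩ then
          evalOut M t ⟨⟨l, h⟩, hn⟩ (lin M t ⟨l, h⟩ (masked M x t l))
        else lin M t ⟨l, h⟩ (masked M x t l)
      else masked M x t l

/-- The mask `c_{L+1}` known to the client. -/
def cFinal (M : A.Model) (t : Tape HE GS k A) : Vec (q k) A.n :=
  if h : A.IsNL A.last then r t ⟨A.last, h⟩ else fun i => HE.dec k (sk t) (cEnc M t A.L i)

/-- The output of the client. -/
def clientOut (M : A.Model) (x : Vec (q k) A.n) (t : Tape HE GS k A) : Vec (q k) A.n :=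
  masked M x t A.L + cFinal M t

/-! #### Views: input, randomness, received messages -/

def cloudView (M : A.Model) (t : Tape HE GS k A) : Data :=
  ToData.toData (M, cloudT t, pk t, encFirst t, encR t)

def clientView (M : A.Model) (x : Vec (q k) A.n) (t : Tape HE GS k A) : Data :=
  ToData.toData (x, clientT t, b t, zEnc M t, ot₂ M t, finalEnc M t, masked M x t A.L)

def computingView (M : A.Model) (x : Vec (q k) A.n) (j : Fin A.P) (v : Fin A.T)
    (t : Tape HE GS k A) : Data :=
  ToData.toData fun l : A.CL j =>
    (shareM M t l.1 v.castSucc, shareS t l.1 v.castSucc, masked M x t l.1)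

set_option synthInstance.maxSize 1000 in
/-- The garbler of cluster `j` receives its shares, the bits of the oblivious transfers, the masked
input of the cluster, the results of the computing servers, and those of the evaluator. -/
def garblerView (M : A.Model) (x : Vec (q k) A.n) (j : Fin A.P) (t : Tape HE GS k A) : Data :=
  ToData.toData
    (fun l : A.CNL j => ((A.nonlin l.1).circuit, garbleCoin t l.1, u t l.1),
      fun l : A.CL j => (shareM M t l.1 (Fin.last A.T), shareS t l.1 (Fin.last A.T)),
      fun l : A.CNL j => ot₁ M t l.1,
      masked M x t (A.bd j),
      fun l : A.CL j => fun v : Fin A.T => linOut M t l.1 (masked M x t l.1) v.castSucc,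
      fun l : A.CNL j => masked M x t (l.1.1 + 1))

/-- The evaluator of cluster `j` receives the garbled circuits, the last messages of the oblivious
transfers, and the labels of the inputs of the garbler. -/
def evaluatorView (M : A.Model) (x : Vec (q k) A.n) (j : Fin A.P) (t : Tape HE GS k A) : Data :=
  ToData.toData fun l : A.CNL j =>
    ((b t l.1, u t l.1), gc t l.1, ot₃ M t l.1,
      onlineLabels t l.1 (lin M t l.1.1 (masked M x t l.1.1)))

end Tape

set_option synthInstance.maxSize 1000 in
/-- The randomness of a run: uniform and independent. -/
noncomputable def sample {q : ℕ → ℕ} [∀ k, NeZero (q k)] (HE : LHE q) (GS : GarblingScheme) (k : ℕ)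
    (A : Arch (q k)) : PMF (Tape HE GS k A) := unif (Tape HE GS k A)

/-- The protocol privateMDI. -/
noncomputable def protocol {q : ℕ → ℕ} [∀ k, NeZero (q k)] (HE : LHE q) (GS : GarblingScheme) :
    InferenceProtocol q where
  output k A M x := (sample HE GS k A).map (clientOut M x)
  viewCloud k A M _ := (sample HE GS k A).map (cloudView M)
  viewClient k A M x := (sample HE GS k A).map (clientView M x)
  viewComputing k A M x j v := (sample HE GS k A).map (computingView M x j v)
  viewGarbler k A M x j := (sample HE GS k A).map (garblerView M x j)
  viewEvaluator k A M x j := (sample HE GS k A).map (evaluatorView M x j)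

end PrivateMDI

/-! ### Polynomially bounded functions -/

/-! Correctness is a cancellation of masks. The homomorphic evaluations follow the masks `c_l`, so
the client decrypts `z = M c + s`. The shares add up to `w = M (x_l - c) - s`, so `w + z = M x_l`,
and the garbled circuit returns `φ (M x_l) - r`. This is `masked_eq`. It also shows that masks,
masked inputs and circuit inputs are functions of the model, the input and the uniform vectors `s`,
`r_1`, `r_l` alone, although the protocol computes them through ciphertexts and garbled circuits.
All coins of encryption, evaluation and garbling can therefore be redrawn without disturbing them.

Perfect steps rest on one principle, `unif_resample`: if `get` reads part of the randomness (after
any bijective change of coordinates) and `set` installs a prescribed value of it, with the two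
inverse laws, then `get` of a uniform tape is uniform, and it can be replaced by a fresh value. For
a computing server and for a garbler the whole view, apart from public circuits, is such a `get`, so
the simulation is exact. The garbler is the delicate case: in a linear layer the next masked input
is a sum of values that it already sees, and `s_l` has to account both for this masked input and for
the garbler's share of `s_l`.

The other views need one computational replacement each, followed or preceded by resampling. The
cloud sees the public key and encryptions of the client's masks, which are replaced by encryptions
of zero (`LHE.SemanticallySecure.encListS_list`). The evaluator sees, in each layer, a garbled
circuit with the labels of one input; these are replaced by the garbling simulator on the output of
the circuit, and that output is uniform because of the mask `r` (`bind_evaluatorIdeal`). The client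
sees ciphertexts whose last evaluation uses coins that occur nowhere else; function privacy replaces
them by simulations from the decrypted values (`clientRows_indist`). Afterwards these values and the
answers in the oblivious transfers are uniform, masked by `s` and `u` (`bind_clientIdeal`), and the
last message is `M(x)` minus a mask that the client knows.

The computational side uses closure of `CompIndist` under averaging over an independent choice,
under post-processing with advice, and under polynomially many hybrids. From these come the
statements on lists, with independent members (`CompIndist.seqL`) or with a common public key
(`CompIndist.seqL_of_common`). The simulators are assembled from closure properties of polynomial
time in the machine model; loops are the only critical construction, since intermediate results must
be kept short. -/

theorem Polynomial.eval_nat_mono (p : Polynomial ℕ) : Monotone fun n : ℕ => p.eval n := by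
  intro a b h
  simp only [Polynomial.eval_eq_sum]
  exact Finset.sum_le_sum fun i _ => Nat.mul_le_mul_left _ (Nat.pow_le_pow_left h i)

namespace PolyBounded

theorem const (c : ℕ) : PolyBounded fun _ => c := ⟨Polynomial.C c, fun k => by simp⟩

theorem self : PolyBounded fun k => k := ⟨Polynomial.X, fun k => by simp⟩

theorem mono {f g : ℕ → ℕ} (hg : PolyBounded g) (h : ∀ k, f k ≤ g k) : PolyBounded f :=
  let ⟨p, hp⟩ := hg
  ⟨p, fun k => (h k).trans (hp k)⟩

theorem add {f g : ℕ → ℕ} (hf : PolyBounded f) (hg : PolyBounded g) :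
    PolyBounded fun k => f k + g k := by
  obtain ⟨p, hp⟩ := hf
  obtain ⟨r, hr⟩ := hg
  exact ⟨p + r, fun k => by simpa using Nat.add_le_add (hp k) (hr k)⟩

theorem mul {f g : ℕ → ℕ} (hf : PolyBounded f) (hg : PolyBounded g) :
    PolyBounded fun k => f k * g k := by
  obtain ⟨p, hp⟩ := hf
  obtain ⟨r, hr⟩ := hg
  exact ⟨p * r, fun k => by simpa using Nat.mul_le_mul (hp k) (hr k)⟩

theorem eval (p : Polynomial ℕ) {f : ℕ → ℕ} (hf : PolyBounded f) :
    PolyBounded fun k => p.eval (f k) := by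
  obtain ⟨r, hr⟩ := hf
  exact ⟨p.comp r, fun k => by simpa using p.eval_nat_mono (hr k)⟩

end PolyBounded

/-! ### Functions computed in probabilistic polynomial time -/

theorem Data.size_pos (d : Data) : 0 < d.size := by cases d <;> simp [Data.size]

@[simp] theorem Data.fst_pair (a b : Data) : (Data.pair a b).fst = a := rfl

@[simp] theorem Data.snd_pair (a b : Data) : (Data.pair a b).snd = b := rfl

@[simp] theorem Data.fst_num (n : ℕ) : (Data.num n).fst = Data.num 0 := rfl

@[simp] theorem Data.snd_num (n : ℕ) : (Data.num n).snd = Data.num 0 := rfl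

theorem Data.size_fst_le (d : Data) : d.fst.size ≤ d.size := by
  cases d <;> simp [Data.fst, Data.size]; omega

theorem Data.size_snd_le (d : Data) : d.snd.size ≤ d.size := by
  cases d <;> simp [Data.snd, Data.size]; omega

theorem Data.size_unary (n : ℕ) : (Data.unary n).size = 2 * n + 1 := by
  induction n with
  | zero => simp [Data.unary, Data.size]
  | succ n ih => simp [Data.unary, Data.size, ih]; omega

namespace Code

/-- Each round is charged at least the length of the state that it leaves, so "length at most
accumulated cost" is an invariant of the loop. -/
theorem size_le_of_mem_support_iterate {F : Data → PMF (Data × ℕ)}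
    (hF : ∀ d, ∀ r ∈ (F d).support, r.1.size ≤ r.2) (n : ℕ) :
    ∀ s : Data × ℕ, s.1.size ≤ s.2 → ∀ r ∈ (iterate F n s).support, r.1.size ≤ r.2 := by
  induction n with
  | zero =>
    intro s hs r hr
    simp only [iterate, PMF.support_pure, Set.mem_singleton_iff] at hr
    exact hr ▸ hs
  | succ n ih =>
    intro s _ r hr
    simp only [iterate, PMF.mem_support_bind_iff] at hr
    obtain ⟨t, ht, hr⟩ := hr
    refine ih _ ?_ r hr
    have := hF _ t ht
    simp only
    omega

theorem size_le_of_mem_support_step {d e : Data} {r : Data × ℕ} (hr : r ∈ (step d e).support) :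
    r.1.size ≤ r.2 := by
  simp only [step, PMF.support_pure, Set.mem_singleton_iff] at hr
  subst hr
  simp only
  omega

/-- The length of the output is at most the number of steps. -/
theorem size_le_of_mem_support_run (c : Code) :
    ∀ d, ∀ r ∈ (c.run d).support, r.1.size ≤ r.2 := by
  induction c with
  | pair f g hf hg =>
    intro d r hr
    simp only [run, PMF.mem_support_bind_iff, PMF.mem_support_pure_iff] at hr
    obtain ⟨a, ha, b, hb, rfl⟩ := hr
    have h1 := hf _ _ ha
    have h2 := hg _ _ hb
    simp only [Data.size]
    omega
  | comp f g hf hg =>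
    intro d r hr
    simp only [run, PMF.mem_support_bind_iff, PMF.mem_support_pure_iff] at hr
    obtain ⟨a, ha, b, hb, rfl⟩ := hr
    have h2 := hf _ _ hb
    simp only
    omega
  | ite c f g hc hf hg =>
    intro d r hr
    simp only [run, PMF.mem_support_bind_iff, PMF.mem_support_pure_iff] at hr
    obtain ⟨a, ha, b, hb, rfl⟩ := hr
    have : b.1.size ≤ b.2 := by
      split at hb
      · exact hf _ _ hb
      · exact hg _ _ hb
    simp only
    omega
  | loop f hf =>
    intro d r hr
    refine size_le_of_mem_support_iterate hf _ _ ?_ r hr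
    have := d.size_snd_le
    simp only
    omega
  | rand =>
    intro d r hr
    simp only [run] at hr
    unfold randStep at hr
    split at hr
    · simp only [PMF.mem_support_bind_iff] at hr
      obtain ⟨i, _, hr⟩ := hr
      exact size_le_of_mem_support_step hr
    · exact size_le_of_mem_support_step hr
  | _ => exact fun d r hr => size_le_of_mem_support_step hr

theorem out_comp (f g : Code) (d : Data) : (comp f g).out d = (g.out d).bind f.out := by
  simp only [out, run, PMF.map_bind, PMF.bind_map, PMF.pure_map]
  refine congrArg _ (funext fun a => ?_)
  simp [Function.comp_def, out, PMF.map]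

theorem out_pair (f g : Code) (d : Data) :
    (pair f g).out d = (f.out d).bind fun a => (g.out d).map (Data.pair a) := by
  simp only [out, run, PMF.map_bind, PMF.bind_map, PMF.pure_map]
  refine congrArg _ (funext fun a => ?_)
  simp [Function.comp_def, PMF.map]

theorem out_ite (c f g : Code) (d : Data) :
    (ite c f g).out d = (c.out d).bind fun a => if a.truth then f.out d else g.out d := by
  simp only [out, run, PMF.map_bind, PMF.bind_map, PMF.pure_map]
  refine congrArg _ (funext fun a => ?_)
  simp only [Function.comp_def]
  split <;> simp [PMF.map, Function.comp_def]

end Code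

/-- Repeat a random map. -/
noncomputable def iterM (F : Data → PMF Data) : ℕ → Data → PMF Data
  | 0, s => PMF.pure s
  | n + 1, s => (F s).bind (iterM F n)

namespace Code

/-- The cost counter never influences the state, so it can be forgotten round by round. -/
theorem map_fst_iterate (F : Data → PMF (Data × ℕ)) (n : ℕ) :
    ∀ s : Data × ℕ, (iterate F n s).map Prod.fst = iterM (fun d => (F d).map Prod.fst) n s.1 := by
  induction n with
  | zero => intro s; simp [iterate, iterM, PMF.pure_map]
  | succ n ih =>
    intro s
    simp only [iterate, iterM, PMF.map_bind, PMF.bind_map]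
    exact congrArg _ (funext fun a => ih _)

theorem mem_support_out {c : Code} {d : Data} {r : Data × ℕ} (hr : r ∈ (c.run d).support) :
    r.1 ∈ (c.out d).support := by
  rw [out, PMF.mem_support_map_iff]
  exact ⟨r, hr, rfl⟩

/-- A round is cheap only on short states. The length of the states reached is a separate
hypothesis, because rounds that are polynomial one by one may double the length each time. -/
theorem cost_iterate_le {c : Code} {B K : ℕ}
    (hc : ∀ d, d.size ≤ B → ∀ r ∈ (c.run d).support, r.2 ≤ K) (n : ℕ) :
    ∀ s : Data × ℕ, (∀ i < n, ∀ r ∈ (iterM c.out i s.1).support, r.size ≤ B) →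
      ∀ r ∈ (iterate c.run n s).support, r.2 ≤ s.2 + n * (K + 1) := by
  induction n with
  | zero =>
    intro s _ r hr
    simp only [iterate, PMF.support_pure, Set.mem_singleton_iff] at hr
    simp [hr]
  | succ n ih =>
    intro s hs r hr
    simp only [iterate, PMF.mem_support_bind_iff] at hr
    obtain ⟨t, ht, hr⟩ := hr
    have h0 : t.2 ≤ K := hc _ (hs 0 n.succ_pos _ (by simp [iterM])) _ ht
    have := ih (t.1, s.2 + t.2 + 1) (fun i hi r' hr' => hs (i + 1) (by omega) _ (by
      simp only [iterM, PMF.mem_support_bind_iff]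
      exact ⟨_, mem_support_out ht, hr'⟩)) r hr
    have e : (n + 1) * (K + 1) = n * (K + 1) + K + 1 := by ring
    simp only at this
    omega

end Code

/-- `F` is the output distribution of a program that runs in polynomial time. -/
def PPT (F : Data → PMF Data) : Prop := ∃ c : Code, c.PolyTime ∧ ∀ d, c.out d = F d

/-- `f` is computed by a program that runs in polynomial time. -/
def PT (f : Data → Data) : Prop := PPT fun d => PMF.pure (f d)

/-- The numerical function `f` is computed in polynomial time. -/
def PTNat (f : Data → ℕ) : Prop := PT fun d => Data.num (f d)

theorem Code.PolyTime.ppt {c : Code} (hc : c.PolyTime) : PPT c.out := ⟨c, hc, fun _ => rfl⟩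

namespace PPT

/-- Every symbol written is charged, so the running time bounds the length of the output. This is
the source of nearly all length bounds below. -/
theorem size_le {F : Data → PMF Data} (hF : PPT F) :
    ∃ p : Polynomial ℕ, ∀ d, ∀ r ∈ (F d).support, r.size ≤ p.eval d.size := by
  obtain ⟨c, ⟨p, hp⟩, h⟩ := hF
  refine ⟨p, fun d r hr => ?_⟩
  rw [← h, Code.out, PMF.mem_support_map_iff] at hr
  obtain ⟨s, hs, rfl⟩ := hr
  exact (c.size_le_of_mem_support_run d s hs).trans (hp d s hs)

theorem congr {F G : Data → PMF Data} (hF : PPT F) (h : ∀ d, F d = G d) : PPT G := by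
  obtain ⟨c, hc, h'⟩ := hF
  exact ⟨c, hc, fun d => (h' d).trans (h d)⟩

theorem bind {F G : Data → PMF Data} (hF : PPT F) (hG : PPT G) :
    PPT fun d => (F d).bind G := by
  obtain ⟨f, ⟨p, hp⟩, hf⟩ := hF
  obtain ⟨g, ⟨r, hr⟩, hg⟩ := hG
  -- The second program reads an output of the first, whose length is at most `p`; this gives the
  -- composition `r.comp p`.
  refine ⟨.comp g f, ⟨p + r.comp p + 1, fun d s hs => ?_⟩, fun d => ?_⟩
  · simp only [Code.run, PMF.mem_support_bind_iff, PMF.mem_support_pure_iff] at hs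
    obtain ⟨a, ha, b, hb, rfl⟩ := hs
    have h1 := hp _ _ ha
    have h2 := hr _ _ hb
    have h3 := r.eval_nat_mono ((f.size_le_of_mem_support_run _ _ ha).trans h1)
    simp only [Polynomial.eval_add, Polynomial.eval_comp, Polynomial.eval_one] at h3 ⊢
    omega
  · rw [Code.out_comp, hf, funext hg]

theorem comp {G : Data → PMF Data} (hG : PPT G) {f : Data → Data} (hf : PT f) :
    PPT fun d => G (f d) :=
  (PPT.bind hf hG).congr fun d => by simp

theorem pair {F G : Data → PMF Data} (hF : PPT F) (hG : PPT G) :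
    PPT fun d => (F d).bind fun a => (G d).map (Data.pair a) := by
  obtain ⟨f, ⟨p, hp⟩, hf⟩ := hF
  obtain ⟨g, ⟨r, hr⟩, hg⟩ := hG
  refine ⟨.pair f g, ⟨p + r + 1, fun d s hs => ?_⟩, fun d => ?_⟩
  · simp only [Code.run, PMF.mem_support_bind_iff, PMF.mem_support_pure_iff] at hs
    obtain ⟨a, ha, b, hb, rfl⟩ := hs
    have h1 := hp _ _ ha
    have h2 := hr _ _ hb
    simp only [Polynomial.eval_add, Polynomial.eval_one]
    omega
  · rw [Code.out_pair, hf, hg]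

theorem ite {F G : Data → PMF Data} {f : Data → Data} (hf : PT f) (hF : PPT F) (hG : PPT G) :
    PPT fun d => if (f d).truth then F d else G d := by
  obtain ⟨c, ⟨t, ht⟩, hc⟩ := hf
  obtain ⟨f, ⟨p, hp⟩, hf⟩ := hF
  obtain ⟨g, ⟨r, hr⟩, hg⟩ := hG
  refine ⟨.ite c f g, ⟨t + p + r + 1, fun d s hs => ?_⟩, fun d => ?_⟩
  · simp only [Code.run, PMF.mem_support_bind_iff, PMF.mem_support_pure_iff] at hs
    obtain ⟨a, ha, b, hb, rfl⟩ := hs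
    have h1 := ht _ _ ha
    simp only [Polynomial.eval_add, Polynomial.eval_one]
    split at hb
    · have h2 := hp _ _ hb
      omega
    · have h2 := hr _ _ hb
      omega
  · rw [Code.out_ite, hc, hf, hg, PMF.pure_bind]

/-- Draw an auxiliary value first. -/
theorem bind' {F : Data → PMF Data} {G : Data → Data → PMF Data} (hF : PPT F)
    (hG : PPT fun d => G d.fst d.snd) : PPT fun d => (F d).bind (G d) := by
  have hid : PPT fun d => PMF.pure d := ⟨.id, ⟨2 * Polynomial.X + 1, fun d s hs => by
    simp only [Code.run, Code.step, PMF.mem_support_pure_iff] at hs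
    subst hs
    simp only [Polynomial.eval_add, Polynomial.eval_mul, Polynomial.eval_X, Polynomial.eval_one,
      Polynomial.eval_ofNat]
    omega⟩, fun d => by simp [Code.out, Code.run, Code.step, PMF.pure_map]⟩
  -- Running `F` next to a copy of the input keeps the input available to `G`.
  refine ((hid.pair hF).bind hG).congr fun d => ?_
  simp [PMF.bind_map, Function.comp_def, Data.fst, Data.snd]

end PPT

theorem PT.of_step (c : Code) (f : Data → Data) (p : Polynomial ℕ)
    (hc : ∀ d, c.run d = Code.step d (f d)) (hp : ∀ d, (f d).size ≤ p.eval d.size) : PT f :=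
  ⟨c, ⟨Polynomial.X + p + 1, fun d s hs => by
    rw [hc] at hs
    simp only [Code.step, PMF.mem_support_pure_iff] at hs
    subst hs
    have := hp d
    simp only [Polynomial.eval_add, Polynomial.eval_X, Polynomial.eval_one]
    omega⟩, fun d => by simp [Code.out, hc, Code.step, PMF.pure_map]⟩

/-! ### Deterministic polynomial-time functions -/

namespace PT

theorem id : PT fun d => d := of_step .id _ Polynomial.X (fun _ => rfl) fun d => by simp

theorem num (n : ℕ) : PT fun _ => Data.num n :=
  of_step (.const n) _ (Polynomial.C (Data.num n).size) (fun _ => rfl) fun d => by simp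

theorem comp {f g : Data → Data} (hg : PT g) (hf : PT f) : PT fun d => g (f d) := PPT.comp hg hf

theorem fst {f : Data → Data} (hf : PT f) : PT fun d => (f d).fst :=
  comp (of_step .fst Data.fst Polynomial.X (fun _ => rfl) fun d => by simpa using d.size_fst_le) hf

theorem snd {f : Data → Data} (hf : PT f) : PT fun d => (f d).snd :=
  comp (of_step .snd Data.snd Polynomial.X (fun _ => rfl) fun d => by simpa using d.size_snd_le) hf

theorem pair {f g : Data → Data} (hf : PT f) (hg : PT g) : PT fun d => Data.pair (f d) (g d) :=
  (PPT.pair hf hg).congr fun d => by simp [PMF.pure_map]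

theorem ite {c f g : Data → Data} (hc : PT c) (hf : PT f) (hg : PT g) :
    PT fun d => if (c d).truth then f d else g d :=
  (PPT.ite hc hf hg).congr fun d => by dsimp only; split <;> rfl

theorem isNum {f : Data → Data} (hf : PT f) : PT fun d => (f d).isNum :=
  comp (of_step .isNum Data.isNum 2 (fun _ => rfl) fun d => by
    cases d <;> simp [Data.isNum, Data.size]) hf

theorem size_le {f : Data → Data} (hf : PT f) :
    ∃ p : Polynomial ℕ, ∀ d, (f d).size ≤ p.eval d.size := by
  obtain ⟨p, hp⟩ := PPT.size_le hf
  exact ⟨p, fun d => hp d _ (by simp)⟩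

theorem congr {f g : Data → Data} (hf : PT f) (h : ∀ d, f d = g d) : PT g :=
  PPT.congr hf fun d => by rw [h]

end PT

theorem PPT.map {F : Data → PMF Data} (hF : PPT F) {f : Data → Data} (hf : PT f) :
    PPT fun d => (F d).map f := hF.bind hf

/-- The number stored in an atom. -/
def Data.val : Data → ℕ
  | num n => n
  | pair _ _ => 0

@[simp] theorem Data.val_num (n : ℕ) : (Data.num n).val = n := rfl

@[simp] theorem Data.val_pair (a b : Data) : (Data.pair a b).val = 0 := rfl

/-! ### Polynomial-time arithmetic -/

namespace PTNat

/-- A primitive step pays for what it writes, so all that matters is that the bit length of the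
result is linear in those of the arguments. -/
theorem arith (c : Code) (op : ℕ → ℕ → ℕ) (hc : ∀ d, c.run d = Code.step d (d.arith op))
    (h : ∀ a b, (op a b).size ≤ a.size + b.size + 1) {f g : Data → ℕ} (hf : PTNat f)
    (hg : PTNat g) : PTNat fun d => op (f d) (g d) := by
  refine PT.comp (g := Data.arith op) (PT.of_step c _ (Polynomial.X + 1) hc fun d => ?_)
    (PT.pair hf hg)
  unfold Data.arith
  split
  · rename_i a b
    have := h a b
    simp only [Data.size, Polynomial.eval_add, Polynomial.eval_X, Polynomial.eval_one]
    omega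
  · simp [Data.size]

theorem size_le_of_le {a b : ℕ} (h : a ≤ b) : a.size ≤ b.size := Nat.size_le_size h

theorem const (n : ℕ) : PTNat fun _ => n := PT.num n

theorem add {f g : Data → ℕ} (hf : PTNat f) (hg : PTNat g) : PTNat fun d => f d + g d := by
  refine arith .add (fun a b => a + b) (fun _ => rfl) (fun a b => Nat.size_le.2 ?_) hf hg
  have h1 := Nat.lt_size_self a
  have h2 := Nat.lt_size_self b
  have h3 : 2 ^ a.size ≤ 2 ^ (a.size + b.size) := Nat.pow_le_pow_right (by simp) (by omega)
  have h4 : 2 ^ b.size ≤ 2 ^ (a.size + b.size) := Nat.pow_le_pow_right (by simp) (by omega)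
  rw [pow_succ]
  omega

theorem mul {f g : Data → ℕ} (hf : PTNat f) (hg : PTNat g) : PTNat fun d => f d * g d := by
  refine arith .mul (fun a b => a * b) (fun _ => rfl) (fun a b => Nat.size_le.2 ?_) hf hg
  have h1 := Nat.lt_size_self a
  have h2 := Nat.lt_size_self b
  rw [pow_succ, pow_add]
  have := Nat.mul_le_mul h1.le h2.le
  have h5 := Nat.mul_pos a.size.two_pow_pos b.size.two_pow_pos
  omega

theorem sub {f g : Data → ℕ} (hf : PTNat f) (hg : PTNat g) : PTNat fun d => f d - g d :=
  arith .sub (fun a b => a - b) (fun _ => rfl)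
    (fun a b => (size_le_of_le (a.sub_le b)).trans (by omega)) hf hg

theorem div {f g : Data → ℕ} (hf : PTNat f) (hg : PTNat g) : PTNat fun d => f d / g d :=
  arith .div (fun a b => a / b) (fun _ => rfl)
    (fun a b => (size_le_of_le (a.div_le_self b)).trans (by omega)) hf hg

theorem mod {f g : Data → ℕ} (hf : PTNat f) (hg : PTNat g) : PTNat fun d => f d % g d :=
  arith .mod (fun a b => a % b) (fun _ => rfl)
    (fun a b => (size_le_of_le (a.mod_le b)).trans (by omega)) hf hg

theorem xor {f g : Data → ℕ} (hf : PTNat f) (hg : PTNat g) : PTNat fun d => f d ^^^ g d := by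
  refine arith .xor (fun a b => a ^^^ b) (fun _ => rfl) (fun a b => Nat.size_le.2 ?_) hf hg
  refine Nat.xor_lt_two_pow ?_ ?_
  · exact (Nat.lt_size_self a).trans_le (Nat.pow_le_pow_right (by simp) (by omega))
  · exact (Nat.lt_size_self b).trans_le (Nat.pow_le_pow_right (by simp) (by omega))

theorem val {f : Data → Data} (hf : PT f) : PTNat fun d => (f d).val := by
  refine PT.comp (g := fun d => Data.num d.val) ?_ hf
  -- Adding `0` fixes every atom and sends pairs, being ill-formed arguments, to `0`; this is
  -- exactly `Data.val`.
  have h : PT fun d => Data.arith (fun a b => a + b) (Data.pair d (Data.num 0)) := by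
    refine PT.comp (g := Data.arith fun a b => a + b)
      (PT.of_step .add _ (Polynomial.X + 1) (fun _ => rfl) fun d => ?_)
      (PT.pair PT.id (PT.num 0))
    unfold Data.arith
    split
    · rename_i a b
      have h1 := Nat.lt_size_self a
      have h2 := Nat.lt_size_self b
      have h3 : 2 ^ a.size ≤ 2 ^ (a.size + b.size) := Nat.pow_le_pow_right (by simp) (by omega)
      have h4 : 2 ^ b.size ≤ 2 ^ (a.size + b.size) := Nat.pow_le_pow_right (by simp) (by omega)
      have h5 : (a + b).size ≤ a.size + b.size + 1 := Nat.size_le.2 (by rw [pow_succ]; omega)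
      simp only [Data.size, Polynomial.eval_add, Polynomial.eval_X, Polynomial.eval_one]
      omega
    · simp [Data.size]
  exact h.congr fun d => by cases d <;> simp [Data.arith, Data.val]

theorem dataSize {f : Data → Data} (hf : PT f) : PTNat fun d => (f d).size := by
  refine PT.comp (g := fun d => Data.num d.size) (PT.of_step .size _ (Polynomial.X + 1)
    (fun _ => rfl) fun d => ?_) hf
  simp only [Data.size, Polynomial.eval_add, Polynomial.eval_X, Polynomial.eval_one]
  have : d.size.size ≤ d.size := Nat.size_le.2 Nat.lt_two_pow_self
  omega

theorem natSize {f : Data → ℕ} (hf : PTNat f) : PTNat fun d => (f d).size :=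
  PT.congr (sub (dataSize hf) (const 1)) fun d => by simp [Data.size]

theorem polyEval (p : Polynomial ℕ) {f : Data → ℕ} (hf : PTNat f) :
    PTNat fun d => p.eval (f d) := by
  induction p using Polynomial.induction_on with
  | C a => simpa using const a
  | add p r hp hr => simpa using add hp hr
  | monomial n a h =>
    -- Raising the exponent of a monomial by one costs one more multiplication.
    refine PT.congr (mul h hf) fun d => ?_
    simp [pow_succ, mul_assoc]

end PTNat

/-! ### Loops -/

/-- The polynomial `B` must bound every intermediate state, not only the last one: polynomially many
polynomial-time rounds do not compose to polynomial time without it. -/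
theorem PPT.iterM {F : Data → PMF Data} (hF : PPT F) {N : Data → ℕ} (hN : PTNat N)
    {f : Data → Data} (hf : PT f) (p B : Polynomial ℕ) (hNp : ∀ d, N d ≤ p.eval d.size)
    (hB : ∀ d, ∀ i ≤ N d, ∀ r ∈ (iterM F i (f d)).support, r.size ≤ B.eval d.size) :
    PPT fun d => _root_.iterM F (N d) (f d) := by
  obtain ⟨cF, ⟨pF, hpF⟩, hF⟩ := hF
  obtain ⟨cN, ⟨pN, hpN⟩, hN⟩ := hN
  obtain ⟨cf, ⟨pf, hpf⟩, hf⟩ := hf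
  have hout : cF.out = F := funext hF
  -- The summands are the cost of preparing counter and state, the initial charge of the loop for
  -- reading them, `p` rounds of cost `pF` on states of length at most `B`, and the charge for the
  -- composition.
  refine ⟨.comp (.loop cF) (.pair cN cf),
    ⟨pN + pf + 1 + (1 + (pN + pf + 1) + p * (pF.comp B + 1)) + 1, fun d s hs => ?_⟩, fun d => ?_⟩
  · simp only [Code.run, PMF.mem_support_bind_iff, PMF.mem_support_pure_iff] at hs
    obtain ⟨_, ⟨a, ha, b, hb, rfl⟩, r, hr, rfl⟩ := hs
    have h1 := hpN _ _ ha
    have h2 := hpf _ _ hb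
    have h1' := cN.size_le_of_mem_support_run _ _ ha
    have h2' := cf.size_le_of_mem_support_run _ _ hb
    have ha' := Code.mem_support_out ha
    have hb' := Code.mem_support_out hb
    rw [hN, PMF.mem_support_pure_iff] at ha'
    rw [hf, PMF.mem_support_pure_iff] at hb'
    simp only [Data.snd] at hr
    have h3 : r.2 ≤ _ := Code.cost_iterate_le (c := cF) (B := B.eval d.size)
      (K := pF.eval (B.eval d.size)) (fun e he r hr => (hpF _ _ hr).trans (pF.eval_nat_mono he))
      _ _ ?_ r hr
    · have hNd := hNp d
      have hl : Data.loopCount (Data.pair a.1 b.1) = N d := by rw [ha']; rfl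
      rw [hl] at h3
      have := Nat.mul_le_mul_right (pF.eval (B.eval d.size) + 1) hNd
      simp only [Polynomial.eval_add, Polynomial.eval_mul, Polynomial.eval_one,
        Polynomial.eval_comp, Data.size] at h3 ⊢
      omega
    · intro i hi e he
      have hl : Data.loopCount (Data.pair a.1 b.1) = N d := by rw [ha']; rfl
      rw [hl] at hi
      rw [hout, hb'] at he
      exact hB d i hi.le e he
  · rw [Code.out_comp, Code.out_pair, hN, hf]
    simp only [PMF.pure_bind, PMF.pure_map]
    rw [Code.out, Code.run, Code.map_fst_iterate]
    simp only [Data.snd, Data.loopCount]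
    exact congrArg (fun G => _root_.iterM G (N d) (f d)) hout

/-! ### Folds over lists -/

namespace Data

/-- Fold a random map over a list. -/
noncomputable def foldP (F : Data → PMF Data) (c : Data) : Data → Data → PMF Data
  | num _, acc => PMF.pure acc
  | pair a l, acc => (F (pair c (pair a acc))).bind (foldP F c l)

/-- One round of the loop that computes a fold. -/
noncomputable def foldStep (F : Data → PMF Data) (s : Data) : PMF Data :=
  if s.snd.fst.isNum.truth then PMF.pure s
  else (F (pair s.fst (pair s.snd.fst.fst s.snd.snd))).map fun acc =>
    pair s.fst (pair s.snd.fst.snd acc)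

theorem foldStep_num (F : Data → PMF Data) (c acc : Data) (n : ℕ) :
    foldStep F (pair c (pair (num n) acc)) = PMF.pure (pair c (pair (num n) acc)) := by
  simp [foldStep, isNum, truth]

theorem foldStep_pair (F : Data → PMF Data) (c a l acc : Data) :
    foldStep F (pair c (pair (pair a l) acc)) =
      (F (pair c (pair a acc))).map fun acc => pair c (pair l acc) := by
  simp [foldStep, isNum, truth]

/-- Once the list is exhausted the loop idles, so any number of rounds that is at least the length
of the list will do. The size of the datum is such a number, and a primitive computes it. -/
theorem iterM_foldStep (F : Data → PMF Data) (c l : Data) :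
    ∀ (n : ℕ) (acc : Data), l.size ≤ n →
      (iterM (foldStep F) n (pair c (pair l acc))).map (fun d => d.snd.snd) =
        foldP F c l acc := by
  induction l with
  | num m =>
    intro n acc hn
    clear hn
    have h : iterM (foldStep F) n (pair c (pair (num m) acc)) =
        PMF.pure (pair c (pair (num m) acc)) := by
      induction n with
      | zero => rfl
      | succ n ih => simpa [iterM, foldStep_num] using ih
    simp [h, foldP, PMF.pure_map]
  | pair a l _ ih =>
    intro n acc hn
    obtain ⟨n, rfl⟩ : ∃ m, n = m + 1 := ⟨n - 1, by simp [size] at hn; omega⟩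
    simp only [iterM, foldStep_pair, PMF.bind_map, PMF.map_bind, foldP]
    refine congrArg _ (funext fun acc' => ih n acc' ?_)
    have := a.size_pos
    simp [size] at hn
    omega

end Data

/-- A random map on `(c, (a, acc))` that adds to the length of `acc` at most a polynomial in the
lengths of `c` and `a`. -/
def GrowsBy (F : Data → PMF Data) : Prop :=
  ∃ p : Polynomial ℕ, ∀ c a acc : Data, ∀ r ∈ (F (.pair c (.pair a acc))).support,
    r.size ≤ acc.size + p.eval (c.size + a.size)

/-- The unread list only shrinks, so `K` keeps bounding it together with `c`, and each round
lengthens the accumulator by at most `p(K)`: growth is additive, not multiplicative. -/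
theorem Data.size_iterM_foldStep_le {F : Data → PMF Data} {p : Polynomial ℕ}
    (hp : ∀ c a acc : Data, ∀ r ∈ (F (.pair c (.pair a acc))).support,
      r.size ≤ acc.size + p.eval (c.size + a.size)) (c : Data) (i : ℕ) :
    ∀ (l acc : Data) (K : ℕ), c.size + l.size ≤ K →
      ∀ r ∈ (iterM (foldStep F) i (pair c (pair l acc))).support,
        r.size ≤ K + acc.size + 2 + i * p.eval K := by
  induction i with
  | zero =>
    intro l acc K hK r hr
    simp only [iterM, PMF.mem_support_pure_iff] at hr
    subst hr
    simp [size]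
    omega
  | succ i ih =>
    intro l acc K hK r hr
    have e : (i + 1) * p.eval K = i * p.eval K + p.eval K := by ring
    cases l with
    | num n =>
      simp only [iterM, foldStep_num, PMF.pure_bind] at hr
      have := ih _ _ K hK r hr
      omega
    | pair a l =>
      simp only [iterM, foldStep_pair, PMF.bind_map, PMF.mem_support_bind_iff] at hr
      obtain ⟨acc', h', hr⟩ := hr
      simp only [size] at hK
      have h1 := hp _ _ _ _ h'
      have h2 := ih l acc' K (by omega) r hr
      have h3 : p.eval (c.size + a.size) ≤ p.eval K := p.eval_nat_mono (by omega)
      omega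

theorem PPT.foldP {F : Data → PMF Data} (hF : PPT F) (hg : GrowsBy F) {c l acc : Data → Data}
    (hc : PT c) (hl : PT l) (hacc : PT acc) : PPT fun d => Data.foldP F (c d) (l d) (acc d) := by
  obtain ⟨p, hp⟩ := hg
  have h : PPT fun d => _root_.iterM (Data.foldStep F) d.snd.fst.size d := by
    -- The bound `K + acc.size + 2 + i * p(K)` becomes `2n + 2 + n * p(n)`, since `K`, the
    -- accumulator and the number of rounds are at most the input length `n`.
    refine PPT.iterM ?_ (PTNat.dataSize PT.id.snd.fst) PT.id Polynomial.X
      (2 * Polynomial.X + 2 + Polynomial.X * p) (fun d => ?_) fun d i hi r hr => ?_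
    · refine PPT.ite (PT.id.snd.fst.isNum) PT.id ?_
      refine PPT.bind' (G := fun s acc => PMF.pure (.pair s.fst (.pair s.snd.fst.snd acc)))
        (hF.comp (PT.id.fst.pair (PT.id.snd.fst.fst.pair PT.id.snd.snd))) ?_
      exact PT.id.fst.fst.pair (PT.id.fst.snd.fst.snd.pair PT.id.snd)
    · have h1 := d.size_snd_le
      have h2 := d.snd.size_fst_le
      simp only [Polynomial.eval_X]
      omega
    · have h1 := d.size_snd_le
      have h2 := d.snd.size_fst_le
      have hid : d.snd.fst.size ≤ d.size := by omega
      simp only [Polynomial.eval_X, Polynomial.eval_add, Polynomial.eval_mul,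
        Polynomial.eval_ofNat]
      -- Polynomial time is demanded on every datum, so inputs that are not of the form `(c, (l,
      -- acc))` must be covered; the loop idles on them.
      cases d with
      | num n =>
        simp only [Data.snd, Data.fst, Data.size, Nat.size_zero, Nat.zero_add] at hi
        have : ∀ j, _root_.iterM (Data.foldStep F) j (Data.num n) = PMF.pure (Data.num n) := by
          intro j
          induction j with
          | zero => rfl
          | succ j ih => simp [_root_.iterM, Data.foldStep, Data.isNum, Data.truth, ih]
        rw [this, PMF.mem_support_pure_iff] at hr
        subst hr
        omega
      | pair c s =>
        cases s with
        | num n =>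
          have : ∀ j, _root_.iterM (Data.foldStep F) j (.pair c (Data.num n)) =
              PMF.pure (.pair c (Data.num n)) := by
            intro j
            induction j with
            | zero => rfl
            | succ j ih =>
              simp [_root_.iterM, Data.foldStep, Data.isNum, Data.truth, ih]
          rw [this, PMF.mem_support_pure_iff] at hr
          subst hr
          omega
        | pair l acc =>
          have := Data.size_iterM_foldStep_le hp c i l acc (Data.size (.pair c (.pair l acc)))
            (by simp [Data.size]; omega) r hr
          have h4 : i * p.eval (Data.size (.pair c (.pair l acc))) ≤
            (Data.size (.pair c (.pair l acc))) * p.eval (Data.size (.pair c (.pair l acc))) :=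
              Nat.mul_le_mul_right _ (hi.trans hid)
          have h5 : acc.size ≤ Data.size (.pair c (.pair l acc)) := by simp [Data.size]; omega
          omega
  refine ((h.map PT.id.snd.snd).comp (hc.pair (hl.pair hacc))).congr fun d => ?_
  exact Data.iterM_foldStep F _ _ _ _ le_rfl

/-! ### Maps over lists and reversal -/

namespace Data

/-- Apply a random map to each member of a list, independently. -/
noncomputable def mapP (F : Data → PMF Data) : Data → PMF Data
  | num _ => PMF.pure (num 0)
  | pair a l => (F a).bind fun x => (mapP F l).map (pair x)

/-- Put the members of a list in front of another one, in reverse order. -/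
def revOnto : Data → Data → Data
  | num _, acc => acc
  | pair a l, acc => revOnto l (pair a acc)

def append : Data → Data → Data
  | num _, acc => acc
  | pair a l, acc => pair a (append l acc)

/-- A fold produces its list in reverse order; with `acc = num 0` this identity shows that a second
reversal restores the order. -/
theorem revOnto_revOnto (l : Data) :
    ∀ acc acc', revOnto (revOnto l acc) acc' = revOnto acc (append l acc') := by
  induction l with
  | num n => intro acc acc'; rfl
  | pair a l _ ih => intro acc acc'; simp [revOnto, append, ih]

theorem append_ofList (l : List Data) (l' : List Data) :
    append (ofList l) (ofList l') = ofList (l ++ l') := by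
  induction l with
  | nil => rfl
  | cons a l ih => simp [ofList, append, ih]

theorem foldP_revOnto (l : Data) (c : Data) :
    ∀ acc, foldP (fun d => PMF.pure (pair d.snd.fst d.snd.snd)) c l acc =
      PMF.pure (revOnto l acc) := by
  induction l with
  | num n => intro acc; rfl
  | pair a l _ ih => intro acc; simp [foldP, revOnto, ih]

/-- Putting each result in front of the accumulator yields the mapped list backwards. Each round
adds a length that does not depend on the accumulator, so the fold meets the growth condition. -/
theorem foldP_mapP (F : Data → PMF Data) (l : Data) (c : Data) :
    ∀ acc, foldP (fun d => (F (pair d.fst d.snd.fst)).map fun x => pair x d.snd.snd) c l acc =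
      (mapP (fun a => F (pair c a)) l).map fun m => revOnto m acc := by
  induction l with
  | num n => intro acc; simp [foldP, mapP, PMF.pure_map, revOnto]
  | pair a l _ ih =>
    intro acc
    simp [foldP, mapP, PMF.map_bind, PMF.bind_map, Function.comp_def, ih, PMF.map_comp,
      revOnto]

/-- Any atom ends a list, and appending `num 0` normalizes this atom; a mapped list already ends in
`num 0`. -/
theorem append_of_mem_support_mapP {F : Data → PMF Data} (l : Data) :
    ∀ m ∈ (mapP F l).support, append m (num 0) = m := by
  induction l with
  | num n =>
    intro m hm
    simp only [mapP, PMF.mem_support_pure_iff] at hm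
    simp [hm, append]
  | pair a l _ ih =>
    intro m hm
    simp only [mapP, PMF.mem_support_bind_iff, PMF.mem_support_map_iff] at hm
    obtain ⟨x, _, m', hm', rfl⟩ := hm
    simp [append, ih m' hm']

end Data

theorem PMF.bind_congr_support {α β : Type*} {p : PMF α} {f g : α → PMF β}
    (h : ∀ a ∈ p.support, f a = g a) : p.bind f = p.bind g := by
  ext b
  simp only [PMF.bind_apply]
  refine tsum_congr fun a => ?_
  by_cases ha : a ∈ p.support
  · rw [h a ha]
  · rw [(PMF.apply_eq_zero_iff p a).2 ha, zero_mul, zero_mul]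

theorem PT.revOnto {f g : Data → Data} (hf : PT f) (hg : PT g) :
    PT fun d => Data.revOnto (f d) (g d) := by
  refine (PPT.foldP (F := fun d => PMF.pure (Data.pair d.snd.fst d.snd.snd))
    (PT.id.snd.fst.pair PT.id.snd.snd) ⟨Polynomial.X + 1, fun c a acc r hr => ?_⟩
    (PT.num 0) hf hg).congr fun _ => Data.foldP_revOnto _ _ _
  simp only [Data.fst_pair, Data.snd_pair, PMF.mem_support_pure_iff] at hr
  subst hr
  simp [Data.size]
  omega

theorem PT.append {f g : Data → Data} (hf : PT f) (hg : PT g) :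
    PT fun d => Data.append (f d) (g d) :=
  (PT.revOnto (PT.revOnto hf (PT.num 0)) hg).congr fun _ => Data.revOnto_revOnto _ _ _

/-- The program receives the context `c d` together with each member, since a loop body sees nothing
but its state. -/
theorem PPT.mapP {F : Data → PMF Data} (hF : PPT F) {c l : Data → Data} (hc : PT c) (hl : PT l) :
    PPT fun d => Data.mapP (fun a => F (.pair (c d) a)) (l d) := by
  obtain ⟨p, hp⟩ := hF.size_le
  have h : PPT fun d => Data.foldP
      (fun d => (F (.pair d.fst d.snd.fst)).map fun x => .pair x d.snd.snd) (c d) (l d)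
      (Data.num 0) := by
    refine PPT.foldP ?_ ⟨p.comp (Polynomial.X + 1) + 1, fun c a acc r hr => ?_⟩ hc hl (PT.num 0)
    · exact PPT.bind' (G := fun d x => PMF.pure (.pair x d.snd.snd))
        (hF.comp (PT.id.fst.pair PT.id.snd.fst)) (PT.id.snd.pair PT.id.fst.snd.snd)
    · simp only [Data.fst, Data.snd, PMF.mem_support_map_iff] at hr
      obtain ⟨x, hx, rfl⟩ := hr
      have := hp _ _ hx
      simp only [Data.size, Polynomial.eval_add, Polynomial.eval_comp, Polynomial.eval_X,
        Polynomial.eval_one] at this ⊢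
      omega
  refine (h.map (PT.revOnto PT.id (PT.num 0))).congr fun d => ?_
  rw [Data.foldP_mapP, PMF.map_comp]
  conv_rhs => rw [← PMF.bind_pure (Data.mapP (fun a => F (.pair (c d) a)) (l d))]
  refine PMF.bind_congr_support fun m hm => ?_
  simp only [Function.comp_def, Data.revOnto_revOnto]
  simp [Data.revOnto, Data.append_of_mem_support_mapP _ m hm]

/-! ### Deterministic maps and folds, unary numbers, powers of two -/

namespace Data

/-- Apply a map to each member of a list. -/
def mapD (f : Data → Data) : Data → Data
  | num _ => num 0
  | pair a l => pair (f a) (mapD f l)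

theorem mapP_pure (f : Data → Data) (l : Data) :
    mapP (fun a => PMF.pure (f a)) l = PMF.pure (mapD f l) := by
  induction l with
  | num n => rfl
  | pair a l _ ih => simp [mapP, mapD, ih, PMF.pure_map]

theorem mapD_ofList (f : Data → Data) (l : List Data) : mapD f (ofList l) = ofList (l.map f) := by
  induction l with
  | nil => rfl
  | cons a l ih => simp [ofList, mapD, ih]

/-- Fold a map over a list. -/
def foldD (f : Data → Data) (c : Data) : Data → Data → Data
  | num _, acc => acc
  | pair a l, acc => foldD f c l (f (pair c (pair a acc)))

theorem foldP_pure (f : Data → Data) (c l : Data) :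
    ∀ acc, foldP (fun d => PMF.pure (f d)) c l acc = PMF.pure (foldD f c l acc) := by
  induction l with
  | num n => intro acc; rfl
  | pair a l _ ih => intro acc; simp [foldP, foldD, ih]

theorem unary_eq_ofList (n : ℕ) : unary n = ofList (List.replicate n (num 0)) := by
  induction n with
  | zero => rfl
  | succ n ih => simp [unary, List.replicate_succ, ofList, ih]

end Data

theorem PT.mapD {f c l : Data → Data} (hf : PT f) (hc : PT c) (hl : PT l) :
    PT fun d => Data.mapD (fun a => f (.pair (c d) a)) (l d) :=
  (PPT.mapP hf hc hl).congr fun _ => Data.mapP_pure _ _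

theorem PT.foldD {f c l acc : Data → Data} (hf : PT f)
    (hg : ∃ p : Polynomial ℕ, ∀ c a acc : Data,
      (f (.pair c (.pair a acc))).size ≤ acc.size + p.eval (c.size + a.size))
    (hc : PT c) (hl : PT l) (hacc : PT acc) : PT fun d => Data.foldD f (c d) (l d) (acc d) := by
  obtain ⟨p, hp⟩ := hg
  refine (PPT.foldP hf ⟨p, fun c a acc r hr => ?_⟩ hc hl hacc).congr fun _ => Data.foldP_pure _ _ _ _
  rw [PMF.mem_support_pure_iff] at hr
  exact hr ▸ hp c a acc

/-- Unary representations of polynomially bounded numbers. -/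
theorem PT.unary {N : Data → ℕ} (hN : PTNat N) (p : Polynomial ℕ)
    (hp : ∀ d, N d ≤ p.eval d.size) : PT fun d => Data.unary (N d) := by
  have h : ∀ n m, _root_.iterM (fun d => PMF.pure (.pair (.num 0) d)) n (Data.unary m) =
      PMF.pure (Data.unary (m + n)) := by
    intro n
    induction n with
    | zero => intro m; rfl
    | succ n ih =>
      intro m
      simp only [iterM, PMF.pure_bind]
      rw [show Data.pair (.num 0) (Data.unary m) = Data.unary (m + 1) from rfl, ih]
      congr 2
      omega
  refine (PPT.iterM (F := fun d => PMF.pure (.pair (.num 0) d)) ((PT.num 0).pair PT.id) hN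
    (PT.num 0) p (2 * p + 1) hp fun d i hi r hr => ?_).congr fun d => ?_
  · have := h i 0
    rw [show Data.unary 0 = Data.num 0 from rfl] at this
    rw [this, PMF.mem_support_pure_iff] at hr
    subst hr
    have := hp d
    simp [Data.size_unary]
    omega
  · have := h (N d) 0
    rwa [Nat.zero_add] at this

theorem Data.foldD_two_pow (n : ℕ) (c : Data) :
    ∀ m, foldD (fun d => num (2 * d.snd.snd.val)) c (unary n) (num m) = num (2 ^ n * m) := by
  induction n with
  | zero => intro m; simp [unary, foldD]
  | succ n ih =>
    intro m
    simp only [unary, foldD, snd_pair, val_num, ih]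
    congr 1
    ring

/-- Repeated doubling along `1^N`. The result has `N + 1` bits, so the exponent itself has to be
polynomially bounded. -/
theorem PTNat.two_pow {N : Data → ℕ} (hN : PTNat N) (p : Polynomial ℕ)
    (hp : ∀ d, N d ≤ p.eval d.size) : PTNat fun d => 2 ^ N d := by
  refine (PT.foldD (f := fun d => .num (2 * d.snd.snd.val))
    (PTNat.mul (PTNat.const 2) (PTNat.val PT.id.snd.snd)) ⟨2, fun c a acc => ?_⟩ (PT.num 0)
    (PT.unary hN p hp) (PT.num 1)).congr fun d => ?_
  · cases acc with
    | num n =>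
      have : (2 * n).size ≤ n.size + 1 := Nat.size_le.2 (by
        have := Nat.lt_size_self n
        rw [pow_succ]
        omega)
      simp [Data.snd, Data.val, Data.size]
      omega
    | pair a b => simp [Data.snd, Data.val, Data.size]
  · simp [Data.foldD_two_pow]

/-! ### Uniform samples -/

/-- A uniform element of `{0, …, m - 1}`, and `0` if `m = 0`. -/
noncomputable def randD (m : ℕ) : PMF Data := Code.rand.out (.num m)

theorem randD_succ (m : ℕ) :
    randD (m + 1) = (unif (Fin (m + 1))).map fun i : Fin (m + 1) => Data.num (i : ℕ) := by
  simp only [randD, Code.out, Code.run, Code.randStep, Code.step, PMF.map_bind, PMF.pure_map]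
  rfl

theorem Code.rand_polyTime : Code.rand.PolyTime := by
  refine ⟨2 * Polynomial.X + 1, fun d s hs => ?_⟩
  simp only [Code.run] at hs
  simp only [Polynomial.eval_add, Polynomial.eval_mul, Polynomial.eval_X, Polynomial.eval_one,
    Polynomial.eval_ofNat]
  unfold Code.randStep at hs
  split at hs
  · simp only [PMF.mem_support_bind_iff, Code.step, PMF.mem_support_pure_iff] at hs
    obtain ⟨i, _, rfl⟩ := hs
    have := Nat.size_le_size (Nat.le_of_lt i.2)
    simp only [Data.size, Nat.succ_eq_add_one]
    omega
  · simp only [Code.step, PMF.mem_support_pure_iff] at hs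
    subst hs
    have := d.size_pos
    simp only [Data.size, Nat.size_zero]
    omega

theorem PPT.randD {N : Data → ℕ} (hN : PTNat N) : PPT fun d => _root_.randD (N d) :=
  PPT.comp Code.rand_polyTime.ppt hN

/-! ### Uniform distributions -/

theorem unif_map_bijective {α β : Type*} [Fintype α] [Nonempty α] [Fintype β] [Nonempty β]
    {f : α → β} (hf : Function.Bijective f) : (unif α).map f = unif β := by
  ext b
  obtain ⟨a, rfl⟩ := hf.2 b
  rw [PMF.map_apply, tsum_eq_single a]
  · simp [PMF.uniformOfFintype_apply, Fintype.card_of_bijective hf]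
  · intro a' ha'
    rw [if_neg fun h => ha' (hf.1 h.symm)]

theorem unif_prod (α β : Type*) [Fintype α] [Nonempty α] [Fintype β] [Nonempty β] :
    unif (α × β) = (unif α).bind fun a => (unif β).map (Prod.mk a) := by
  ext ⟨a, b⟩
  rw [PMF.bind_apply, tsum_eq_single a, PMF.map_apply, tsum_eq_single b]
  · simp only [PMF.uniformOfFintype_apply, Fintype.card_prod, if_true, Nat.cast_mul]
    exact ENNReal.mul_inv (Or.inr (ENNReal.natCast_ne_top _)) (Or.inl (ENNReal.natCast_ne_top _))
  · intro b' h
    rw [if_neg]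
    rintro ⟨⟩
    exact h rfl
  · intro a' h
    rw [PMF.map_apply, ENNReal.tsum_eq_zero.2 fun b' => ?_, mul_zero]
    rw [if_neg]
    rintro ⟨⟩
    exact h rfl

/-- Replacing a component of a uniform element by a fresh uniform value does not change its
distribution. -/
theorem unif_resample {T R : Type*} [Fintype T] [Nonempty T] [Fintype R] [Nonempty R]
    (get : T → R) (set : T → R → T) (h1 : ∀ t ρ, get (set t ρ) = ρ)
    (h2 : ∀ t ρ, set (set t ρ) (get t) = t) :
    unif T = (unif T).bind fun t => (unif R).map (set t) := by
  -- Exchanging the component of the tape with the fresh value is an involution of `T × R`, hence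
  -- preserves the uniform distribution. Projecting to the tape gives the claim.
  have hinv : Function.Involutive fun p : T × R => (set p.1 p.2, get p.1) := by
    rintro ⟨t, ρ⟩
    simp [h1, h2]
  have hfst : (unif (T × R)).map Prod.fst = unif T := by
    rw [unif_prod, PMF.map_bind]
    simp only [PMF.map_comp]
    refine Eq.trans (congrArg _ (funext fun a => ?_)) (PMF.bind_pure _)
    exact PMF.map_const _ _
  conv_lhs => rw [← hfst, ← unif_map_bijective hinv.bijective, PMF.map_comp, unif_prod,
    PMF.map_bind]
  simp only [PMF.map_comp]
  rfl

/-- After resampling, `get` returns the fresh value. Every exact simulation below is an instance: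
one only has to find the right `set`. -/
theorem unif_map_get {T R : Type*} [Fintype T] [Nonempty T] [Fintype R] [Nonempty R]
    (get : T → R) (set : T → R → T) (h1 : ∀ t ρ, get (set t ρ) = ρ)
    (h2 : ∀ t ρ, set (set t ρ) (get t) = t) : (unif T).map get = unif R := by
  rw [unif_resample get set h1 h2, PMF.map_bind]
  simp only [PMF.map_comp, Function.comp_def, h1]
  exact (PMF.bind_const _ _).trans (PMF.map_id _)

/-! ### Lists of independent samples and encodings of uniform elements -/

/-- Independent samples, as a list. -/
noncomputable def seqL : List (PMF Data) → PMF Data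
  | [] => PMF.pure (Data.num 0)
  | p :: l => p.bind fun a => (seqL l).map (Data.pair a)

theorem seqL_pure {α : Type*} (f : α → Data) (l : List α) :
    seqL (l.map fun a => PMF.pure (f a)) = PMF.pure (Data.ofList (l.map f)) := by
  induction l with
  | nil => rfl
  | cons a l ih => simp [seqL, ih, Data.ofList, PMF.pure_map]

theorem Data.mapP_ofList (F : Data → PMF Data) (l : List Data) :
    mapP F (ofList l) = seqL (l.map F) := by
  induction l with
  | nil => rfl
  | cons a l ih => simp [ofList, mapP, seqL, ih]

/-- The coordinates of a uniform family are independent. Resample the coordinate of the first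
member: the other members do not read it, as `e` is injective and the list has no repetitions. -/
theorem unif_pi_bind_seqL {ι κ : Type*} [Fintype ι] [DecidableEq ι] {α : ι → Type*}
    [∀ i, Fintype (α i)] [∀ i, Nonempty (α i)] {e : κ → ι} (he : Function.Injective e)
    (g : ∀ c, α (e c) → PMF Data) (l : List κ) (hl : l.Nodup) :
    (unif (∀ i, α i)).bind (fun f => seqL (l.map fun c => g c (f (e c)))) =
      seqL (l.map fun c => (unif (α (e c))).bind (g c)) := by
  induction l with
  | nil => simp [seqL]
  | cons c l ih =>
    obtain ⟨hc, hl⟩ := List.nodup_cons.1 hl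
    rw [unif_resample (fun f : ∀ i, α i => f (e c)) (fun f a => Function.update f (e c) a)
      (by simp) (by simp)]
    have h : ∀ (f : ∀ i, α i) (a : α (e c)), (l.map fun c' => g c' (Function.update f (e c) a (e c')))
        = l.map fun c' => g c' (f (e c')) := by
      intro f a
      refine List.map_congr_left fun c' hc' => ?_
      rw [Function.update_of_ne]
      exact fun h => hc (he h ▸ hc')
    simp only [List.map_cons, seqL, PMF.bind_bind, PMF.bind_map, Function.comp_def,
      Function.update_self, h]
    rw [PMF.bind_comm]
    refine congrArg _ (funext fun a => ?_)
    rw [PMF.bind_comm]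
    refine congrArg _ (funext fun x => ?_)
    rw [← ih hl, PMF.map_bind]

theorem unif_pi_map_ofList {ι κ : Type*} [Fintype ι] [DecidableEq ι] {α : ι → Type*}
    [∀ i, Fintype (α i)] [∀ i, Nonempty (α i)] {e : κ → ι} (he : Function.Injective e)
    (g : ∀ c, α (e c) → Data) (l : List κ) (hl : l.Nodup) :
    (unif (∀ i, α i)).map (fun f => Data.ofList (l.map fun c => g c (f (e c)))) =
      seqL (l.map fun c => (unif (α (e c))).map (g c)) := by
  have := unif_pi_bind_seqL he (fun c a => PMF.pure (g c a)) l hl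
  simp only [seqL_pure] at this
  exact this

/-- The members of a finite linear order in increasing order. -/
abbrev enum (ι : Type*) [Fintype ι] [LinearOrder ι] : List ι :=
  Finset.univ.sort fun a b : ι => a ≤ b

theorem toData_pi {ι : Type*} [Fintype ι] [LinearOrder ι] {α : ι → Type*} [∀ i, ToData (α i)]
    (f : ∀ i, α i) :
    ToData.toData f = Data.ofList ((enum ι).map fun i => ToData.toData (f i)) := rfl

theorem nodup_enum (ι : Type*) [Fintype ι] [LinearOrder ι] : (enum ι).Nodup :=
  Finset.sort_nodup _ _

theorem length_enum (ι : Type*) [Fintype ι] [LinearOrder ι] :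
    (enum ι).length = Fintype.card ι := by simp

theorem enum_map_const {β : Type*} (ι : Type*) [Fintype ι] [LinearOrder ι] (b : β) :
    (enum ι).map (fun _ => b) = List.replicate (Fintype.card ι) b := by
  simp [List.map_const']

/-- The encoding of a uniform element. -/
noncomputable def sampU (α : Type*) [Fintype α] [Nonempty α] [ToData α] : PMF Data :=
  (unif α).map ToData.toData

/-- Two independent samples. -/
noncomputable def prodP (p r : PMF Data) : PMF Data := p.bind fun a => r.map (Data.pair a)

theorem sampU_prod (α β : Type*) [Fintype α] [Nonempty α] [ToData α] [Fintype β] [Nonempty β]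
    [ToData β] : sampU (α × β) = prodP (sampU α) (sampU β) := by
  simp only [sampU, prodP, unif_prod, PMF.map_bind, PMF.bind_map, PMF.map_comp]
  rfl

theorem sampU_pi (ι α : Type*) [Fintype ι] [LinearOrder ι] [DecidableEq ι] [Fintype α] [Nonempty α] [ToData α] :
    sampU (ι → α) = seqL (List.replicate (Fintype.card ι) (sampU α)) := by
  have := unif_pi_map_ofList (α := fun _ : ι => α) Function.injective_id
    (fun _ a => ToData.toData a) (enum ι) (nodup_enum ι)
  rw [← enum_map_const]
  exact this

theorem mapP_unary (p : PMF Data) (n : ℕ) :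
    Data.mapP (fun _ => p) (Data.unary n) = seqL (List.replicate n p) := by
  rw [Data.unary_eq_ofList, Data.mapP_ofList]
  simp

theorem sampU_pi_eq_mapP (ι α : Type*) [Fintype ι] [LinearOrder ι] [DecidableEq ι] [Fintype α] [Nonempty α]
    [ToData α] :
    sampU (ι → α) = Data.mapP (fun _ => sampU α) (Data.unary (Fintype.card ι)) := by
  rw [sampU_pi, mapP_unary]

theorem sampU_matrix (m n q : ℕ) [NeZero q] :
    sampU (Matrix (Fin m) (Fin n) (ZMod q)) = sampU (Fin m → Fin n → ZMod q) := rfl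

/-- Residues, bit strings and bits are all encoded by the atoms `0, …, m - 1`, so one random
primitive samples them all. -/
theorem sampU_eq_randD {α : Type*} [Fintype α] [Nonempty α] [ToData α] {m : ℕ} (f : Fin m → α)
    (hf : Function.Bijective f) (h : ∀ i, ToData.toData (f i) = Data.num (i : ℕ)) :
    sampU α = randD m := by
  cases m with
  | zero => exact ((hf.2 (Classical.arbitrary α)).choose).elim0
  | succ m =>
    rw [sampU, ← unif_map_bijective hf, PMF.map_comp, randD_succ]
    exact congrArg (fun g => PMF.map g _) (funext h)

theorem sampU_zmod (q : ℕ) [NeZero q] : sampU (ZMod q) = randD q := by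
  cases q with
  | zero => exact absurd rfl (NeZero.ne 0)
  | succ m =>
    exact sampU_eq_randD (show Fin (m + 1) → ZMod (m + 1) from fun i => i)
      Function.bijective_id fun _ => rfl

theorem sampU_bitVec (m : ℕ) : sampU (BitVec m) = randD (2 ^ m) :=
  sampU_eq_randD BitVec.ofFin
    ⟨fun a b h => by simpa using h, fun v => ⟨v.toFin, rfl⟩⟩ fun i => rfl

theorem sampU_bool : sampU Bool = randD 2 :=
  sampU_eq_randD (fun i : Fin 2 => decide ((i : ℕ) = 1)) (by decide)
    fun i => by fin_cases i <;> rfl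

theorem mem_support_sampU {α : Type*} [Fintype α] [Nonempty α] [ToData α] (a : α) :
    ToData.toData a ∈ (sampU α).support := by
  rw [sampU, PMF.mem_support_map_iff]
  exact ⟨a, by simp, rfl⟩

/-! ### Computational indistinguishability -/

theorem acceptProb_bind {Ω : Type*} (D : Code) (k : ℕ) (a : Data) (W : PMF Ω) (X : Ω → PMF Data) :
    acceptProb D k a (W.bind X) = ∑' w, (W w).toReal * acceptProb D k a (X w) := by
  simp only [acceptProb, PMF.bind_bind]
  rw [PMF.bind_apply, ENNReal.tsum_toReal_eq fun w =>
    ENNReal.mul_ne_top (PMF.apply_ne_top _ _) (PMF.apply_ne_top _ _)]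
  simp only [ENNReal.toReal_mul]

theorem acceptProb_nonneg (D : Code) (k : ℕ) (a : Data) (X : PMF Data) :
    0 ≤ acceptProb D k a X := ENNReal.toReal_nonneg

theorem acceptProb_le_one (D : Code) (k : ℕ) (a : Data) (X : PMF Data) :
    acceptProb D k a X ≤ 1 := by
  refine ENNReal.toReal_le_of_le_ofReal zero_le_one ?_
  rw [ENNReal.ofReal_one]
  exact PMF.coe_le_one _ _

theorem PMF.summable_toReal {Ω : Type*} (W : PMF Ω) : Summable fun w => (W w).toReal :=
  ENNReal.summable_toReal (by rw [PMF.tsum_coe]; exact ENNReal.one_ne_top)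

theorem PMF.tsum_toReal {Ω : Type*} (W : PMF Ω) : ∑' w, (W w).toReal = 1 := by
  rw [← ENNReal.tsum_toReal_eq fun w => PMF.apply_ne_top _ _, PMF.tsum_coe, ENNReal.toReal_one]

/-- The acceptance probability of a mixture is the average of the acceptance probabilities, so the
gap is at most a bound on the single gaps. -/
theorem abs_acceptProb_bind_sub_le {Ω : Type*} (D : Code) (k : ℕ) (a : Data) (W : PMF Ω)
    (X Y : Ω → PMF Data) {c : ℝ}
    (h : ∀ w ∈ W.support, |acceptProb D k a (X w) - acceptProb D k a (Y w)| ≤ c) :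
    |acceptProb D k a (W.bind X) - acceptProb D k a (W.bind Y)| ≤ c := by
  have hs : ∀ Z : Ω → PMF Data, Summable fun w => (W w).toReal * acceptProb D k a (Z w) :=
    fun Z => W.summable_toReal.of_nonneg_of_le
      (fun w => mul_nonneg ENNReal.toReal_nonneg (acceptProb_nonneg _ _ _ _))
      (fun w => mul_le_of_le_one_right ENNReal.toReal_nonneg (acceptProb_le_one _ _ _ _))
  have hb : ∀ w, |(W w).toReal * acceptProb D k a (X w) - (W w).toReal * acceptProb D k a (Y w)| ≤
      (W w).toReal * c := by
    intro w
    rw [← mul_sub, abs_mul, abs_of_nonneg ENNReal.toReal_nonneg]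
    by_cases hw : w ∈ W.support
    · exact mul_le_mul_of_nonneg_left (h w hw) ENNReal.toReal_nonneg
    · rw [(PMF.apply_eq_zero_iff W w).2 hw]
      simp
  rw [acceptProb_bind, acceptProb_bind, ← (hs X).tsum_sub (hs Y)]
  calc |∑' w, ((W w).toReal * acceptProb D k a (X w) - (W w).toReal * acceptProb D k a (Y w))|
      ≤ ∑' w, (W w).toReal * c :=
        tsum_of_norm_bounded (f := fun w => (W w).toReal * acceptProb D k a (X w) -
          (W w).toReal * acceptProb D k a (Y w)) (W.summable_toReal.mul_right c).hasSum hb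
    _ = c := by rw [tsum_mul_right, PMF.tsum_toReal, one_mul]

namespace CompIndist

theorem of_abs_le {X Y : ℕ → PMF Data}
    (h : ∀ D : Code, D.PolyTime → ∀ a : ℕ → Data, PolyBounded (fun k => (a k).size) →
      ∃ f : ℕ → ℝ, Asymptotics.SuperpolynomialDecay atTop (fun k : ℕ => (k : ℝ)) f ∧
        ∀ k, |acceptProb D k (a k) (X k) - acceptProb D k (a k) (Y k)| ≤ f k) :
    CompIndist X Y := by
  intro D hD a ha
  obtain ⟨f, hf, hle⟩ := h D hD a ha
  exact hf.trans_abs_le fun k => by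
    rw [abs_abs]
    exact (hle k).trans (le_abs_self _)

theorem refl (X : ℕ → PMF Data) : CompIndist X X := fun D _ a _ =>
  (Asymptotics.superpolynomialDecay_zero atTop (fun k : ℕ => (k : ℝ))).congr fun k => by simp

theorem of_eq {X Y : ℕ → PMF Data} (h : ∀ k, X k = Y k) : CompIndist X Y := funext h ▸ refl X

theorem congr {X Y X' Y' : ℕ → PMF Data} (h : CompIndist X Y) (hX : ∀ k, X k = X' k)
    (hY : ∀ k, Y k = Y' k) : CompIndist X' Y' := funext hX ▸ funext hY ▸ h

/-- The gap vanishes where the two distributions coincide. This disposes of indices outside a list,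
where a default value stands in. -/
theorem of_eq_or {X Y X' Y' : ℕ → PMF Data} (h : CompIndist X' Y')
    (he : ∀ k, X k = Y k ∨ (X k = X' k ∧ Y k = Y' k)) : CompIndist X Y :=
  of_abs_le fun D hD a ha => ⟨_, h D hD a ha, fun k => by
    rcases he k with h | ⟨h, h'⟩
    · simp [h]
    · rw [h, h']⟩

/-- Averaging over an independent choice. -/
theorem bind {Ω : ℕ → Type*} (W : ∀ k, PMF (Ω k)) {X Y : ∀ k, Ω k → PMF Data}
    (h : ∀ w : ∀ k, Ω k, (∀ k, w k ∈ (W k).support) →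
      CompIndist (fun k => X k (w k)) (fun k => Y k (w k))) :
    CompIndist (fun k => (W k).bind (X k)) (fun k => (W k).bind (Y k)) := by
  refine of_abs_le fun D hD a ha => ?_
  -- Some `w` has at least half the average gap. The factor 2 avoids the question whether a supremum
  -- is attained. The choice depends on the distinguisher, which is why the hypothesis speaks of all
  -- sequences `w`.
  have key : ∀ k, ∃ w ∈ (W k).support,
      |acceptProb D k (a k) ((W k).bind (X k)) - acceptProb D k (a k) ((W k).bind (Y k))| ≤
        |acceptProb D k (a k) (X k w) - acceptProb D k (a k) (Y k w)| * 2 := by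
    intro k
    by_contra! hk
    set ε := |acceptProb D k (a k) ((W k).bind (X k)) - acceptProb D k (a k) ((W k).bind (Y k))|
    have h1 : ε ≤ ε / 2 := abs_acceptProb_bind_sub_le D k (a k) (W k) _ _ fun w hw => by
      linarith [hk w hw]
    obtain ⟨w, hw⟩ := (W k).support_nonempty
    have h2 := hk w hw
    have h3 := abs_nonneg (acceptProb D k (a k) (X k w) - acceptProb D k (a k) (Y k w))
    linarith
  choose w hw hle using key
  exact ⟨_, (h w hw D hD a ha).mul_const 2, hle⟩

/-- Post-processing with an advice string. -/
theorem postprocess {X Y : ℕ → PMF Data} (h : CompIndist X Y) {F : Data → PMF Data} (hF : PPT F)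
    {a : ℕ → Data} (ha : PolyBounded fun k => (a k).size) :
    CompIndist (fun k => (X k).bind fun d => F (.pair (.unary k) (.pair (a k) d)))
      (fun k => (Y k).bind fun d => F (.pair (.unary k) (.pair (a k) d))) := by
  intro D hD b hb
  have hG : PPT fun d => (F (.pair d.fst (.pair d.snd.fst.fst d.snd.snd))).bind fun e =>
      D.out (.pair d.fst (.pair d.snd.fst.snd e)) :=
    PPT.bind' (hF.comp (PT.id.fst.pair (PT.id.snd.fst.fst.pair PT.id.snd.snd)))
      (hD.ppt.comp (PT.id.fst.fst.pair (PT.id.fst.snd.fst.snd.pair PT.id.snd)))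
  obtain ⟨D', hD', hout⟩ := hG
  -- The new distinguisher first runs `F`, so its advice holds both the string for `F` and the
  -- advice of `D`.
  have := h D' hD' (fun k => .pair (a k) (b k)) (((ha.add hb).add (PolyBounded.const 1)))
  refine this.congr fun k => ?_
  simp only [acceptProb, hout, PMF.bind_bind]
  rfl

theorem map {X Y : ℕ → PMF Data} (h : CompIndist X Y) {f : Data → Data} (hf : PT f)
    {a : ℕ → Data} (ha : PolyBounded fun k => (a k).size) :
    CompIndist (fun k => (X k).map fun d => f (.pair (.unary k) (.pair (a k) d)))
      (fun k => (Y k).map fun d => f (.pair (.unary k) (.pair (a k) d))) :=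
  h.postprocess hf ha

/-- Hybrid argument. -/
theorem hybrid (H : ℕ → ℕ → PMF Data) {N : ℕ → ℕ} (hN : PolyBounded N)
    (h : ∀ i : ℕ → ℕ, CompIndist (fun k => H k (i k)) (fun k => H k (i k + 1))) :
    CompIndist (fun k => H k 0) (fun k => H k (N k)) := by
  refine of_abs_le fun D hD a ha => ?_
  let δ : ℕ → ℕ → ℝ := fun k i =>
    |acceptProb D k (a k) (H k i) - acceptProb D k (a k) (H k (i + 1))|
  -- For each `k`, take the step with the largest gap; the total gap is at most `N k` times this
  -- one. This is why the hypothesis ranges over all sequences of indices.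
  have key : ∀ k, ∃ i, ∀ j < N k, δ k j ≤ δ k i := by
    intro k
    rcases (Finset.range (N k)).eq_empty_or_nonempty with he | hne
    · exact ⟨0, fun j hj => absurd (Finset.mem_range.2 hj) (he ▸ Finset.notMem_empty j)⟩
    · obtain ⟨i, _, hi⟩ := Finset.exists_max_image _ (δ k) hne
      exact ⟨i, fun j hj => hi j (Finset.mem_range.2 hj)⟩
  choose i hi using key
  obtain ⟨p, hp⟩ := hN
  refine ⟨_, (h i D hD a ha).polynomial_mul (p.map (Nat.castRingHom ℝ)), fun k => ?_⟩
  have tele : ∀ n, |acceptProb D k (a k) (H k 0) - acceptProb D k (a k) (H k n)| ≤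
      ∑ j ∈ Finset.range n, δ k j := by
    intro n
    induction n with
    | zero => simp
    | succ n ih =>
      rw [Finset.sum_range_succ]
      exact (abs_sub_le _ _ _).trans (add_le_add_left ih _)
  have hδ : 0 ≤ δ k (i k) := abs_nonneg _
  calc _ ≤ ∑ j ∈ Finset.range (N k), δ k j := tele _
    _ ≤ ∑ j ∈ Finset.range (N k), δ k (i k) :=
      Finset.sum_le_sum fun j hj => hi k j (Finset.mem_range.1 hj)
    _ = N k * δ k (i k) := by simp
    _ ≤ p.eval k * δ k (i k) := mul_le_mul_of_nonneg_right (by exact_mod_cast hp k) hδ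
    _ = _ := by simp [δ]

end CompIndist

/-! ### Indistinguishability of lists of samples -/

theorem seqL_append (l l' : List (PMF Data)) :
    seqL (l ++ l') = (seqL l).bind fun a => (seqL l').map fun b => Data.append a b := by
  induction l with
  | nil => simp only [List.nil_append, seqL, PMF.pure_bind, Data.append]; exact (PMF.map_id _).symm
  | cons p l ih =>
    simp [seqL, ih, PMF.bind_bind, PMF.map_bind, PMF.bind_map, PMF.map_comp, Function.comp_def,
      Data.append]

theorem size_le_of_mem_support_seqL {l : List (PMF Data)} {B : ℕ}
    (h : ∀ p ∈ l, ∀ d ∈ p.support, d.size ≤ B) :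
    ∀ d ∈ (seqL l).support, d.size ≤ l.length * (B + 1) + 1 := by
  induction l with
  | nil =>
    intro d hd
    simp only [seqL, PMF.mem_support_pure_iff] at hd
    simp [hd, Data.size]
  | cons p l ih =>
    intro d hd
    simp only [seqL, PMF.mem_support_bind_iff, PMF.mem_support_map_iff] at hd
    obtain ⟨a, ha, b, hb, rfl⟩ := hd
    have h1 := h p (by simp) a ha
    have h2 := ih (fun p hp => h p (by simp [hp])) b hb
    simp only [Data.size, List.length_cons, Nat.add_mul, Nat.one_mul] at h2 ⊢
    omega

theorem Data.size_ofList_le {l : List Data} {B : ℕ} (h : ∀ d ∈ l, d.size ≤ B) :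
    (ofList l).size ≤ l.length * (B + 1) + 1 := by
  induction l with
  | nil => simp [ofList, size]
  | cons a l ih =>
    have h1 := h a (by simp)
    have h2 := ih fun d hd => h d (by simp [hd])
    simp only [ofList, size, List.length_cons, Nat.add_mul, Nat.one_mul] at h2 ⊢
    omega

/-- Lists of independent samples are indistinguishable if their members are. -/
theorem CompIndist.seqL {X Y : ℕ → List (PMF Data)} (hlen : ∀ k, (X k).length = (Y k).length)
    (hN : PolyBounded fun k => (X k).length) {B : ℕ → ℕ} (hB : PolyBounded B)
    (hXB : ∀ k, ∀ p ∈ X k, ∀ d ∈ p.support, d.size ≤ B k)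
    (hYB : ∀ k, ∀ p ∈ Y k, ∀ d ∈ p.support, d.size ≤ B k)
    (h : ∀ i : ℕ → ℕ, CompIndist (fun k => (X k).getD (i k) (PMF.pure (.num 0)))
      (fun k => (Y k).getD (i k) (PMF.pure (.num 0)))) :
    CompIndist (fun k => seqL (X k)) (fun k => seqL (Y k)) := by
  -- The `i`-th hybrid takes its first `i` members from `Y` and the others from `X`.
  refine (CompIndist.hybrid (fun k i => _root_.seqL ((Y k).take i ++ (X k).drop i)) hN
    fun i => ?_).congr (fun k => by simp) fun k => by
    rw [hlen, List.take_length, List.drop_eq_nil_of_le (hlen k).le, List.append_nil]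
  -- The members before and after position `i` are common to both hybrids and independent of the one
  -- that changes, so they can be fixed and handed over as advice.
  let W : ℕ → PMF (Data × Data) := fun k => (_root_.seqL ((Y k).take (i k))).bind fun P =>
    (_root_.seqL ((X k).drop (i k + 1))).map fun S => (P, S)
  have hstep : CompIndist
      (fun k => (W k).bind fun w => ((X k).getD (i k) (PMF.pure (.num 0))).map fun d =>
        Data.append w.1 (.pair d w.2))
      (fun k => (W k).bind fun w => ((Y k).getD (i k) (PMF.pure (.num 0))).map fun d =>
        Data.append w.1 (.pair d w.2)) := by
    refine CompIndist.bind W fun w hw => ?_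
    refine (h i).map (f := fun d => Data.append d.snd.fst.fst (.pair d.snd.snd d.snd.fst.snd))
      (a := fun k => .pair (w k).1 (w k).2)
      (PT.append PT.id.snd.fst.fst (PT.id.snd.snd.pair PT.id.snd.fst.snd)) ?_
    have hb : PolyBounded fun k => (X k).length * (B k + 1) + 1 :=
      (hN.mul (hB.add (.const 1))).add (.const 1)
    refine ((hb.add hb).add (.const 1)).mono fun k => ?_
    have := hw k
    simp only [W, PMF.mem_support_bind_iff, PMF.mem_support_map_iff] at this
    obtain ⟨P, hP, S, hS, he⟩ := this
    have h1 := size_le_of_mem_support_seqL (fun p hp => hYB k p (List.mem_of_mem_take hp)) P hP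
    have h2 := size_le_of_mem_support_seqL (fun p hp => hXB k p (List.mem_of_mem_drop hp)) S hS
    have h3 : ((Y k).take (i k)).length * (B k + 1) ≤ (X k).length * (B k + 1) :=
      Nat.mul_le_mul_right _ (by rw [hlen]; simp)
    have h4 : ((X k).drop (i k + 1)).length * (B k + 1) ≤ (X k).length * (B k + 1) :=
      Nat.mul_le_mul_right _ (by simp)
    rw [← he]
    simp only [Data.size]
    omega
  refine hstep.of_eq_or fun k => ?_
  by_cases hi : i k < (X k).length
  · right
    have hi' : i k < (Y k).length := hlen k ▸ hi
    constructor
    · rw [List.drop_eq_getElem_cons hi, seqL_append]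
      simp only [W, PMF.bind_bind, PMF.bind_map, Function.comp_def, _root_.seqL, PMF.map_bind,
        PMF.map_comp]
      refine congrArg _ (funext fun P => ?_)
      simp only [List.getD_eq_getElem?_getD, List.getElem?_eq_getElem hi, Option.getD_some]
      simp only [PMF.map]
      rw [PMF.bind_comm]
      rfl
    · rw [List.take_add_one, List.getElem?_eq_getElem hi', List.append_assoc, seqL_append]
      simp only [W, PMF.bind_bind, PMF.bind_map, Function.comp_def, _root_.seqL, PMF.map_bind,
        PMF.map_comp, Option.toList_some, List.singleton_append]
      refine congrArg _ (funext fun P => ?_)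
      simp only [List.getD_eq_getElem?_getD, List.getElem?_eq_getElem hi', Option.getD_some]
      simp only [PMF.map]
      rw [PMF.bind_comm]
      rfl
  -- Beyond the end of the lists neighbouring hybrids are equal.
  · left
    have hi' : ¬ i k < (Y k).length := hlen k ▸ hi
    rw [List.drop_eq_nil_of_le (by omega), List.drop_eq_nil_of_le (by omega),
      List.take_of_length_le (by omega), List.take_of_length_le (by omega)]

/-- Lists of samples that depend on a common value are indistinguishable if this holds for single
samples. -/
theorem CompIndist.seqL_of_common {E : Data → PMF Data} (hE : PPT E) (Z : ℕ → PMF Data)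
    {X Y : ℕ → List Data} (hlen : ∀ k, (X k).length = (Y k).length)
    (hN : PolyBounded fun k => (X k).length) {B : ℕ → ℕ} (hB : PolyBounded B)
    (hXB : ∀ k, ∀ d ∈ X k, d.size ≤ B k) (hYB : ∀ k, ∀ d ∈ Y k, d.size ≤ B k)
    (h : ∀ i : ℕ → ℕ, CompIndist
      (fun k => (Z k).bind fun z =>
        (E (.pair (.unary k) (.pair z ((X k).getD (i k) (.num 0))))).map (.pair z))
      (fun k => (Z k).bind fun z =>
        (E (.pair (.unary k) (.pair z ((Y k).getD (i k) (.num 0))))).map (.pair z))) :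
    CompIndist
      (fun k => (Z k).bind fun z =>
        (_root_.seqL ((X k).map fun x => E (.pair (.unary k) (.pair z x)))).map (.pair z))
      (fun k => (Z k).bind fun z =>
        (_root_.seqL ((Y k).map fun x => E (.pair (.unary k) (.pair z x)))).map (.pair z)) := by
  refine (CompIndist.hybrid (fun k i => (Z k).bind fun z => (_root_.seqL
    (((Y k).take i ++ (X k).drop i).map fun x => E (.pair (.unary k) (.pair z x)))).map (.pair z))
    hN fun i => ?_).congr (fun k => by simp) fun k => by
    rw [hlen, List.take_length, List.drop_eq_nil_of_le (hlen k).le, List.append_nil]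
  -- The other members depend on the common value `z` and cannot be fixed beforehand. The
  -- post-processing gets their inputs as advice and recomputes them from `z` with `E`.
  have hF : PPT fun d =>
      (Data.mapP (fun x => E (.pair d.fst (.pair d.snd.snd.fst x))) d.snd.fst.fst).bind fun P =>
        (Data.mapP (fun x => E (.pair d.fst (.pair d.snd.snd.fst x))) d.snd.fst.snd).bind fun S =>
          PMF.pure (.pair d.snd.snd.fst (Data.append P (.pair d.snd.snd.snd S))) := by
    have hm : PPT fun d => E (.pair d.fst.fst (.pair d.fst.snd d.snd)) :=
      hE.comp (PT.id.fst.fst.pair (PT.id.fst.snd.pair PT.id.snd))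
    refine PPT.bind' (hm.mapP (PT.id.fst.pair PT.id.snd.snd.fst) PT.id.snd.fst.fst) ?_
    refine PPT.bind' ((hm.mapP (PT.id.fst.pair PT.id.snd.snd.fst) PT.id.snd.fst.snd).comp
      PT.id.fst) ?_
    exact PT.pair PT.id.fst.fst.snd.snd.fst (PT.append PT.id.fst.snd
      (PT.id.fst.fst.snd.snd.snd.pair PT.id.snd))
  have hstep := (h i).postprocess hF (a := fun k =>
    .pair (.ofList ((Y k).take (i k))) (.ofList ((X k).drop (i k + 1)))) (by
    have hb : PolyBounded fun k => (X k).length * (B k + 1) + 1 :=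
      (hN.mul (hB.add (.const 1))).add (.const 1)
    refine ((hb.add hb).add (.const 1)).mono fun k => ?_
    have h1 := Data.size_ofList_le (fun p hp => hYB k p (List.mem_of_mem_take (i := i k) hp))
    have h2 := Data.size_ofList_le (fun p hp => hXB k p (List.mem_of_mem_drop (i := i k + 1) hp))
    have h3 : ((Y k).take (i k)).length * (B k + 1) ≤ (X k).length * (B k + 1) :=
      Nat.mul_le_mul_right _ (by rw [hlen]; simp)
    have h4 : ((X k).drop (i k + 1)).length * (B k + 1) ≤ (X k).length * (B k + 1) :=
      Nat.mul_le_mul_right _ (by simp)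
    simp only [Data.size]
    omega)
  refine hstep.of_eq_or fun k => ?_
  by_cases hi : i k < (X k).length
  · right
    have hi' : i k < (Y k).length := hlen k ▸ hi
    constructor
    · rw [List.drop_eq_getElem_cons hi]
      simp only [PMF.bind_bind, PMF.bind_map, Function.comp_def, Data.fst_pair, Data.snd_pair,
        Data.mapP_ofList, List.map_append, seqL_append, PMF.map_bind, PMF.map_comp, List.map_cons,
        _root_.seqL]
      refine congrArg _ (funext fun z => ?_)
      conv_rhs => rw [PMF.bind_comm]
      refine congrArg _ (funext fun P => ?_)
      simp only [List.getD_eq_getElem?_getD, List.getElem?_eq_getElem hi, Option.getD_some]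
      rfl
    · rw [List.take_add_one, List.getElem?_eq_getElem hi', List.append_assoc]
      simp only [PMF.bind_bind, PMF.bind_map, Function.comp_def, Data.fst_pair, Data.snd_pair,
        Data.mapP_ofList, List.map_append, seqL_append, PMF.map_bind, PMF.map_comp, List.map_cons,
        _root_.seqL, Option.toList_some, List.singleton_append]
      refine congrArg _ (funext fun z => ?_)
      conv_rhs => rw [PMF.bind_comm]
      refine congrArg _ (funext fun P => ?_)
      simp only [List.getD_eq_getElem?_getD, List.getElem?_eq_getElem hi', Option.getD_some]
      rfl
  · left
    have hi' : ¬ i k < (Y k).length := hlen k ▸ hi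
    rw [List.drop_eq_nil_of_le (by omega), List.drop_eq_nil_of_le (by omega),
      List.take_of_length_le (by omega), List.take_of_length_le (by omega)]

/-! ### Correctness of privateMDI -/

theorem addRe_addShr {G : Type*} [AddCommGroup G] {T : ℕ} (x : G) (a : Fin T → G) :
    addRe (addShr x a) = x := by
  simp [addRe, addShr, Fin.sum_univ_castSucc]

theorem sum_testBit_eq_mod (x n : ℕ) :
    (∑ t : Fin n, if x.testBit t then 2 ^ (t : ℕ) else 0) = x % 2 ^ n := by
  rw [Fin.sum_univ_eq_sum_range (fun t => if x.testBit t then 2 ^ t else 0) n]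
  induction n with
  | zero => simp [Nat.mod_one]
  | succ n ih =>
    rw [Finset.sum_range_succ, ih, Nat.mod_pow_succ, Nat.testBit_eq_decide_div_mod_eq]
    rcases Nat.mod_two_eq_zero_or_one (x / 2 ^ n) with h | h <;> simp [h]

theorem val_lt_two_pow_bitLen {q : ℕ} [NeZero q] (a : ZMod q) : a.val < 2 ^ bitLen q :=
  (ZMod.val_lt _).trans_le (Nat.le_pow_clog one_lt_two q)

theorem ofBits_toBits {q n : ℕ} [NeZero q] (v : Vec q n) : ofBits (toBits v) = v := by
  funext i
  have h := congrArg (Nat.cast (R := ZMod q)) (sum_testBit_eq_mod (v i).val (bitLen q))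
  rw [Nat.mod_eq_of_lt (val_lt_two_pow_bitLen _),
    ZMod.natCast_zmod_val] at h
  conv_rhs => rw [← h]
  simp [ofBits, toBits]

/-- With `e = i ⊕ b`, the label `k_0` is masked by `u_e` and `k_1` by `u_{1-e}`; in both cases the
string that masks `k_i` is `u_b`. -/
theorem OT.msg₃_msg₂ {κ : ℕ} (K u : Bool → BitVec κ) (i b : Bool) :
    OT.msg₃ i (OT.msg₂ K u (OT.msg₁ i b)) = K i ^^^ u b := by
  cases i <;> cases b <;> rfl

theorem OT.output_msg₃ {κ : ℕ} (K u : Bool → BitVec κ) (i b : Bool) :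
    OT.output u b (OT.msg₃ i (OT.msg₂ K u (OT.msg₁ i b))) = K i := by
  rw [OT.msg₃_msg₂, OT.output, BitVec.xor_assoc, BitVec.xor_self, BitVec.xor_zero]

namespace PrivateMDI

variable {q : ℕ → ℕ} {HE : LHE q} {GS : GarblingScheme} {k : ℕ} {A : Arch (q k)}

/-- The masks `c_l` (with layers counted from `0`). -/
def mask (M : A.Model) (t : Tape HE GS k A) : ℕ → Vec (q k) A.n
  | 0 => rFirst t
  | l + 1 =>
      if h : l < A.L then
        if hn : A.IsNL ⟨l, h⟩ then r t ⟨⟨l, h⟩, hn⟩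
        else (M ⟨l, h⟩).mulVec (mask M t l) + s t ⟨l, h⟩
      else mask M t l

theorem mask_succ_of_isNL (M : A.Model) (t : Tape HE GS k A) (l : A.NL) :
    mask M t (l.1 + 1) = r t l := by
  rw [mask, dif_pos l.1.2]
  exact dif_pos l.2

theorem mask_succ_of_not_isNL (M : A.Model) (t : Tape HE GS k A) (l : Fin A.L) (hl : ¬A.IsNL l) :
    mask M t (l + 1) = (M l).mulVec (mask M t l) + s t l := by
  rw [mask, dif_pos l.2]
  exact dif_neg hl

/-- The recursion for the masks mentions neither shares nor coins, and it uses `s` only in linear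
layers. -/
theorem mask_congr (M : A.Model) {t t' : Tape HE GS k A}
    (hs : ∀ l, ¬A.IsNL l → s t l = s t' l) (h1 : rFirst t = rFirst t') (h2 : r t = r t') (l : ℕ) :
    mask M t l = mask M t' l := by
  induction l with
  | zero => exact h1
  | succ l ih =>
    simp only [mask, ih, h2]
    split
    · split
      · rfl
      · rw [hs _ ‹_›]
    · rfl

/-- Invariant of the row computation: the accumulated ciphertext encrypts the partial sum. Stating
it for an arbitrary list of columns also covers all but the last column, which is needed for the
client. -/
theorem encrypts_foldl (M : A.Model) (t : Tape HE GS k A) (l : Fin A.L)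
    {ct : Fin A.n → HE.Ct k} {c : Vec (q k) A.n} (hc : ∀ i, HE.Encrypts k (pk t) (ct i) (c i))
    (i : Fin A.n) (is : List (Fin A.n)) {acc : HE.Ct k} {m : ZMod (q k)}
    (h : HE.Encrypts k (pk t) acc m) :
    HE.Encrypts k (pk t) (is.foldl
      (fun acc i' => HE.eval k (pk t) acc (ct i') (1, M l i i') (evalCoin t l i i')) acc)
      (m + (is.map fun i' => M l i i' * c i').sum) := by
  induction is generalizing acc m with
  | nil => simpa using h
  | cons i' is ih =>
    have := ih (LHE.Encrypts.eval 1 (M l i i') (evalCoin t l i i') h (hc i'))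
    rw [List.foldl_cons, List.map_cons, List.sum_cons, ← add_assoc]
    rwa [one_mul] at this

theorem encrypts_linEnc (M : A.Model) (t : Tape HE GS k A) (l : Fin A.L)
    {ct : Fin A.n → HE.Ct k} {c : Vec (q k) A.n} (hc : ∀ i, HE.Encrypts k (pk t) (ct i) (c i))
    (i : Fin A.n) :
    HE.Encrypts k (pk t) (linEnc M t l ct i) ((M l).mulVec c i + s t l i) := by
  have := encrypts_foldl M t l hc i (List.finRange A.n)
    (LHE.Encrypts.enc (s t l i) (encSCoin t l i))
  rw [← Fin.sum_univ_def, add_comm] at this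
  exact this

theorem encrypts_cEnc (M : A.Model) (t : Tape HE GS k A) (l : ℕ) :
    ∀ i, HE.Encrypts k (pk t) (cEnc M t l i) (mask M t l i) := by
  induction l with
  | zero => exact fun i => LHE.Encrypts.enc _ _
  | succ l ih =>
    intro i
    rw [cEnc, mask]
    split
    · split
      · exact LHE.Encrypts.enc _ _
      · exact encrypts_linEnc M t _ ih i
    · exact ih i

/-- The value `M_l · c_l + s_l`. -/
def shifted (M : A.Model) (t : Tape HE GS k A) (l : Fin A.L) : Vec (q k) A.n :=
  (M l).mulVec (mask M t l) + s t l

theorem z_eq (hHE : HE.Correct) (M : A.Model) (t : Tape HE GS k A) (l : A.NL) :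
    z M t l = shifted M t l.1 :=
  funext fun i => hHE _ _ _ _ (encrypts_linEnc M t l.1 (encrypts_cEnc M t l.1) i)

theorem clientBits_eq (hHE : HE.Correct) (M : A.Model) (t : Tape HE GS k A) (l : A.NL) :
    clientBits M t l = Fin.append (toBits (shifted M t l.1)) (toBits (r t l)) := by
  rw [clientBits, z_eq hHE]

/-- Correct decryption makes the client's bits a function of `s` and the client's masks alone, so
the remaining randomness may be changed freely. -/
theorem clientBits_congr (hHE : HE.Correct) (M : A.Model) {t t' : Tape HE GS k A}
    (hs : s t = s t') (h1 : rFirst t = rFirst t') (h2 : r t = r t') (l : A.NL) :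
    clientBits M t l = clientBits M t' l := by
  rw [clientBits_eq hHE, clientBits_eq hHE, shifted, shifted,
    mask_congr M (fun l _ => congrFun hs l) h1 h2, hs, h2]

theorem cFinal_eq (hHE : HE.Correct) (M : A.Model) (t : Tape HE GS k A) :
    cFinal M t = mask M t A.L := by
  rw [cFinal]
  split
  · rename_i h
    have := mask_succ_of_isNL M t ⟨A.last, h⟩
    rw [← this]
    exact congrArg _ (Nat.succ_pred_eq_of_pos A.L_pos)
  · exact funext fun i => hHE _ _ _ _ (encrypts_cEnc M t A.L i)

/-- Each server's result is linear in its pair of shares, so adding the results is the same as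
reconstructing first. -/
theorem lin_eq (M : A.Model) (t : Tape HE GS k A) (l : Fin A.L) (d : Vec (q k) A.n) :
    lin M t l d = (M l).mulVec d - s t l := by
  have h1 : addRe (shareM M t l) = M l := addRe_addShr _ _
  have h2 : addRe (shareS t l) = s t l := addRe_addShr _ _
  conv_rhs => rw [← h1, ← h2]
  simp only [lin, addRe, linOut, Finset.sum_sub_distrib, Matrix.sum_mulVec]

theorem ot₃_eq (M : A.Model) (t : Tape HE GS k A) (l : A.NL) (i : Fin (A.bits + A.bits)) :
    ot₃ M t l i = clientLabels t l i (clientBits M t l i) ^^^ u t l i (b t l i) :=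
  OT.msg₃_msg₂ _ _ _ _

theorem append_labels {m n : ℕ} {κ : Type*} (K : Fin (m + n) → Bool → κ) (v : Fin m → Bool)
    (w : Fin n → Bool) :
    (Fin.append (fun i => K (Fin.castAdd n i) (v i)) fun i => K (Fin.natAdd m i) (w i)) =
      fun i => K i (Fin.append v w i) := by
  funext i
  refine Fin.addCases (fun i => ?_) (fun i => ?_) i <;> simp

/-- The oblivious transfers deliver the labels of `(z, r)` and the garbler those of `w`; together
they are the labels of one circuit input, to which correctness of garbling applies. -/
theorem evalOut_eq [NeZero (q k)] (hGS : GS.Correct) (M : A.Model) (t : Tape HE GS k A) (l : A.NL)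
    (w : Vec (q k) A.n) :
    evalOut M t l w = (A.nonlin l).fn (w + z M t l) - r t l := by
  have h : (Fin.append (onlineLabels t l w) fun i => OT.output (u t l i) (b t l i) (ot₃ M t l i)) =
      fun i => (GS.garble k (A.nonlin l).circuit (garbleCoin t l)).2 i
        (Fin.append (toBits w) (clientBits M t l) i) := by
    rw [← append_labels]
    congr 1
    exact funext fun i => OT.output_msg₃ _ _ _ _
  rw [evalOut, h, gc, hGS, clientBits, (A.nonlin l).spec, ofBits_toBits]

/-- The online phase computes the input of each layer, masked with `c_l`. -/
theorem masked_eq [NeZero (q k)] (hHE : HE.Correct) (hGS : GS.Correct) (M : A.Model)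
    (x : Vec (q k) A.n) (t : Tape HE GS k A) (l : ℕ) :
    masked M x t l = A.act M x l - mask M t l := by
  induction l with
  | zero => rfl
  | succ l ih =>
    rw [masked, Arch.act, mask]
    split
    · rename_i h
      split
      · rename_i hn
        -- Here `M (x_l - c_l) - s + (M c_l + s) = M x_l`.
        rw [evalOut_eq hGS, lin_eq, z_eq hHE, ih, shifted]
        simp only [Matrix.mulVec_sub]
        congr 2
        abel
      · rw [lin_eq, ih, Matrix.mulVec_sub]
        abel
    · exact ih

theorem masked_succ_of_isNL [NeZero (q k)] (hHE : HE.Correct) (hGS : GS.Correct) (M : A.Model)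
    (x : Vec (q k) A.n) (t : Tape HE GS k A) (l : A.NL) :
    masked M x t (l.1 + 1) = A.act M x (l.1 + 1) - r t l := by
  rw [masked_eq hHE hGS, mask_succ_of_isNL]

theorem masked_succ_of_not_isNL (M : A.Model) (x : Vec (q k) A.n) (t : Tape HE GS k A)
    (l : Fin A.L) (hl : ¬A.IsNL l) :
    masked M x t (l + 1) = (M l).mulVec (masked M x t l) - s t l := by
  rw [masked, dif_pos l.2, dif_neg hl, lin_eq]

theorem clientOut_eq [NeZero (q k)] (hHE : HE.Correct) (hGS : GS.Correct) (M : A.Model)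
    (x : Vec (q k) A.n) (t : Tape HE GS k A) : clientOut M x t = A.infer M x := by
  rw [clientOut, masked_eq hHE hGS, cFinal_eq hHE, sub_add_cancel, Arch.infer]

theorem protocol_correct [∀ k, NeZero (q k)] (hHE : HE.Correct) (hGS : GS.Correct) :
    (protocol HE GS).Correct := by
  intro k A M x
  have : clientOut (HE := HE) (GS := GS) M x = Function.const _ (A.infer M x) :=
    funext fun t => clientOut_eq hHE hGS M x t
  simp only [protocol, this, PMF.map_const]

end PrivateMDI

/-! ### Samplers -/

/-- The number represented by a unary string. -/
def Data.ulen (d : Data) : ℕ := (d.size - 1) / 2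

@[simp] theorem Data.ulen_unary (n : ℕ) : (unary n).ulen = n := by
  rw [ulen, size_unary]
  omega

/-- A list of independent samples whose length is given in unary. -/
noncomputable def repS (p : PMF Data) (n : Data) : PMF Data := Data.mapP (fun _ => p) n

theorem sampU_pi_eq_repS (ι α : Type*) [Fintype ι] [LinearOrder ι] [DecidableEq ι] [Fintype α] [Nonempty α]
    [ToData α] : sampU (ι → α) = repS (sampU α) (.unary (Fintype.card ι)) :=
  sampU_pi_eq_mapP ι α

theorem sampU_fin_pi (n : ℕ) (α : Type*) [Fintype α] [Nonempty α] [ToData α] :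
    sampU (Fin n → α) = repS (sampU α) (.unary n) := by
  rw [sampU_pi_eq_repS, Fintype.card_fin]

/-- A uniform bit string whose length is a polynomial in the number represented by `d`. -/
noncomputable def bitsS (p : Polynomial ℕ) (d : Data) : PMF Data := randD (2 ^ p.eval d.ulen)

theorem bitsS_unary (p : Polynomial ℕ) (k : ℕ) :
    bitsS p (.unary k) = sampU (BitVec (p.eval k)) := by
  rw [bitsS, Data.ulen_unary, sampU_bitVec]

/-- A uniform vector. -/
noncomputable def vecS (q n : Data) : PMF Data := repS (randD q.val) n

theorem vecS_unary (q n : ℕ) [NeZero q] : vecS (.num q) (.unary n) = sampU (Vec q n) := by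
  rw [vecS, Data.val_num, ← sampU_zmod, ← sampU_fin_pi]

/-- A uniform square matrix. -/
noncomputable def matS (q n : Data) : PMF Data := repS (vecS q n) n

theorem matS_unary (q n : ℕ) [NeZero q] :
    matS (.num q) (.unary n) = sampU (Matrix (Fin n) (Fin n) (ZMod q)) := by
  rw [matS, vecS_unary, ← sampU_fin_pi, sampU_matrix]

namespace PPT

theorem rep {F : Data → PMF Data} (hF : PPT F) {n : Data → Data} (hn : PT n) :
    PPT fun d => repS (F d) (n d) :=
  (PPT.mapP (hF.comp PT.id.fst) PT.id hn).congr fun _ => rfl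

theorem prodP {F G : Data → PMF Data} (hF : PPT F) (hG : PPT G) :
    PPT fun d => _root_.prodP (F d) (G d) := hF.pair hG

end PPT

theorem PTNat.ulen {f : Data → Data} (hf : PT f) : PTNat fun d => (f d).ulen :=
  ((dataSize hf).sub (const 1)).div (const 2)

theorem Data.ulen_le (d : Data) : d.ulen ≤ d.size := by
  rw [ulen]
  omega

theorem PPT.bits (p : Polynomial ℕ) {f : Data → Data} (hf : PT f) :
    PPT fun d => bitsS p (f d) := by
  obtain ⟨r, hr⟩ := hf.size_le
  refine PPT.randD (PTNat.two_pow (PTNat.polyEval p (PTNat.ulen hf)) (p.comp r) fun d => ?_)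
  rw [Polynomial.eval_comp]
  exact p.eval_nat_mono ((f d).ulen_le.trans (hr d))

theorem PPT.vec {q n : Data → Data} (hq : PT q) (hn : PT n) :
    PPT fun d => vecS (q d) (n d) := (PPT.randD (PTNat.val hq)).rep hn

theorem PPT.mat {q n : Data → Data} (hq : PT q) (hn : PT n) :
    PPT fun d => matS (q d) (n d) := (PPT.vec hq hn).rep hn

theorem PPT.bool : PPT fun _ => sampU Bool :=
  (PPT.randD (PTNat.const 2)).congr fun _ => sampU_bool.symm

namespace PrivateMDI

variable {q : ℕ → ℕ} {HE : LHE q} {GS : GarblingScheme} {k : ℕ} {A : Arch (q k)}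

/-! ### Computing servers -/

/-- The run with other random shares. -/
def setRand (t : Tape HE GS k A)
    (a : Fin A.L → Fin A.T → Matrix (Fin A.n) (Fin A.n) (ZMod (q k)))
    (b : Fin A.L → Fin A.T → Vec (q k) A.n) : Tape HE GS k A :=
  ((s t, a, b, t.1.2.2.2), t.2)

/-- The run with other masks, such that the masked inputs are `δ`. -/
def setMasked (M : A.Model) (x : Vec (q k) A.n) (t : Tape HE GS k A) (δ : ℕ → Vec (q k) A.n) :
    Tape HE GS k A :=
  ((fun l => if A.IsNL l then s t l else (M l).mulVec (δ l) - δ (l + 1), t.1.2),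
    (keyCoin t, (x - δ 0, encFirstCoin t),
      fun l => (A.act M x (l.1 + 1) - δ (l.1 + 1), encRCoin t l)), t.2.2)

theorem setMasked_congr (M : A.Model) (x : Vec (q k) A.n) (t : Tape HE GS k A)
    {δ δ' : ℕ → Vec (q k) A.n} (h : ∀ l ≤ A.L, δ l = δ' l) :
    setMasked M x t δ = setMasked M x t δ' := by
  have h1 : ∀ l : Fin A.L, δ l = δ' l := fun l => h _ l.2.le
  have h2 : ∀ l : Fin A.L, δ (l + 1) = δ' (l + 1) := fun l => h _ l.2
  simp only [setMasked, h1, h2, h 0 (Nat.zero_le _)]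

theorem setMasked_setMasked (M : A.Model) (x : Vec (q k) A.n) (t : Tape HE GS k A)
    (δ δ' : ℕ → Vec (q k) A.n) :
    setMasked M x (setMasked M x t δ) δ' = setMasked M x t δ' := by
  refine Prod.ext (Prod.ext (funext fun l => ?_) rfl) rfl
  simp only [setMasked, s]
  split_ifs <;> rfl

/-- The shares and masked inputs that a computing server sees. -/
abbrev ComputingSeen (A : Arch (q k)) (j : Fin A.P) : Type :=
  A.CL j → Matrix (Fin A.n) (Fin A.n) (ZMod (q k)) × Vec (q k) A.n × Vec (q k) A.n

/-- What a computing server sees. -/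
def computingSeen (M : A.Model) (x : Vec (q k) A.n) (j : Fin A.P) (v : Fin A.T)
    (t : Tape HE GS k A) : ComputingSeen A j :=
  fun l => (randM t l.1 v, randS t l.1 v, masked M x t l.1)

theorem computingView_eq (M : A.Model) (x : Vec (q k) A.n) (j : Fin A.P) (v : Fin A.T)
    (t : Tape HE GS k A) :
    computingView M x j v t = ToData.toData (computingSeen M x j v t) := by
  simp only [computingView, shareM, shareS, addShr, Fin.snoc_castSucc]
  rfl

variable [NeZero (q k)]

/-- Each masked input has a mask of its own that can be solved for: `r` after a non-linear layer,
where it is subtracted last, and `s_l` in a linear one, where `M δ_l - (M δ_l - δ_{l+1}) = δ_{l+1}`.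
-/
theorem masked_setMasked (hHE : HE.Correct) (hGS : GS.Correct) (M : A.Model)
    (x : Vec (q k) A.n) (t : Tape HE GS k A) (δ : ℕ → Vec (q k) A.n) (l : ℕ) (hl : l ≤ A.L) :
    masked M x (setMasked M x t δ) l = δ l := by
  induction l with
  | zero => simp [masked, rFirst, setMasked]
  | succ l ih =>
    by_cases hn : A.IsNL ⟨l, hl⟩
    · have := masked_succ_of_isNL hHE hGS M x (setMasked M x t δ) ⟨⟨l, hl⟩, hn⟩
      simp only at this
      rw [this, r]
      simp [setMasked]
    · have := masked_succ_of_not_isNL M x (setMasked M x t δ) ⟨l, hl⟩ hn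
      simp only at this
      rw [this, ih (Nat.le_of_succ_le hl), s]
      simp [setMasked, hn]

/-- The masked inputs determine the masks that `setMasked` replaces, so the change of coordinates is
reversible. -/
theorem setMasked_masked (hHE : HE.Correct) (hGS : GS.Correct) (M : A.Model)
    (x : Vec (q k) A.n) (t : Tape HE GS k A) : setMasked M x t (masked M x t) = t := by
  have h1 : ∀ l, (if A.IsNL l then s t l
      else (M l).mulVec (masked M x t l) - masked M x t (l + 1)) = s t l := by
    intro l
    split
    · rfl
    · rename_i h
      rw [masked_succ_of_not_isNL M x t l h]
      abel
  have h2 : x - masked M x t 0 = rFirst t := by rw [masked]; abel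
  have h3 : ∀ l : A.NL, A.act M x (l.1 + 1) - masked M x t (l.1 + 1) = r t l := by
    intro l
    rw [masked_succ_of_isNL hHE hGS]
    abel
  simp only [setMasked, h1, h2, h3]
  rfl

open Classical in
/-- The run in which a computing server sees prescribed values. -/
noncomputable def setComputingSeen (M : A.Model) (x : Vec (q k) A.n) (j : Fin A.P) (v : Fin A.T)
    (t : Tape HE GS k A) (ρ : ComputingSeen A j) : Tape HE GS k A :=
  setMasked M x
    (setRand t
      (fun l => if h : A.InCluster j l then Function.update (randM t l) v (ρ ⟨l, h⟩).1
        else randM t l)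
      (fun l => if h : A.InCluster j l then Function.update (randS t l) v (ρ ⟨l, h⟩).2.1
        else randS t l))
    (fun l => if h : ∃ hl : l < A.L, A.InCluster j ⟨l, hl⟩ then (ρ ⟨⟨l, h.1⟩, h.2⟩).2.2
      else masked M x t l)

theorem computingSeen_set (hHE : HE.Correct) (hGS : GS.Correct) (M : A.Model)
    (x : Vec (q k) A.n) (j : Fin A.P) (v : Fin A.T) (t : Tape HE GS k A) (ρ : ComputingSeen A j) :
    computingSeen M x j v (setComputingSeen M x j v t ρ) = ρ := by
  funext l
  have h : ∃ hl : l.1.1 < A.L, A.InCluster j ⟨l.1.1, hl⟩ := ⟨l.1.2, l.2⟩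
  refine Prod.ext ?_ (Prod.ext ?_ ?_)
  · change (if h : A.InCluster j l.1 then Function.update (randM t l.1) v (ρ ⟨l.1, h⟩).1
      else randM t l.1) v = _
    rw [dif_pos l.2, Function.update_self]
  · change (if h : A.InCluster j l.1 then Function.update (randS t l.1) v (ρ ⟨l.1, h⟩).2.1
      else randS t l.1) v = _
    rw [dif_pos l.2, Function.update_self]
  · simp only [computingSeen, setComputingSeen]
    rw [masked_setMasked hHE hGS _ _ _ _ _ l.1.2.le, dif_pos h]

theorem setComputingSeen_set (hHE : HE.Correct) (hGS : GS.Correct) (M : A.Model)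
    (x : Vec (q k) A.n) (j : Fin A.P) (v : Fin A.T) (t : Tape HE GS k A) (ρ : ComputingSeen A j) :
    setComputingSeen M x j v (setComputingSeen M x j v t ρ) (computingSeen M x j v t) = t := by
  have h1 : ∀ l, (if h : A.InCluster j l then
      Function.update (randM (setComputingSeen M x j v t ρ) l) v (randM t l v)
      else randM (setComputingSeen M x j v t ρ) l) = randM t l := by
    intro l
    have : randM (setComputingSeen M x j v t ρ) l = if h : A.InCluster j l then
      Function.update (randM t l) v (ρ ⟨l, h⟩).1 else randM t l := rfl
    rw [this]
    split <;> simp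
  have h2 : ∀ l, (if h : A.InCluster j l then
      Function.update (randS (setComputingSeen M x j v t ρ) l) v (randS t l v)
      else randS (setComputingSeen M x j v t ρ) l) = randS t l := by
    intro l
    have : randS (setComputingSeen M x j v t ρ) l = if h : A.InCluster j l then
      Function.update (randS t l) v (ρ ⟨l, h⟩).2.1 else randS t l := rfl
    rw [this]
    split <;> simp
  -- Inside the cluster the prescribed masked inputs are those of `t`; outside they were never
  -- changed. So the second `setMasked` aims at all masked inputs of `t`.
  rw [setComputingSeen, setMasked_congr (δ' := masked M x t)]
  · simp only [computingSeen, h1, h2]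
    have : setRand (setComputingSeen M x j v t ρ) (fun l => randM t l) (fun l => randS t l) =
      setMasked M x t (fun l => if h : ∃ hl : l < A.L, A.InCluster j ⟨l, hl⟩ then
        (ρ ⟨⟨l, h.1⟩, h.2⟩).2.2 else masked M x t l) := rfl
    rw [this, setMasked_setMasked, setMasked_masked hHE hGS]
  · intro l hl
    split
    · rfl
    · rename_i h
      rw [setComputingSeen, masked_setMasked hHE hGS _ _ _ _ _ hl, dif_neg h]

end PrivateMDI

namespace PrivateMDI

variable {q : ℕ → ℕ} {HE : LHE q} {GS : GarblingScheme} [∀ k, NeZero (q k)]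

set_option synthInstance.maxSize 1000 in
-- The simulation is exact: a computing server holds only freely chosen shares, never the correcting
-- last one, and the masked inputs are independent of these.
theorem secureComputing (hHE : HE.Correct) (hGS : GS.Correct) :
    (protocol HE GS).SecureComputing := by
  have hS : PPT fun d => repS (prodP (matS d.snd.fst d.snd.snd.fst)
      (prodP (vecS d.snd.fst d.snd.snd.fst) (vecS d.snd.fst d.snd.snd.fst))) d.snd.snd.snd :=
    ((PPT.mat PT.id.snd.fst PT.id.snd.snd.fst).prodP
      ((PPT.vec PT.id.snd.fst PT.id.snd.snd.fst).prodP
        (PPT.vec PT.id.snd.fst PT.id.snd.snd.fst))).rep PT.id.snd.snd.snd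
  obtain ⟨c, hc, hout⟩ := hS
  refine ⟨c, hc, fun A M x j v _ => CompIndist.of_eq fun k => ?_⟩
  have h1 : (sample HE GS k (A k)).map (computingSeen (M k) (x k) (j k) (v k)) =
      unif (ComputingSeen (A k) (j k)) :=
    unif_map_get _ (setComputingSeen (M k) (x k) (j k) (v k))
      (computingSeen_set hHE hGS _ _ _ _) (setComputingSeen_set hHE hGS _ _ _ _)
  have h2 : (protocol HE GS).viewComputing k (A k) (M k) (x k) (j k) (v k) =
      sampU (ComputingSeen (A k) (j k)) := by
    rw [sampU, ← h1, PMF.map_comp]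
    exact congrArg (fun f => PMF.map f _) (funext fun t => computingView_eq _ _ _ _ _)
  rw [h2, hout, sampU_pi_eq_repS ((A k).CL (j k)), sampU_prod, sampU_prod, ← matS_unary, ← vecS_unary]
  rfl

end PrivateMDI

/-- Overwrite the members of a family whose indices satisfy a predicate. -/
def overwrite {ι : Type*} {α : ι → Type*} {P : ι → Prop} [DecidablePred P] (f : ∀ i, α i)
    (ρ : ∀ c : {i // P i}, α c.1) : ∀ i, α i :=
  fun i => if h : P i then ρ ⟨i, h⟩ else f i

section overwrite

variable {ι : Type*} {α : ι → Type*} {P : ι → Prop} [DecidablePred P]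

theorem overwrite_apply (f : ∀ i, α i) (ρ : ∀ c : {i // P i}, α c.1) (c : {i // P i}) :
    overwrite f ρ c.1 = ρ c := dif_pos c.2

theorem overwrite_of_not (f : ∀ i, α i) (ρ : ∀ c : {i // P i}, α c.1) {i : ι} (h : ¬P i) :
    overwrite f ρ i = f i := dif_neg h

theorem overwrite_overwrite_self (f : ∀ i, α i) (ρ : ∀ c : {i // P i}, α c.1) :
    overwrite (overwrite f ρ) (fun c : {i // P i} => f c.1) = f := by
  funext i
  unfold overwrite
  split <;> rfl

end overwrite

theorem unif_prod_map_pair {α β : Type*} [Fintype α] [Nonempty α] [Fintype β] [Nonempty β]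
    (f : α → Data) (g : β → Data) :
    (unif (α × β)).map (fun p => Data.pair (f p.1) (g p.2)) =
      prodP ((unif α).map f) ((unif β).map g) := by
  simp only [prodP, unif_prod, PMF.map_bind, PMF.bind_map, PMF.map_comp, Function.comp_def]

theorem repS_ofList (p : PMF Data) (l : List Data) : repS p (.ofList l) = repS p (.unary l.length) := by
  rw [repS, repS, Data.mapP_ofList, mapP_unary, List.map_const']

/-- The length of a list, in unary. -/
def Data.ulist (l : Data) : Data := mapD (fun _ => num 0) l

theorem Data.ulist_ofList (l : List Data) : (ofList l).ulist = unary l.length := by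
  rw [ulist, mapD_ofList, unary_eq_ofList, List.map_const']

theorem PT.ulist {f : Data → Data} (hf : PT f) : PT fun d => (f d).ulist :=
  (PT.mapD (f := fun _ => .num 0) (PT.num 0) PT.id hf).congr fun _ => rfl

theorem Data.length_le_size_ofList (l : List Data) : l.length ≤ (ofList l).size := by
  induction l with
  | nil => simp
  | cons a l ih =>
    simp only [ofList, size, List.length_cons]
    omega

theorem Data.append_unary (m n : ℕ) : append (unary m) (unary n) = unary (m + n) := by
  simp only [unary_eq_ofList, append_ofList, List.replicate_append_replicate]

namespace PrivateMDI

variable {q : ℕ → ℕ} {HE : LHE q} {GS : GarblingScheme} {k : ℕ} {A : Arch (q k)}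

/-! ### Garblers -/

/-- `setMasked` discards the client's masks and the `s_l` of linear layers; the tapes need to agree
on the rest only. -/
theorem setMasked_congr_tape (M : A.Model) (x : Vec (q k) A.n) {t t' : Tape HE GS k A}
    (δ : ℕ → Vec (q k) A.n) (hs : ∀ l, A.IsNL l → s t l = s t' l) (h1 : t.1.2 = t'.1.2)
    (h2 : keyCoin t = keyCoin t') (h3 : encFirstCoin t = encFirstCoin t')
    (h4 : encRCoin t = encRCoin t') (h5 : t.2.2 = t'.2.2) :
    setMasked M x t δ = setMasked M x t' δ := by
  simp only [setMasked, h1, h2, h3, h4, h5]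
  refine Prod.ext (Prod.ext (funext fun l => ?_) rfl) rfl
  dsimp only
  split
  · exact hs l ‹_›
  · rfl

/-- The random values that a garbler sees. -/
abbrev GarblerSeen (GS : GarblingScheme) (A : Arch (q k)) (j : Fin A.P) : Type :=
  ((l : A.CNL j) → GS.Coin k (A.nonlin l.1).circuit ×
    (Fin (A.bits + A.bits) → Bool → GS.Label k)) ×
  (A.CL j → Matrix (Fin A.n) (Fin A.n) (ZMod (q k)) × Vec (q k) A.n) ×
  (A.CNL j → Fin (A.bits + A.bits) → Bool) ×
  Vec (q k) A.n ×
  (A.CL j → Fin A.T → Vec (q k) A.n) ×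
  (A.CNL j → Vec (q k) A.n)

/-- What a garbler sees. -/
def garblerSeen (M : A.Model) (x : Vec (q k) A.n) (j : Fin A.P) (t : Tape HE GS k A) :
    GarblerSeen GS A j :=
  (fun l => (garbleCoin t l.1, u t l.1),
    fun l => (shareM M t l.1 (Fin.last A.T), shareS t l.1 (Fin.last A.T)),
    fun l => ot₁ M t l.1,
    masked M x t (A.bd j),
    fun l => fun v : Fin A.T => linOut M t l.1 (masked M x t l.1) v.castSucc,
    fun l => masked M x t (l.1.1 + 1))

/-- The masked inputs that result from what the garbler of cluster `j` sees; outside the cluster they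
are `d`. -/
def garblerMasked (A : Arch (q k)) (j : Fin A.P) (d : ℕ → Vec (q k) A.n)
    (ρ : GarblerSeen GS A j) : ℕ → Vec (q k) A.n
  | 0 => if A.bd j = 0 then ρ.2.2.2.1 else d 0
  | l + 1 =>
      if l + 1 = A.bd j then ρ.2.2.2.1
      else if h : ∃ hl : l < A.L, A.InCluster j ⟨l, hl⟩ then
        if hn : A.IsNL ⟨l, h.1⟩ then ρ.2.2.2.2.2 ⟨⟨⟨l, h.1⟩, hn⟩, h.2⟩
        else (ρ.2.1 ⟨⟨l, h.1⟩, h.2⟩).1.mulVec (garblerMasked A j d ρ l) +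
          ∑ v, ρ.2.2.2.2.1 ⟨⟨l, h.1⟩, h.2⟩ v - (ρ.2.1 ⟨⟨l, h.1⟩, h.2⟩).2
      else d (l + 1)

/-- The first computing server. -/
def firstServer (A : Arch (q k)) : Fin A.T := ⟨0, A.T_pos⟩

/-- The shares of the computing servers that result from what the garbler sees. -/
def garblerRandM (M : A.Model) (j : Fin A.P) (t : Tape HE GS k A) (ρ : GarblerSeen GS A j) :
    Fin A.L → Fin A.T → Matrix (Fin A.n) (Fin A.n) (ZMod (q k)) :=
  overwrite (randM t) fun l : A.CL j => Function.update (randM t l.1) (firstServer A)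
    (M l.1 - (ρ.2.1 l).1 - ∑ v ∈ Finset.univ.erase (firstServer A), randM t l.1 v)

/-- The shares of the computing servers that result from what the garbler sees. -/
def garblerRandS (M : A.Model) (x : Vec (q k) A.n) (j : Fin A.P) (t : Tape HE GS k A)
    (ρ : GarblerSeen GS A j) : Fin A.L → Fin A.T → Vec (q k) A.n :=
  overwrite (randS t) fun l : A.CL j => fun v =>
    (garblerRandM M j t ρ l.1 v).mulVec (garblerMasked A j (masked M x t) ρ l.1) -
      ρ.2.2.2.2.1 l v

/-- The masks that result from what the garbler sees. -/
def garblerS (M : A.Model) (x : Vec (q k) A.n) (j : Fin A.P) (t : Tape HE GS k A)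
    (ρ : GarblerSeen GS A j) : Fin A.L → Vec (q k) A.n :=
  overwrite (s t) fun l : A.CL j => (ρ.2.1 l).2 + ∑ v, garblerRandS M x j t ρ l.1 v

/-- A run in which the garbler sees prescribed values, except for the bits of the oblivious
transfers, with the bits `β` shared by client and evaluator. -/
def garblerTape (M : A.Model) (x : Vec (q k) A.n) (j : Fin A.P) (t : Tape HE GS k A)
    (ρ : GarblerSeen GS A j) (β : TapeB A) : Tape HE GS k A :=
  setMasked M x
    ((garblerS M x j t ρ, garblerRandM M j t ρ, garblerRandS M x j t ρ, t.1.2.2.2), t.2.1,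
      overwrite (garbleCoin t) (fun l : A.CNL j => (ρ.1 l).1), β,
      overwrite (u t) fun l : A.CNL j => (ρ.1 l).2)
    (garblerMasked A j (masked M x t) ρ)

/-- The run in which the garbler sees prescribed values. -/
def setGarblerSeen (M : A.Model) (x : Vec (q k) A.n) (j : Fin A.P) (t : Tape HE GS k A)
    (ρ : GarblerSeen GS A j) : Tape HE GS k A :=
  garblerTape M x j t ρ (overwrite (b t) fun l : A.CNL j => fun i =>
    Bool.xor (clientBits M (garblerTape M x j t ρ (b t)) l.1 i) (ρ.2.2.1 l i))

theorem garblerMasked_bd (j : Fin A.P) (d : ℕ → Vec (q k) A.n) (ρ : GarblerSeen GS A j) :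
    garblerMasked A j d ρ (A.bd j) = ρ.2.2.2.1 := by
  rcases h : A.bd j with _ | l
  · rw [garblerMasked, if_pos h]
  · rw [garblerMasked, if_pos h.symm]

theorem garblerMasked_succ_of_isNL (j : Fin A.P) (d : ℕ → Vec (q k) A.n)
    (ρ : GarblerSeen GS A j) (l : A.CNL j) :
    garblerMasked A j d ρ (l.1.1 + 1) = ρ.2.2.2.2.2 l := by
  have h1 : ¬ (l.1.1 : ℕ) + 1 = A.bd j := fun h => by
    have := l.2.1
    omega
  rw [garblerMasked, if_neg h1, dif_pos ⟨l.1.1.2, l.2⟩, dif_pos l.1.2]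

theorem garblerMasked_succ_of_not_isNL (j : Fin A.P) (d : ℕ → Vec (q k) A.n)
    (ρ : GarblerSeen GS A j) (l : A.CL j) (hl : ¬A.IsNL l.1) :
    garblerMasked A j d ρ (l.1 + 1) = (ρ.2.1 l).1.mulVec (garblerMasked A j d ρ l.1) +
      ∑ v, ρ.2.2.2.2.1 l v - (ρ.2.1 l).2 := by
  have h1 : ¬ (l.1 : ℕ) + 1 = A.bd j := fun h => by
    have := l.2.1
    omega
  rw [garblerMasked, if_neg h1, dif_pos ⟨l.1.2, l.2⟩, dif_neg hl]

/-- The share of the first computing server absorbs the difference, so that the garbler's share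
becomes the prescribed one. This uses that there is at least one computing server. -/
theorem sum_garblerRandM (M : A.Model) (j : Fin A.P) (t : Tape HE GS k A)
    (ρ : GarblerSeen GS A j) (l : A.CL j) :
    ∑ v, garblerRandM M j t ρ l.1 v = M l.1 - (ρ.2.1 l).1 := by
  rw [garblerRandM, overwrite_apply, ← Finset.add_sum_erase _ _ (Finset.mem_univ (firstServer A)),
    Function.update_self, Finset.sum_congr rfl fun v hv =>
      Function.update_of_ne (Finset.ne_of_mem_erase hv) _ _]
  abel

theorem shareM_last (M : A.Model) (t : Tape HE GS k A) (l : Fin A.L) :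
    shareM M t l (Fin.last A.T) = M l - ∑ v, randM t l v := by
  simp [shareM, addShr]

theorem shareS_last (t : Tape HE GS k A) (l : Fin A.L) :
    shareS t l (Fin.last A.T) = s t l - ∑ v, randS t l v := by
  simp [shareS, addShr]

theorem linOut_castSucc (M : A.Model) (t : Tape HE GS k A) (l : Fin A.L) (d : Vec (q k) A.n)
    (v : Fin A.T) :
    linOut M t l d v.castSucc = (randM t l v).mulVec d - randS t l v := by
  simp [linOut, shareM, shareS, addShr]

/-- In a non-linear layer `s_l` is free and is set to fit. In a linear layer `s_l` is already forced
by consecutive masked inputs, but these were chosen in `garblerMasked` by the garbler's own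
reconstruction, so the share comes out right. -/
theorem shareS_garblerTape (M : A.Model) (x : Vec (q k) A.n) (j : Fin A.P) (t : Tape HE GS k A)
    (ρ : GarblerSeen GS A j) (β : TapeB A) (l : A.CL j) :
    shareS (garblerTape M x j t ρ β) l.1 (Fin.last A.T) = (ρ.2.1 l).2 := by
  rw [shareS_last]
  have h1 : s (garblerTape M x j t ρ β) l.1 = if A.IsNL l.1 then garblerS M x j t ρ l.1 else
    (M l.1).mulVec (garblerMasked A j (masked M x t) ρ l.1) -
      garblerMasked A j (masked M x t) ρ (l.1 + 1) := rfl
  have h2 : randS (garblerTape M x j t ρ β) = garblerRandS M x j t ρ := rfl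
  rw [h1, h2]
  split
  · rw [garblerS, overwrite_apply]
    abel
  · rename_i hl
    rw [garblerMasked_succ_of_not_isNL j _ ρ l hl]
    simp only [garblerRandS, overwrite_apply, Finset.sum_sub_distrib, ← Matrix.sum_mulVec]
    have h3 : ∀ d, (∑ v, garblerRandM M j t ρ l.1 v).mulVec d =
        (M l.1).mulVec d - (ρ.2.1 l).1.mulVec d := fun d => by
      rw [sum_garblerRandM, Matrix.sub_mulVec]
    rw [h3]
    abel

variable [NeZero (q k)]

/-- One unknown answers for each value seen: the first server's share for the garbler's share of
`M_l`, the shares of `s_l` for the servers' results, `s_l` for the garbler's share of it, the masks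
for the masked inputs, and `b` for the bits of the oblivious transfers. -/
theorem garblerSeen_set (hHE : HE.Correct) (hGS : GS.Correct) (M : A.Model)
    (x : Vec (q k) A.n) (j : Fin A.P) (t : Tape HE GS k A) (ρ : GarblerSeen GS A j) :
    garblerSeen M x j (setGarblerSeen M x j t ρ) = ρ := by
  have hm : ∀ l ≤ A.L, masked M x (setGarblerSeen M x j t ρ) l =
      garblerMasked A j (masked M x t) ρ l :=
    fun l hl => masked_setMasked hHE hGS _ _ _ _ _ hl
  refine Prod.ext (funext fun l => Prod.ext ?_ ?_) (Prod.ext (funext fun l => Prod.ext ?_ ?_)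
    (Prod.ext (funext fun l => funext fun i => ?_) (Prod.ext ?_
      (Prod.ext (funext fun l => funext fun v => ?_) (funext fun l => ?_)))))
  · exact overwrite_apply (garbleCoin t) (fun l : A.CNL j => (ρ.1 l).1) l
  · exact overwrite_apply (u t) (fun l : A.CNL j => (ρ.1 l).2) l
  · change shareM M (setGarblerSeen M x j t ρ) l.1 (Fin.last A.T) = _
    rw [shareM_last]
    have h : randM (setGarblerSeen M x j t ρ) = garblerRandM M j t ρ := rfl
    rw [h, sum_garblerRandM]
    abel
  · exact shareS_garblerTape M x j t ρ _ l
  -- The client's bits do not depend on `b`, so they can be computed before `b` is chosen.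
  · have e : clientBits M (setGarblerSeen M x j t ρ) l.1 =
        clientBits M (garblerTape M x j t ρ (b t)) l.1 :=
          clientBits_congr hHE M (t := setGarblerSeen M x j t ρ)
            (t' := garblerTape M x j t ρ (b t)) rfl rfl rfl l.1
    change Bool.xor (clientBits M (setGarblerSeen M x j t ρ) l.1 i) (overwrite (b t)
      (fun l : A.CNL j => fun i => Bool.xor (clientBits M (garblerTape M x j t ρ (b t)) l.1 i)
        (ρ.2.2.1 l i)) l.1 i) = _
    rw [e, overwrite_apply, ← Bool.xor_assoc, Bool.xor_self, Bool.false_xor]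
  · have hb : A.bd j ≤ A.L := A.bd_last ▸ A.bd_mono j.2.le
    exact (hm _ hb).trans (garblerMasked_bd j _ ρ)
  · change linOut M (setGarblerSeen M x j t ρ) l.1 (masked M x (setGarblerSeen M x j t ρ) l.1)
      v.castSucc = _
    rw [linOut_castSucc, hm _ l.1.2.le]
    have h : randM (setGarblerSeen M x j t ρ) = garblerRandM M j t ρ := rfl
    have h' : randS (setGarblerSeen M x j t ρ) = garblerRandS M x j t ρ := rfl
    rw [h, h', garblerRandS, overwrite_apply]
    abel
  · exact (hm _ l.1.1.2).trans (garblerMasked_succ_of_isNL j _ ρ l)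

/-- The garbler can recompute the masked inputs of its cluster from its view: they are received at
the start and after non-linear layers, and sums of results in between. -/
theorem garblerMasked_set (hHE : HE.Correct) (hGS : GS.Correct) (M : A.Model)
    (x : Vec (q k) A.n) (j : Fin A.P) (t : Tape HE GS k A) (ρ : GarblerSeen GS A j) (l : ℕ)
    (hl : l ≤ A.L) :
    garblerMasked A j (masked M x (setGarblerSeen M x j t ρ)) (garblerSeen M x j t) l =
      masked M x t l := by
  have hm : ∀ l ≤ A.L, masked M x (setGarblerSeen M x j t ρ) l =
      garblerMasked A j (masked M x t) ρ l :=
    fun l hl => masked_setMasked hHE hGS _ _ _ _ _ hl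
  induction l with
  | zero =>
    rw [garblerMasked]
    split
    · rename_i h
      simp [garblerSeen, h]
    · rename_i h
      rw [hm _ hl, garblerMasked, if_neg h]
  | succ l ih =>
    rw [garblerMasked]
    split
    · rename_i h
      simp [garblerSeen, h]
    · rename_i h0
      split
      · rename_i h
        split
        · rfl
        · rename_i hn
          rw [ih (Nat.le_of_succ_le hl)]
          -- In a linear layer the next masked input is the sum of the results of all servers, the
          -- garbler's own included; this is the recursion of `garblerMasked`.
          have h1 := masked_succ_of_not_isNL M x t ⟨l, h.1⟩ hn
          rw [← lin_eq, lin, addRe, Fin.sum_univ_castSucc] at h1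
          simp only at h1
          rw [h1]
          simp only [garblerSeen]
          conv_rhs => rw [linOut]
          abel
      · rename_i h
        rw [hm _ hl, garblerMasked, if_neg h0, dif_neg h]

theorem setGarblerSeen_set (hHE : HE.Correct) (hGS : GS.Correct) (M : A.Model)
    (x : Vec (q k) A.n) (j : Fin A.P) (t : Tape HE GS k A) (ρ : GarblerSeen GS A j) :
    setGarblerSeen M x j (setGarblerSeen M x j t ρ) (garblerSeen M x j t) = t := by
  set t' := setGarblerSeen M x j t ρ with ht'
  have eM : randM t' = garblerRandM M j t ρ := rfl
  have eS : randS t' = garblerRandS M x j t ρ := rfl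
  have es : ∀ l, A.IsNL l → s t' l = garblerS M x j t ρ l := fun l hl => if_pos hl
  have eg : garbleCoin t' = overwrite (garbleCoin t) fun l : A.CNL j => (ρ.1 l).1 := rfl
  have eu : u t' = overwrite (u t) fun l : A.CNL j => (ρ.1 l).2 := rfl
  have eb : b t' = overwrite (b t) fun l : A.CNL j => fun i =>
    Bool.xor (clientBits M (garblerTape M x j t ρ (b t)) l.1 i) (ρ.2.2.1 l i) := rfl
  have hM : garblerRandM M j t' (garblerSeen M x j t) = randM t := by
    funext l
    by_cases h : A.InCluster j l
    · refine (overwrite_apply _ _ ⟨l, h⟩).trans (funext fun v => ?_)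
      -- Only the first server's share was altered, so the other shares are still the original ones
      -- and determine it.
      have h1 : ∀ v, v ≠ firstServer A → randM t' l v = randM t l v := by
        intro v hv
        change garblerRandM M j t ρ l v = _
        rw [garblerRandM, overwrite_apply _ _ (⟨l, h⟩ : A.CL j), Function.update_of_ne hv]
      by_cases hv : v = firstServer A
      · subst hv
        rw [Function.update_self, Finset.sum_congr rfl fun v hv =>
          h1 v (Finset.ne_of_mem_erase hv)]
        simp only [garblerSeen]
        rw [shareM_last, ← Finset.add_sum_erase _ _ (Finset.mem_univ (firstServer A))]
        abel
      · rw [Function.update_of_ne hv, h1 v hv]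
    · rw [garblerRandM, overwrite_of_not _ _ h, eM, garblerRandM, overwrite_of_not _ _ h]
  have hδ := garblerMasked_set hHE hGS M x j t ρ
  have hS : garblerRandS M x j t' (garblerSeen M x j t) = randS t := by
    funext l
    by_cases h : A.InCluster j l
    · refine (overwrite_apply _ _ ⟨l, h⟩).trans (funext fun v => ?_)
      rw [hM, hδ _ l.2.le]
      simp only [garblerSeen]
      rw [linOut_castSucc]
      abel
    · rw [garblerRandS, overwrite_of_not _ _ h, eS, garblerRandS, overwrite_of_not _ _ h]
  have hs : ∀ l, A.IsNL l → garblerS M x j t' (garblerSeen M x j t) l = s t l := by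
    intro l hl
    by_cases h : A.InCluster j l
    · refine (overwrite_apply _ _ ⟨l, h⟩).trans ?_
      rw [hS]
      simp only [garblerSeen]
      rw [shareS_last]
      abel
    · rw [garblerS, overwrite_of_not _ _ h, es l hl, garblerS, overwrite_of_not _ _ h]
  have hg : overwrite (garbleCoin t') (fun l : A.CNL j => ((garblerSeen M x j t).1 l).1) =
      garbleCoin t := by
    rw [eg]
    exact overwrite_overwrite_self (garbleCoin t) _
  have hu : overwrite (u t') (fun l : A.CNL j => ((garblerSeen M x j t).1 l).2) = u t := by
    rw [eu]
    exact overwrite_overwrite_self (u t) _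
  -- For any bits `β` the original tape is restored up to `b`. The bits are left open because their
  -- value is fixed only afterwards, from the client's bits on this tape.
  have key : ∀ β, garblerTape M x j t' (garblerSeen M x j t) β =
      (t.1, t.2.1, t.2.2.1, β, t.2.2.2.2) := by
    intro β
    have h2 : masked M x (t.1, t.2.1, t.2.2.1, β, t.2.2.2.2) = masked M x t := by
      funext l
      rw [masked_eq hHE hGS, masked_eq hHE hGS,
        mask_congr M (t := (t.1, t.2.1, t.2.2.1, β, t.2.2.2.2)) (t' := t) (fun _ _ => rfl) rfl rfl]
    rw [← setMasked_masked hHE hGS M x (t.1, t.2.1, t.2.2.1, β, t.2.2.2.2), h2, garblerTape,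
      setMasked_congr M x _ hδ]
    refine setMasked_congr_tape M x _ hs ?_ rfl rfl rfl ?_
    · simp only [hM, hS]
      rfl
    · simp only [hg, hu]
      rfl
  rw [setGarblerSeen, key, key]
  have hb : overwrite (b t') (fun l : A.CNL j => fun i =>
      Bool.xor (clientBits M (t.1, t.2.1, t.2.2.1, b t', t.2.2.2.2) l.1 i)
        ((garblerSeen M x j t).2.2.1 l i)) = b t := by
    funext l
    by_cases h : A.InCluster j l.1
    · refine (overwrite_apply _ _ (⟨l, h⟩ : A.CNL j)).trans (funext fun i => ?_)
      have e1 : clientBits M (t.1, t.2.1, t.2.2.1, b t', t.2.2.2.2) l i = clientBits M t l i :=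
        congrFun (clientBits_congr hHE M (t := (t.1, t.2.1, t.2.2.1, b t', t.2.2.2.2)) (t' := t)
          rfl rfl rfl l) i
      have e2 : (garblerSeen M x j t).2.2.1 ⟨l, h⟩ i =
        Bool.xor (clientBits M t l i) (b t l i) := rfl
      rw [e1, e2]
      rw [← Bool.xor_assoc, Bool.xor_self, Bool.false_xor]
    · have h' : ¬(fun l : A.NL => A.InCluster j l.1) l := h
      rw [overwrite_of_not (b t') _ h', eb, overwrite_of_not (b t) _ h']
  rw [hb]
  rfl

end PrivateMDI

/-! ### Sampling and simulating the view of a garbler -/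

theorem Data.ulen_ulist_le (l : Data) : l.ulist.ulen ≤ l.size := by
  have h : l.ulist.size ≤ 2 * l.size := by
    induction l with
    | num n =>
      simp only [ulist, mapD, size, Nat.size_zero]
      omega
    | pair a l _ ih =>
      have := a.size_pos
      simp only [ulist, mapD, size, Nat.size_zero] at ih ⊢
      omega
  rw [ulen]
  omega

theorem ulist_toData_pi {ι : Type*} [Fintype ι] [LinearOrder ι] {α : ι → Type*}
    [∀ i, ToData (α i)] (f : ∀ i, α i) :
    (ToData.toData f).ulist = .unary (Fintype.card ι) := by
  rw [toData_pi, Data.ulist_ofList, List.length_map, length_enum]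

theorem ulist_toData_list {α : Type*} [ToData α] (l : List α) :
    (ToData.toData l).ulist = .unary l.length := by
  change (Data.ofList (l.map ToData.toData)).ulist = _
  rw [Data.ulist_ofList, List.length_map]

/-- The coins for garbling a circuit in which one third of the input bits, or as many as there are
output bits, belong to the garbler. -/
noncomputable def garbleCoinS (p : Polynomial ℕ) (k C : Data) : PMF Data :=
  randD (2 ^ p.eval (k.ulen + (3 * C.snd.ulist.ulen + C.fst.ulist.ulen + C.snd.ulist.ulen)))

theorem PPT.garbleCoin (p : Polynomial ℕ) {k C : Data → Data} (hk : PT k) (hC : PT C) :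
    PPT fun d => garbleCoinS p (k d) (C d) := by
  obtain ⟨r, hr⟩ := hk.size_le
  obtain ⟨s, hs⟩ := hC.size_le
  have h1 := PTNat.ulen hC.snd.ulist
  have h2 := PTNat.ulen hC.fst.ulist
  refine PPT.randD (PTNat.two_pow (PTNat.polyEval p ((PTNat.ulen hk).add
    ((((PTNat.const 3).mul h1).add h2).add h1))) (p.comp (r + 5 * s)) fun d => ?_)
  rw [Polynomial.eval_comp]
  refine p.eval_nat_mono ?_
  have e1 := (k d).ulen_le.trans (hr d)
  have e2 := (C d).snd.ulen_ulist_le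
  have e3 := (C d).fst.ulen_ulist_le
  have e4 := (C d).size_snd_le
  have e5 := (C d).size_fst_le
  have e6 := hs d
  simp only [Polynomial.eval_add, Polynomial.eval_mul, Polynomial.eval_ofNat]
  omega

theorem garbleCoinS_toData (GS : GarblingScheme) (k : ℕ) {n : ℕ}
    (C : Circuit (n + (n + n)) n) :
    garbleCoinS GS.coins (.unary k) (ToData.toData C) = sampU (GS.Coin k C) := by
  have h1 : (ToData.toData C).snd = ToData.toData C.outputs := rfl
  have h2 : (ToData.toData C).fst = ToData.toData C.gates := rfl
  rw [garbleCoinS, h1, h2, ulist_toData_pi, ulist_toData_list, sampU_bitVec, Circuit.size]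
  simp only [Data.ulen_unary, Fintype.card_fin]
  congr 4
  ring

/-- The pairs of strings shared by garbler and evaluator in `m` oblivious transfers, where `m` is
given in unary. -/
noncomputable def padS (p : Polynomial ℕ) (k m : Data) : PMF Data :=
  repS (repS (bitsS p k) (.unary 2)) m

theorem padS_unary (p : Polynomial ℕ) (k m : ℕ) :
    padS p (.unary k) (.unary m) = sampU (Fin m → Bool → BitVec (p.eval k)) := by
  rw [padS, bitsS_unary, sampU_fin_pi, sampU_pi_eq_repS Bool, Fintype.card_bool]

theorem PT.const_unary (n : ℕ) : PT fun _ => Data.unary n := by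
  induction n with
  | zero => exact PT.num 0
  | succ n ih => exact (PT.num 0).pair ih

theorem PPT.pad (p : Polynomial ℕ) {k m : Data → Data} (hk : PT k) (hm : PT m) :
    PPT fun d => padS p (k d) (m d) := ((PPT.bits p hk).rep (PT.const_unary 2)).rep hm

namespace PrivateMDI

variable {q : ℕ → ℕ} {HE : LHE q} {GS : GarblingScheme}

/-- The simulator of the view of a garbler. -/
noncomputable def garblerSim (GS : GarblingScheme) (d : Data) : PMF Data :=
  prodP
    (Data.mapP (fun C => (prodP (garbleCoinS GS.coins d.fst C)
      (padS GS.labelLen d.fst (C.snd.ulist.append C.snd.ulist))).map (.pair C))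
      d.snd.snd.snd.snd.snd) <|
  prodP
    (repS (prodP (matS d.snd.fst d.snd.snd.fst) (vecS d.snd.fst d.snd.snd.fst))
      d.snd.snd.snd.snd.fst) <|
  prodP
    (Data.mapP (fun C => repS (sampU Bool) (C.snd.ulist.append C.snd.ulist))
      d.snd.snd.snd.snd.snd) <|
  prodP (vecS d.snd.fst d.snd.snd.fst) <|
  prodP
    (repS (repS (vecS d.snd.fst d.snd.snd.fst) d.snd.snd.snd.fst) d.snd.snd.snd.snd.fst)
    (repS (vecS d.snd.fst d.snd.snd.fst) d.snd.snd.snd.snd.snd)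

theorem ppt_garblerSim (GS : GarblingScheme) : PPT (garblerSim GS) := by
  have hv : PPT fun d => vecS d.snd.fst d.snd.snd.fst := PPT.vec PT.id.snd.fst PT.id.snd.snd.fst
  have hm : PPT fun d => matS d.snd.fst d.snd.snd.fst := PPT.mat PT.id.snd.fst PT.id.snd.snd.fst
  have hc : PT fun d => d.snd.snd.snd.snd.fst := PT.id.snd.snd.snd.snd.fst
  have hC : PT fun d => d.snd.snd.snd.snd.snd := PT.id.snd.snd.snd.snd.snd
  have hl : PT fun d => d.snd.snd.ulist.append d.snd.snd.ulist :=
    PT.append PT.id.snd.snd.ulist PT.id.snd.snd.ulist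
  refine PPT.prodP ?_ (PPT.prodP ((hm.prodP hv).rep hc) (PPT.prodP ?_ (hv.prodP
    (PPT.prodP ((hv.rep PT.id.snd.snd.snd.fst).rep hc) (hv.rep hC)))))
  · refine (PPT.mapP (F := fun d => (prodP (garbleCoinS GS.coins d.fst d.snd)
      (padS GS.labelLen d.fst (d.snd.snd.ulist.append d.snd.snd.ulist))).map (.pair d.snd))
      ?_ PT.id.fst hC).congr fun d => rfl
    exact PPT.bind' (G := fun d e => PMF.pure (.pair d.snd e))
      ((PPT.garbleCoin _ PT.id.fst PT.id.snd).prodP (PPT.pad _ PT.id.fst hl))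
      (PT.id.fst.snd.pair PT.id.snd)
  · exact (PPT.mapP (F := fun d => repS (sampU Bool) (d.snd.snd.ulist.append d.snd.snd.ulist))
      (PPT.bool.rep hl) PT.id hC).congr fun d => rfl

theorem mapP_toData_pi {ι : Type*} [Fintype ι] [LinearOrder ι] {α : ι → Type*}
    [∀ i, ToData (α i)] (f : ∀ i, α i) (F : Data → PMF Data) :
    Data.mapP F (ToData.toData f) = seqL ((enum ι).map fun i => F (ToData.toData (f i))) := by
  rw [toData_pi, Data.mapP_ofList, List.map_map]
  rfl

theorem repS_toData_pi {ι : Type*} [Fintype ι] [LinearOrder ι] {α : ι → Type*}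
    [∀ i, ToData (α i)] (f : ∀ i, α i) (p : PMF Data) :
    repS p (ToData.toData f) = repS p (.unary (Fintype.card ι)) := by
  rw [toData_pi, repS_ofList, List.length_map, length_enum]

variable [∀ k, NeZero (q k)]

set_option synthInstance.maxSize 1000 in
-- The simulation is exact. The only part of the view that is not uniform is the list of circuits,
-- which is public and copied.
theorem secureGarbler (hHE : HE.Correct) (hGS : GS.Correct) :
    (protocol HE GS).SecureGarbler := by
  obtain ⟨c, hc, hout⟩ := ppt_garblerSim GS
  refine ⟨c, hc, fun A M x j _ => CompIndist.of_eq fun k => ?_⟩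
  have h1 : (sample HE GS k (A k)).map (garblerSeen (M k) (x k) (j k)) =
      unif (GarblerSeen GS (A k) (j k)) :=
    unif_map_get _ (setGarblerSeen (M k) (x k) (j k))
      (garblerSeen_set hHE hGS _ _ _) (setGarblerSeen_set hHE hGS _ _ _)
  have h2 : (protocol HE GS).viewGarbler k (A k) (M k) (x k) (j k) =
      (unif (GarblerSeen GS (A k) (j k))).map fun ρ => Data.pair
        (ToData.toData fun l : (A k).CNL (j k) => (((A k).nonlin l.1).circuit, ρ.1 l))
        (ToData.toData ρ.2) := by
    rw [← h1, PMF.map_comp]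
    rfl
  rw [h2, hout, garblerSim]
  refine (unif_prod_map_pair (fun f : (l : (A k).CNL (j k)) →
    GS.Coin k ((A k).nonlin l.1).circuit ×
      (Fin ((A k).bits + (A k).bits) → Bool → GS.Label k) =>
    ToData.toData fun l : (A k).CNL (j k) => (((A k).nonlin l.1).circuit, f l))
    ToData.toData).trans ?_
  -- The number of transfers is twice the number of output bits, so it is read off the list of
  -- outputs; the public data do not contain it directly.
  have hbits : ∀ C : Circuit ((A k).bits + ((A k).bits + (A k).bits)) (A k).bits,
      ((ToData.toData C).snd.ulist.append (ToData.toData C).snd.ulist) =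
        .unary ((A k).bits + (A k).bits) := by
    intro C
    have h : (ToData.toData C).snd = ToData.toData C.outputs := rfl
    rw [h, ulist_toData_pi, Data.append_unary, Fintype.card_fin]
  have e0 : infoGarbler k (A k) (j k) = .pair (.unary k) (.pair (.num (q k)) (.pair
    (.unary (A k).n) (.pair (.unary (A k).T) (.pair (.unary (Fintype.card ((A k).CL (j k))))
      (ToData.toData fun l : (A k).CNL (j k) => ((A k).nonlin l.1).circuit))))) := rfl
  simp only [e0, Data.fst_pair, Data.snd_pair]
  congr 1
  · rw [mapP_toData_pi]
    refine (unif_pi_map_ofList (e := fun l : (A k).CNL (j k) => l) (fun _ _ h => h)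
      (fun l a => Data.pair (ToData.toData ((A k).nonlin l.1).circuit) (ToData.toData a))
      (enum _) (nodup_enum _)).trans ?_
    congr 1
    refine List.map_congr_left fun l _ => ?_
    rw [hbits, padS_unary, garbleCoinS_toData, ← sampU_prod, sampU, PMF.map_comp]
    rfl
  · change sampU _ = _
    rw [sampU_prod, sampU_prod, sampU_prod, sampU_prod]
    congr 1
    · rw [sampU_pi_eq_repS ((A k).CL (j k)), sampU_prod, matS_unary, vecS_unary]
    congr 1
    · rw [sampU_pi_eq_repS ((A k).CNL (j k)), mapP_toData_pi]
      simp only [hbits]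
      rw [enum_map_const, ← mapP_unary, sampU_fin_pi]
      rfl
    rw [vecS_unary]
    congr 1
    congr 1
    · rw [sampU_pi_eq_repS ((A k).CL (j k)), sampU_fin_pi]
    · rw [sampU_pi_eq_repS ((A k).CNL (j k)), repS_toData_pi]

end PrivateMDI

/-! ### Operations on lists -/

namespace Data

/-- Pair the members of the first list with those of the second one. -/
def zip : Data → Data → Data
  | num _, _ => num 0
  | pair a l, m => pair (pair a m.fst) (zip l m.snd)

/-- Drop as many members of the second list as the first one has. -/
def drop : Data → Data → Data
  | num _, m => m
  | pair _ l, m => drop l m.snd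

/-- Keep as many members of the second list as the first one has. -/
def take (l m : Data) : Data := mapD snd (zip l m)

/-- Concatenation of a list of lists. -/
def flatten : Data → Data
  | num _ => num 0
  | pair a l => append a (flatten l)

/-- The binary digits of a number; their number is the length of the list `c`. -/
def bits : Data → ℕ → Data
  | num _, _ => num 0
  | pair _ c, a => pair (num (a % 2)) (bits c (a / 2))

theorem append_zip (l : Data) : ∀ m, append (zip l m) (num 0) = zip l m := by
  induction l with
  | num n => intro m; rfl
  | pair a l _ ih => intro m; simp [zip, append, ih]

theorem append_bits (l : Data) : ∀ m, append (bits l m) (num 0) = bits l m := by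
  induction l with
  | num n => intro m; rfl
  | pair a l _ ih => intro m; simp [bits, append, ih]

/-- The accumulator holds the unread rest of the second list and the reversed output, so zipping and
dropping come from one loop. -/
theorem foldD_zip (c l : Data) : ∀ m out,
    foldD (fun d => pair d.snd.snd.fst.snd (pair (pair d.snd.fst d.snd.snd.fst.fst) d.snd.snd.snd))
      c l (pair m out) = pair (drop l m) (revOnto (zip l m) out) := by
  induction l with
  | num n => intro m out; rfl
  | pair a l _ ih => intro m out; simp only [foldD, snd_pair, fst_pair, ih, drop, zip, revOnto]

theorem foldD_bits (c l : Data) : ∀ (a : ℕ) (out : Data),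
    (foldD (fun d => pair (num (d.snd.snd.fst.val / 2))
      (pair (num (d.snd.snd.fst.val % 2)) d.snd.snd.snd)) c l (pair (num a) out)).snd =
        revOnto (bits l a) out := by
  induction l with
  | num n => intro a out; rfl
  | pair b l _ ih =>
    intro a out
    simp only [foldD, snd_pair, fst_pair, val_num, ih, bits, revOnto]

theorem revOnto_append (l : Data) : ∀ m out, revOnto (append l m) out = revOnto m (revOnto l out) := by
  induction l with
  | num n => intro m out; rfl
  | pair a l _ ih => intro m out; simp only [append, revOnto, ih]

theorem foldD_flatten (c l : Data) : ∀ out,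
    foldD (fun d => revOnto d.snd.fst d.snd.snd) c l out = revOnto (flatten l) out := by
  induction l with
  | num n => intro out; rfl
  | pair b l _ ih =>
    intro out
    simp only [foldD, snd_pair, fst_pair, ih, flatten, revOnto_append]

theorem append_assoc (l : Data) : ∀ m out, append (append l m) out = append l (append m out) := by
  induction l with
  | num n => intro m out; rfl
  | pair a l _ ih => intro m out; simp only [append, ih]

theorem append_flatten (l : Data) : append (flatten l) (num 0) = flatten l := by
  induction l with
  | num n => rfl
  | pair b l _ ih => rw [flatten, append_assoc, ih]

theorem size_revOnto_le (l : Data) : ∀ m, (revOnto l m).size ≤ l.size + m.size := by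
  induction l with
  | num n => intro m; simp [revOnto]
  | pair a l _ ih =>
    intro m
    have := ih (pair a m)
    simp only [revOnto, size] at this ⊢
    omega

theorem size_fst_add_size_snd_le (d : Data) : d.fst.size + d.snd.size ≤ d.size + 1 := by
  cases d <;> simp [size]; omega

end Data

namespace PT

theorem foldZip {l m : Data → Data} (hl : PT l) (hm : PT m) :
    PT fun d => Data.pair (Data.drop (l d) (m d)) (Data.revOnto (Data.zip (l d) (m d)) (.num 0)) := by
  refine (PT.foldD (c := fun _ => .num 0) (f := fun d => .pair d.snd.snd.fst.snd
    (.pair (.pair d.snd.fst d.snd.snd.fst.fst) d.snd.snd.snd)) ?_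
    ⟨Polynomial.X + 5, fun c a acc => ?_⟩ (PT.num 0) hl (hm.pair (PT.num 0))).congr
    fun d => Data.foldD_zip _ _ _ _
  · exact PT.id.snd.snd.fst.snd.pair ((PT.id.snd.fst.pair PT.id.snd.snd.fst.fst).pair
      PT.id.snd.snd.snd)
  · have h1 := acc.size_fst_add_size_snd_le
    have h2 := acc.fst.size_fst_add_size_snd_le
    simp only [Data.snd_pair, Data.fst_pair, Data.size, Polynomial.eval_add, Polynomial.eval_X,
      Polynomial.eval_ofNat]
    omega

theorem drop {l m : Data → Data} (hl : PT l) (hm : PT m) :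
    PT fun d => Data.drop (l d) (m d) := (foldZip hl hm).fst

theorem zip {l m : Data → Data} (hl : PT l) (hm : PT m) :
    PT fun d => Data.zip (l d) (m d) :=
  (PT.revOnto (foldZip hl hm).snd (PT.num 0)).congr fun d => by
    simp only [Data.snd_pair, Data.revOnto_revOnto, Data.append_zip, Data.revOnto]

theorem take {l m : Data → Data} (hl : PT l) (hm : PT m) :
    PT fun d => Data.take (l d) (m d) :=
  (PT.mapD (f := fun d => d.snd.snd) PT.id.snd.snd PT.id (zip hl hm)).congr fun _ => rfl

theorem flatten {l : Data → Data} (hl : PT l) : PT fun d => Data.flatten (l d) := by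
  have h : PT fun d => Data.revOnto (Data.flatten (l d)) (.num 0) := by
    refine (PT.foldD (c := fun _ => .num 0) (f := fun d => .revOnto d.snd.fst d.snd.snd)
      (PT.revOnto PT.id.snd.fst PT.id.snd.snd)
      ⟨Polynomial.X, fun c a acc => ?_⟩ (PT.num 0) hl (PT.num 0)).congr
      fun d => Data.foldD_flatten _ _ _
    have := a.size_revOnto_le acc
    simp only [Data.snd_pair, Data.fst_pair, Polynomial.eval_X]
    omega
  exact (PT.revOnto h (PT.num 0)).congr fun d => by
    simp only [Data.revOnto_revOnto, Data.append_flatten, Data.revOnto]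

theorem bits {l : Data → Data} (hl : PT l) {a : Data → ℕ} (ha : PTNat a) :
    PT fun d => Data.bits (l d) (a d) := by
  have h : PT fun d => Data.revOnto (Data.bits (l d) (a d)) (.num 0) := by
    refine PT.congr (PT.snd (PT.foldD (c := fun _ => .num 0) (f := fun d =>
      .pair (.num (d.snd.snd.fst.val / 2))
        (.pair (.num (d.snd.snd.fst.val % 2)) d.snd.snd.snd)) ?_
      ⟨6, fun c a acc => ?_⟩ (PT.num 0) hl (PT.pair ha (PT.num 0))))
      fun d => Data.foldD_bits _ _ _ _
    · exact ((PTNat.val PT.id.snd.snd.fst).div (PTNat.const 2)).pair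
        (((PTNat.val PT.id.snd.snd.fst).mod (PTNat.const 2)).pair PT.id.snd.snd.snd)
    · have h1 := acc.size_fst_add_size_snd_le
      have h2 : (acc.fst.val / 2).size ≤ acc.fst.size := by
        cases acc.fst with
        | num n =>
          have := Nat.size_le_size (Nat.div_le_self n 2)
          simp only [Data.val_num, Data.size]
          omega
        | pair a b => simp
      have h3 : (acc.fst.val % 2).size ≤ 1 := Nat.size_le.2 (Nat.mod_lt _ two_pos)
      simp only [Data.snd_pair, Data.size, Polynomial.eval_ofNat]
      omega
  exact (PT.revOnto h (PT.num 0)).congr fun d => by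
    simp only [Data.revOnto_revOnto, Data.append_bits, Data.revOnto]

end PT

/-! ### List operations on encodings, and binary representations -/

namespace Data

theorem zip_ofList_map {ι : Type*} (f g : ι → Data) (l : List ι) :
    zip (ofList (l.map f)) (ofList (l.map g)) = ofList (l.map fun i => pair (f i) (g i)) := by
  induction l with
  | nil => rfl
  | cons a l ih => simp [ofList, zip, ih]

theorem take_append (l m : List Data) : take (unary l.length) (ofList (l ++ m)) = ofList l := by
  induction l with
  | nil => rfl
  | cons a l ih =>
    simp only [take, List.length_cons, unary, List.cons_append, ofList, zip, fst_pair, snd_pair,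
      mapD] at ih ⊢
    rw [ih]

theorem drop_append (l m : List Data) : drop (unary l.length) (ofList (l ++ m)) = ofList m := by
  induction l with
  | nil => rfl
  | cons a l ih => simpa [unary, ofList, drop] using ih

theorem flatten_ofList (l : List (List Data)) :
    flatten (ofList (l.map ofList)) = ofList l.flatten := by
  induction l with
  | nil => rfl
  | cons a l ih => simp [ofList, flatten, ih, append_ofList]

theorem bits_unary (c : ℕ) : ∀ a : ℕ,
    bits (unary c) a = ofList (List.ofFn fun t : Fin c => num (a.testBit t).toNat) := by
  induction c with
  | zero => intro a; simp [unary, bits, ofList]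
  | succ c ih =>
    intro a
    simp only [unary, bits, ih, List.ofFn_succ, ofList, Fin.val_zero, Fin.val_succ,
      Nat.testBit_succ]
    congr 2
    rw [Nat.testBit_zero]
    rcases Nat.mod_two_eq_zero_or_one a with h | h <;> simp [h]

end Data

theorem toData_fin {n : ℕ} {α : Fin n → Type*} [∀ i, ToData (α i)] (f : ∀ i, α i) :
    ToData.toData f = Data.ofList (List.ofFn fun i => ToData.toData (f i)) := by
  rw [toData_pi, List.ofFn_eq_map]
  exact congrArg (fun l => Data.ofList (List.map _ l)) (Fin.sort_univ n)

/-- Programs have no logarithm but can measure atoms, and `q - 1` is the largest residue. -/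
theorem bitLen_eq_size (q : ℕ) [NeZero q] : bitLen q = Nat.size (q - 1) := by
  have hq := NeZero.pos q
  refine le_antisymm ?_ ?_
  · refine (Nat.clog_le_iff_le_pow one_lt_two).2 ?_
    have := Nat.lt_size_self (q - 1)
    omega
  · refine Nat.size_le.2 ?_
    have := Nat.le_pow_clog one_lt_two q
    rw [bitLen]
    omega

/-- The binary representation of a vector. -/
def vecBits (q v : Data) : Data :=
  (Data.mapD (fun a => Data.bits (.unary (Nat.size (q.val - 1))) a.val) v).flatten

theorem vecBits_toData {q n : ℕ} [NeZero q] (v : Vec q n) :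
    vecBits (.num q) (ToData.toData v) = ToData.toData (toBits v) := by
  rw [vecBits, Data.val_num, ← bitLen_eq_size, toData_fin, Data.mapD_ofList, List.map_ofFn]
  have h : ((fun a : Data => Data.bits (.unary (bitLen q)) a.val) ∘
      fun i => ToData.toData (v i)) =
      fun i => Data.ofList (List.ofFn fun t : Fin (bitLen q) =>
        Data.num ((v i).val.testBit t).toNat) :=
    funext fun i => Data.bits_unary _ _
  rw [h, toData_fin, List.ofFn_mul, ← Data.flatten_ofList, List.map_ofFn]
  congr 3
  funext i
  simp only [Function.comp_apply]
  congr 2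
  funext t
  simp only [toBits]
  -- The flattened list runs through the bits entry by entry, which is the order of
  -- `finProdFinEquiv`.
  have e : finProdFinEquiv.symm ⟨(i : ℕ) * bitLen q + t, by
      calc (i : ℕ) * bitLen q + t < i * bitLen q + bitLen q := Nat.add_lt_add_left t.2 _
        _ = (i + 1) * bitLen q := by ring
        _ ≤ _ := Nat.mul_le_mul_right _ i.2⟩ = (i, t) := by
    rw [Equiv.symm_apply_eq]
    ext
    simp [finProdFinEquiv]
    ring
  rw [e]
  rfl

theorem PT.vecBits {q v : Data → Data} (hq : PT q) (hv : PT v) :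
    PT fun d => _root_.vecBits (q d) (v d) := by
  obtain ⟨p, hp⟩ := hq.size_le
  have hu : PT fun d => Data.unary (Nat.size ((q d).val - 1)) := by
    refine PT.unary (PTNat.natSize ((PTNat.val hq).sub (PTNat.const 1))) p fun d =>
      le_trans ?_ (hp d)
    cases q d with
    | num n =>
      have := Nat.size_le_size (Nat.sub_le n 1)
      simp only [Data.val_num, Data.size]
      omega
    | pair a b => simp
  exact (PT.flatten (PT.mapD (f := fun d => Data.bits d.fst d.snd.val)
    (PT.bits PT.id.fst (PTNat.val PT.id.snd)) hu hv)).congr fun _ => rfl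

/-- The exclusive or of a label with the string that is selected by a bit. -/
def xorSelect (d : Data) : Data :=
  .num (d.fst.val ^^^ if d.snd.fst.truth then d.snd.snd.snd.fst.val else d.snd.snd.fst.val)

theorem PT.xorSelect : PT _root_.xorSelect := by
  have h : PTNat fun d => if d.snd.fst.truth then d.snd.snd.snd.fst.val else d.snd.snd.fst.val := by
    refine (PT.ite (c := fun d => d.snd.fst) PT.id.snd.fst (PTNat.val PT.id.snd.snd.snd.fst)
      (PTNat.val PT.id.snd.snd.fst)).congr fun d => ?_
    dsimp only
    split <;> rfl
  exact (PTNat.val PT.id.fst).xor h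

theorem toData_bool_pi {α : Type*} [ToData α] (f : Bool → α) :
    ToData.toData f = .pair (ToData.toData (f false)) (.pair (ToData.toData (f true)) (.num 0)) := by
  have h : enum Bool = [false, true] := by
    have hu : (Finset.univ : Finset Bool) = [false, true].toFinset := by decide
    rw [enum, hu]
    exact (List.toFinset_sort (fun a b : Bool => a ≤ b) (by decide)).2 (by decide)
  rw [toData_pi, h]
  rfl

theorem xorSelect_toData {κ : ℕ} (K : BitVec κ) (b : Bool) (u : Bool → BitVec κ) :
    xorSelect (.pair (ToData.toData K) (.pair (ToData.toData b) (ToData.toData u))) =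
      ToData.toData (K ^^^ u b) := by
  rw [toData_bool_pi]
  cases b
  · simp [xorSelect, ToData.toData, Data.truth]
  · simp [xorSelect, ToData.toData, Data.truth]

/-! ### Lengths of encodings -/

theorem size_toData_bitVec {m : ℕ} (v : BitVec m) : (ToData.toData v).size ≤ m + 1 :=
  Nat.succ_le_succ (Nat.size_le.2 v.isLt)

theorem size_toData_bool (b : Bool) : (ToData.toData b).size ≤ 2 := by
  cases b <;> simp [ToData.toData, Data.size]

theorem size_toData_zmod {q : ℕ} [NeZero q] (a : ZMod q) :
    (ToData.toData a).size ≤ q.size + 1 :=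
  Nat.succ_le_succ (Nat.size_le_size (ZMod.val_lt a).le)

theorem size_toData_pi {ι : Type*} [Fintype ι] [LinearOrder ι] {α : ι → Type*}
    [∀ i, ToData (α i)] (f : ∀ i, α i) {B : ℕ} (h : ∀ i, (ToData.toData (f i)).size ≤ B) :
    (ToData.toData f).size ≤ Fintype.card ι * (B + 1) + 1 := by
  rw [toData_pi, ← length_enum ι, ← List.length_map (as := enum ι)]
  exact Data.size_ofList_le fun d hd => by
    obtain ⟨i, _, rfl⟩ := List.mem_map.1 hd
    exact h i

theorem size_toData_fin_pi {n : ℕ} {α : Fin n → Type*} [∀ i, ToData (α i)] (f : ∀ i, α i) {B : ℕ}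
    (h : ∀ i, (ToData.toData (f i)).size ≤ B) :
    (ToData.toData f).size ≤ n * (B + 1) + 1 := by
  simpa using size_toData_pi f h

theorem length_le_size_toData_pi {ι : Type*} [Fintype ι] [LinearOrder ι] {α : ι → Type*}
    [∀ i, ToData (α i)] (f : ∀ i, α i) : Fintype.card ι ≤ (ToData.toData f).size := by
  rw [toData_pi, ← length_enum ι, ← List.length_map (as := enum ι)]
  exact Data.length_le_size_ofList _

namespace Circuit

variable {m r : ℕ} (C : Circuit m r)

theorem length_gates_add_le : m + C.gates.length + r ≤ C.descLen := by
  have h1 : C.gates.length ≤ (ToData.toData C.gates).size := by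
    rw [← List.length_map (as := C.gates) (f := ToData.toData)]
    exact Data.length_le_size_ofList _
  have h2 := length_le_size_toData_pi C.outputs
  rw [Fintype.card_fin] at h2
  rw [descLen]
  omega

theorem size_sizeData_le : C.sizeData.size ≤ 2 * C.descLen + 5 := by
  have := C.length_gates_add_le
  have h : C.sizeData.size = (2 * m + 1) + ((2 * C.gates.length + 1) + (2 * r + 1) + 1) + 1 := by
    rw [← Data.size_unary, ← Data.size_unary, ← Data.size_unary]
    rfl
  omega

end Circuit

namespace GarblingScheme

/-- Garbled circuits are outputs of a polynomial-time program, hence short. The hybrid argument over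
the layers needs this bound uniformly in the coins and in the input. -/
theorem Efficient.size_garble_le {GS : GarblingScheme} (h : GS.Efficient) :
    ∃ p : Polynomial ℕ, ∀ (k m r : ℕ) (C : Circuit m r) (ρ : GS.Coin k C) (inp : Fin m → Bool),
      (ToData.toData ((GS.garble k C ρ).1, fun i => (GS.garble k C ρ).2 i (inp i))).size ≤
        p.eval (k + C.descLen) := by
  obtain ⟨⟨c, hc, hout⟩, _⟩ := h
  obtain ⟨p, hp⟩ := hc.ppt.size_le
  -- The first summand covers the input of the garbling program, coins included; the second one the
  -- selected labels.
  refine ⟨p.comp (7 * Polynomial.X + 10 + GS.coins) +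
    (Polynomial.X * (GS.labelLen + 2) + 2), fun k m r C ρ inp => ?_⟩
  have h1 := hp _ (ToData.toData (GS.garble k C ρ)) (by rw [hout, PMF.mem_support_pure_iff])
  have h2 := C.length_gates_add_le
  have h3 := size_toData_bitVec ρ
  have h4 : (ToData.toData (Data.unary k, Data.unary m, Data.unary r, C, ρ)).size =
      (2 * k + 1) + ((2 * m + 1) + ((2 * r + 1) +
        (((ToData.toData C.gates).size + (ToData.toData C.outputs).size + 1) +
          (ToData.toData ρ).size + 1) + 1) + 1) + 1 := by
    rw [← Data.size_unary, ← Data.size_unary, ← Data.size_unary]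
    rfl
  have h5 : GS.coins.eval (k + C.size) ≤ GS.coins.eval (k + C.descLen) :=
    GS.coins.eval_nat_mono (Nat.add_le_add_left h2 k)
  have h6 := size_toData_fin_pi (fun i => (GS.garble k C ρ).2 i (inp i))
    fun i => size_toData_bitVec _
  have h7 : (ToData.toData (GS.garble k C ρ)).size =
    (GS.garble k C ρ).1.size + (ToData.toData (GS.garble k C ρ).2).size + 1 := rfl
  have h8 : (ToData.toData ((GS.garble k C ρ).1, fun i => (GS.garble k C ρ).2 i (inp i))).size =
    (GS.garble k C ρ).1.size +
      (ToData.toData fun i => (GS.garble k C ρ).2 i (inp i)).size + 1 := rfl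
  have h9 : m * (GS.labelLen.eval k + 1 + 1) ≤
      (k + C.descLen) * (GS.labelLen.eval (k + C.descLen) + 2) :=
    Nat.mul_le_mul (by omega) (Nat.add_le_add_right
      (GS.labelLen.eval_nat_mono (Nat.le_add_right _ _)) 2)
  have h10 : C.descLen = m + (ToData.toData C.gates).size + (ToData.toData C.outputs).size := rfl
  have h11 := p.eval_nat_mono (show (ToData.toData (Data.unary k, Data.unary m, Data.unary r, C,
    ρ)).size ≤ 7 * (k + C.descLen) + 10 + GS.coins.eval (k + C.descLen) by omega)
  simp only [Polynomial.eval_add, Polynomial.eval_mul, Polynomial.eval_comp, Polynomial.eval_X,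
    Polynomial.eval_ofNat] at h11 ⊢
  omega

end GarblingScheme

theorem bitLen_le_size (q : ℕ) [NeZero q] : bitLen q ≤ q.size := by
  rw [bitLen_eq_size]
  exact Nat.size_le_size (Nat.sub_le _ _)

namespace Arch

variable {q : ℕ} (A : Arch q)

theorem n_le_size : A.n ≤ A.size := by rw [size]; omega

theorem T_le_size : A.T ≤ A.size := by rw [size]; omega

theorem L_le_size : A.L ≤ A.size := by rw [size]; omega

theorem natSize_le_size : q.size ≤ A.size := by rw [size]; omega

theorem bits_le_size [NeZero q] : A.bits ≤ A.size * A.size :=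
  Nat.mul_le_mul A.n_le_size ((bitLen_le_size q).trans A.natSize_le_size)

theorem descLen_le_size (l : A.NL) : (A.nonlin l).circuit.descLen ≤ A.size := by
  have := Finset.single_le_sum (f := fun l : A.NL => (A.nonlin l).circuit.descLen)
    (fun _ _ => Nat.zero_le _) (Finset.mem_univ l)
  rw [size]
  omega

theorem card_NL_le : Fintype.card A.NL ≤ A.L :=
  (Fintype.card_subtype_le _).trans (Fintype.card_fin _).le

theorem card_CNL_le (j : Fin A.P) : Fintype.card (A.CNL j) ≤ A.L :=
  (Fintype.card_subtype_le _).trans A.card_NL_le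

end Arch

/-! ### Evaluators -/

/-- The view of an evaluator in one layer, from the number of the input bits of the garbler in unary,
the strings of the oblivious transfers, and the garbled circuit with the labels of its input. -/
def evaluatorPost (d : Data) : Data :=
  .pair d.snd.fst (.pair d.snd.snd.fst (.pair
    (Data.mapD xorSelect (.zip (.drop d.fst d.snd.snd.snd) (.zip d.snd.fst.fst d.snd.fst.snd)))
    (.take d.fst d.snd.snd.snd)))

theorem pt_evaluatorPost : PT evaluatorPost := by
  have hz : PT fun d => Data.zip (.drop d.fst d.snd.snd.snd) (.zip d.snd.fst.fst d.snd.fst.snd) :=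
    PT.zip (PT.drop PT.id.fst PT.id.snd.snd.snd) (PT.zip PT.id.snd.fst.fst PT.id.snd.fst.snd)
  have hx : PT fun d => Data.mapD xorSelect
      (.zip (.drop d.fst d.snd.snd.snd) (.zip d.snd.fst.fst d.snd.fst.snd)) :=
    (PT.mapD (f := fun d => xorSelect d.snd) (PT.xorSelect.comp PT.id.snd) PT.id hz).congr
      fun _ => rfl
  exact PT.id.snd.fst.pair (PT.id.snd.snd.fst.pair
    (hx.pair (PT.take PT.id.fst PT.id.snd.snd.snd)))

theorem evaluatorPost_toData {m n κ : ℕ} (K₁ : Fin m → BitVec κ) (K₂ : Fin n → BitVec κ)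
    (b : Fin n → Bool) (u : Fin n → Bool → BitVec κ) (gc : Data) :
    evaluatorPost (.pair (.unary m) (.pair (ToData.toData (b, u))
      (ToData.toData (gc, Fin.append K₁ K₂)))) =
      ToData.toData ((b, u), gc, (fun i => K₂ i ^^^ u i (b i)), K₁) := by
  have hl : ToData.toData (Fin.append K₁ K₂) = Data.ofList
      ((List.ofFn fun i => ToData.toData (K₁ i)) ++ List.ofFn fun i => ToData.toData (K₂ i)) := by
    rw [toData_fin, ← List.ofFn_fin_append]
    congr 2
    funext i
    refine Fin.addCases (fun i => ?_) (fun i => ?_) i <;> simp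
  have h1 : ToData.toData (gc, Fin.append K₁ K₂) = .pair gc (ToData.toData (Fin.append K₁ K₂)) := rfl
  have h2 : ToData.toData (b, u) = .pair (ToData.toData b) (ToData.toData u) := rfl
  have ht : Data.take (.unary m) (ToData.toData (Fin.append K₁ K₂)) = ToData.toData K₁ := by
    have := Data.take_append (List.ofFn fun i => ToData.toData (K₁ i))
      (List.ofFn fun i => ToData.toData (K₂ i))
    rwa [List.length_ofFn, ← hl, ← toData_fin] at this
  have hd : Data.drop (.unary m) (ToData.toData (Fin.append K₁ K₂)) = ToData.toData K₂ := by
    have := Data.drop_append (List.ofFn fun i => ToData.toData (K₁ i))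
      (List.ofFn fun i => ToData.toData (K₂ i))
    rwa [List.length_ofFn, ← hl, ← toData_fin] at this
  simp only [evaluatorPost, h1, Data.fst_pair, Data.snd_pair, ht, hd]
  rw [h2]
  simp only [Data.fst_pair, Data.snd_pair]
  rw [toData_pi b, toData_pi u, toData_pi K₂, Data.zip_ofList_map, Data.zip_ofList_map,
    Data.mapD_ofList, List.map_map]
  simp only [Function.comp_def, xorSelect_toData]
  rfl

namespace PrivateMDI

variable {q : ℕ → ℕ} {HE : LHE q} {GS : GarblingScheme} {k : ℕ} {A : Arch (q k)}

/-- The input of the circuit of a non-linear layer. -/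
def circuitInput (M : A.Model) (x : Vec (q k) A.n) (t : Tape HE GS k A) (l : A.NL) :
    Fin (A.bits + (A.bits + A.bits)) → Bool :=
  Fin.append (toBits (lin M t l.1 (masked M x t l.1))) (clientBits M t l)

theorem eval_circuitInput [NeZero (q k)] (hGS : GS.Correct) (M : A.Model) (x : Vec (q k) A.n)
    (t : Tape HE GS k A) (l : A.NL) :
    (A.nonlin l).circuit.eval (circuitInput M x t l) = toBits (masked M x t (l.1 + 1)) := by
  rw [circuitInput, clientBits, (A.nonlin l).spec, masked, dif_pos l.1.2, dif_pos l.2,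
    evalOut_eq hGS]

/-- By correctness the masked inputs do not depend on the garbling coins, although they are computed
by evaluating garbled circuits. Hence the garblings of different layers are independent once `s` and
the client's masks are fixed. -/
theorem circuitInput_congr [NeZero (q k)] (hHE : HE.Correct) (hGS : GS.Correct) (M : A.Model)
    (x : Vec (q k) A.n) {t t' : Tape HE GS k A} (hs : s t = s t') (h1 : rFirst t = rFirst t')
    (h2 : r t = r t') (l : A.NL) : circuitInput M x t l = circuitInput M x t' l := by
  rw [circuitInput, circuitInput, lin_eq, lin_eq, masked_eq hHE hGS, masked_eq hHE hGS,
    mask_congr M (fun l _ => congrFun hs l) h1 h2, hs, clientBits_congr hHE M hs h1 h2]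

/-- The strings of the oblivious transfers of a layer that an evaluator knows. -/
def evaluatorPads (t : Tape HE GS k A) (l : A.NL) : Data := ToData.toData (b t l, u t l)

/-- The last message of a transfer is a label masked by a string that the evaluator knows. So in
each layer the view is computed from these strings and exactly what a garbling simulator produces.
-/
theorem evaluatorView_eq (M : A.Model) (x : Vec (q k) A.n) (j : Fin A.P) (t : Tape HE GS k A) :
    evaluatorView M x j t = Data.ofList ((enum (A.CNL j)).map fun l =>
      evaluatorPost (.pair (.unary A.bits) (.pair (evaluatorPads t l.1)
        (ToData.toData ((GS.garble k (A.nonlin l.1).circuit (garbleCoin t l.1)).1,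
          fun i => (GS.garble k (A.nonlin l.1).circuit (garbleCoin t l.1)).2 i
            (circuitInput M x t l.1 i)))))) := by
  refine congrArg Data.ofList (List.map_congr_left fun l _ => ?_)
  rw [circuitInput, ← append_labels (GS.garble k (A.nonlin l.1).circuit (garbleCoin t l.1)).2,
    evaluatorPads, evaluatorPost_toData]
  have h : ot₃ M t l.1 = fun i => clientLabels t l.1 i (clientBits M t l.1 i) ^^^
    u t l.1 i (b t l.1 i) := funext fun i => ot₃_eq M t l.1 i
  change ToData.toData ((b t l.1, u t l.1), gc t l.1, ot₃ M t l.1, _) = _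
  rw [h]
  rfl

/-- The run with other coins of the garblers. -/
def setGarbleCoin (t : Tape HE GS k A) (ρ : GarblerTape GS k A) : Tape HE GS k A :=
  (t.1, t.2.1, ρ, t.2.2.2)

theorem size_evaluatorPads_le (t : Tape HE GS k A) (l : A.NL) :
    (evaluatorPads t l).size ≤ 2 * A.bits * (2 * GS.labelLen.eval k + 10) + 3 := by
  have h1 := size_toData_fin_pi (b t l) fun i => size_toData_bool _
  have h2 := size_toData_fin_pi (u t l) fun i => size_toData_pi (u t l i)
    fun i => size_toData_bitVec _
  have h3 : (evaluatorPads t l).size =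
    (ToData.toData (b t l)).size + (ToData.toData (u t l)).size + 1 := rfl
  rw [h3]
  simp only [Fintype.card_bool] at h2
  nlinarith [Nat.zero_le (A.bits * GS.labelLen.eval k)]

end PrivateMDI

/-- Families of independent samples are indistinguishable if their members are. -/
theorem CompIndist.seqL_map {ι : ℕ → Type*} (l : ∀ k, List (ι k)) {X Y : ∀ k, ι k → PMF Data}
    (hN : PolyBounded fun k => (l k).length) {B : ℕ → ℕ} (hB : PolyBounded B)
    (hXB : ∀ k i, ∀ d ∈ (X k i).support, d.size ≤ B k)
    (hYB : ∀ k i, ∀ d ∈ (Y k i).support, d.size ≤ B k)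
    (h : ∀ i : ∀ k, Option (ι k), CompIndist
      (fun k => (i k).elim (PMF.pure (.num 0)) (X k))
      (fun k => (i k).elim (PMF.pure (.num 0)) (Y k))) :
    CompIndist (fun k => _root_.seqL ((l k).map (X k))) (fun k => _root_.seqL ((l k).map (Y k))) := by
  have hget : ∀ (k j : ℕ) (F : ι k → PMF Data), ((l k)[j]?).elim (PMF.pure (.num 0)) F =
      ((l k).map F).getD j (PMF.pure (.num 0)) := by
    intro k j F
    rw [List.getD_eq_getElem?_getD, List.getElem?_map]
    cases (l k)[j]? <;> rfl
  refine CompIndist.seqL (by simp) (by simpa using hN) hB ?_ ?_ fun i =>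
    (h fun k => (l k)[i k]?).congr (fun k => hget _ _ _) fun k => hget _ _ _
  · intro k p hp
    obtain ⟨i, _, rfl⟩ := List.mem_map.1 hp
    exact hXB k i
  · intro k p hp
    obtain ⟨i, _, rfl⟩ := List.mem_map.1 hp
    exact hYB k i

theorem PolyBounded.unary_size {f : ℕ → ℕ} (hf : PolyBounded f) :
    PolyBounded fun k => (Data.unary (f k)).size :=
  ((hf.mul (.const 2)).add (.const 1)).mono fun k => by rw [Data.size_unary]; omega

/-! ### Simulation of the evaluator -/

namespace PrivateMDI

variable {q : ℕ → ℕ} {HE : LHE q} {GS : GarblingScheme}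

section

variable {k : ℕ} {A : Arch (q k)}

/-- The random values that determine the simulated view of an evaluator. -/
abbrev EvaluatorSeen (GS : GarblingScheme) (A : Arch (q k)) (j : Fin A.P) : Type :=
  A.CNL j → ((Fin (A.bits + A.bits) → Bool) × (Fin (A.bits + A.bits) → Bool → GS.Label k)) ×
    Vec (q k) A.n

/-- All that remains once the garblings are simulated: the strings of the transfers and the outputs
of the circuits. -/
def evaluatorSeen (M : A.Model) (x : Vec (q k) A.n) (j : Fin A.P) (t : Tape HE GS k A) :
    EvaluatorSeen GS A j :=
  fun l => ((b t l.1, u t l.1), masked M x t (l.1.1 + 1))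

/-- The run with prescribed values of `evaluatorSeen`. -/
def setEvaluatorSeen (M : A.Model) (x : Vec (q k) A.n) (j : Fin A.P) (t : Tape HE GS k A)
    (ρ : EvaluatorSeen GS A j) : Tape HE GS k A :=
  (t.1,
    (keyCoin t, t.2.1.2.1, fun l =>
      (overwrite (P := fun l : A.NL => A.InCluster j l.1) (r t)
        (fun c => A.act M x (c.1.1 + 1) - (ρ c).2) l, encRCoin t l)),
    t.2.2.1,
    overwrite (P := fun l : A.NL => A.InCluster j l.1) (b t) (fun c => (ρ c).1.1),
    overwrite (P := fun l : A.NL => A.InCluster j l.1) (u t) (fun c => (ρ c).1.2))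

theorem evaluatorSeen_set [NeZero (q k)] (hHE : HE.Correct) (hGS : GS.Correct) (M : A.Model)
    (x : Vec (q k) A.n) (j : Fin A.P) (t : Tape HE GS k A) (ρ : EvaluatorSeen GS A j) :
    evaluatorSeen M x j (setEvaluatorSeen M x j t ρ) = ρ := by
  funext l
  refine Prod.ext (Prod.ext ?_ ?_) ?_
  · exact overwrite_apply (P := fun l : A.NL => A.InCluster j l.1) (b t) (fun c => (ρ c).1.1) l
  · exact overwrite_apply (P := fun l : A.NL => A.InCluster j l.1) (u t) (fun c => (ρ c).1.2) l
  · have : r (setEvaluatorSeen M x j t ρ) l.1 = A.act M x (l.1.1 + 1) - (ρ l).2 :=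
      overwrite_apply (P := fun l : A.NL => A.InCluster j l.1) (r t)
        (fun c => A.act M x (c.1.1 + 1) - (ρ c).2) l
    simp only [evaluatorSeen]
    rw [masked_succ_of_isNL hHE hGS, this, sub_sub_cancel]

theorem setEvaluatorSeen_set [NeZero (q k)] (hHE : HE.Correct) (hGS : GS.Correct) (M : A.Model)
    (x : Vec (q k) A.n) (j : Fin A.P) (t : Tape HE GS k A) (ρ : EvaluatorSeen GS A j) :
    setEvaluatorSeen M x j (setEvaluatorSeen M x j t ρ) (evaluatorSeen M x j t) = t := by
  have h : (fun c : A.CNL j => A.act M x (c.1.1 + 1) - (evaluatorSeen M x j t c).2) =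
      fun c : A.CNL j => r t c.1 := funext fun c => by
    simp only [evaluatorSeen]
    rw [masked_succ_of_isNL hHE hGS, sub_sub_cancel]
  have h1 : ∀ t' : Tape HE GS k A, setEvaluatorSeen M x j t' (evaluatorSeen M x j t) =
    (t'.1,
    (keyCoin t', t'.2.1.2.1, fun l =>
      (overwrite (P := fun l : A.NL => A.InCluster j l.1) (r t')
        (fun c : A.CNL j => r t c.1) l, encRCoin t' l)),
    t'.2.2.1,
    overwrite (P := fun l : A.NL => A.InCluster j l.1) (b t') (fun c : A.CNL j => b t c.1),
    overwrite (P := fun l : A.NL => A.InCluster j l.1) (u t') (fun c : A.CNL j => u t c.1)) := by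
    intro t'
    rw [setEvaluatorSeen, h]
    rfl
  rw [h1]
  have hr : overwrite (P := fun l : A.NL => A.InCluster j l.1) (r (setEvaluatorSeen M x j t ρ))
      (fun c : A.CNL j => r t c.1) = r t := 
    overwrite_overwrite_self (r t) (fun c => A.act M x (c.1.1 + 1) - (ρ c).2)
  have hb : overwrite (P := fun l : A.NL => A.InCluster j l.1) (b (setEvaluatorSeen M x j t ρ))
      (fun c : A.CNL j => b t c.1) = b t := 
    overwrite_overwrite_self (b t) (fun c => (ρ c).1.1)
  have hu : overwrite (P := fun l : A.NL => A.InCluster j l.1) (u (setEvaluatorSeen M x j t ρ))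
      (fun c : A.CNL j => u t c.1) = u t := 
    overwrite_overwrite_self (u t) (fun c => (ρ c).1.2)
  rw [hr, hb, hu]
  rfl

variable [NeZero (q k)]

/-- The view of an evaluator in a layer, for fixed randomness except for the coins of the garbler. -/
noncomputable def evaluatorReal (M : A.Model) (x : Vec (q k) A.n) (j : Fin A.P)
    (t : Tape HE GS k A) (l : A.CNL j) : PMF Data :=
  (unif (GS.Coin k (A.nonlin l.1).circuit)).map fun ρ =>
    evaluatorPost (.pair (.unary A.bits) (.pair (evaluatorPads t l.1)
      (ToData.toData ((GS.garble k (A.nonlin l.1).circuit ρ).1, fun i =>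
        (GS.garble k (A.nonlin l.1).circuit ρ).2 i (circuitInput M x t l.1 i)))))

/-- The simulated view of an evaluator in a layer in which its result is `v`. -/
noncomputable def evaluatorIdeal (S : Code) (j : Fin A.P) (l : A.CNL j) (pads : Data)
    (v : Vec (q k) A.n) : PMF Data :=
  (S.out (ToData.toData (Data.unary k, (A.nonlin l.1).circuit.sizeData, toBits v))).map fun d =>
    evaluatorPost (.pair (.unary A.bits) (.pair pads d))

set_option synthInstance.maxSize 1000 in
-- Redraw the garbling coins with everything else fixed: the circuit inputs stay, and the view
-- becomes a list of independent samples, one for each layer.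
theorem map_evaluatorView (hHE : HE.Correct) (hGS : GS.Correct) (M : A.Model)
    (x : Vec (q k) A.n) (j : Fin A.P) :
    (unif (Tape HE GS k A)).map (evaluatorView M x j) =
      (unif (Tape HE GS k A)).bind fun t =>
        seqL ((enum (A.CNL j)).map fun l => evaluatorReal M x j t l) := by
  conv_lhs => rw [unif_resample (T := Tape HE GS k A) (R := GarblerTape GS k A) (fun t => t.2.2.1)
    setGarbleCoin (fun _ _ => rfl) (fun _ _ => rfl), PMF.map_bind]
  refine congrArg _ (funext fun t => ?_)
  rw [PMF.map_comp]
  refine Eq.trans ?_ (unif_pi_map_ofList (α := fun l : A.NL => GS.Coin k (A.nonlin l).circuit)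
    (e := fun l : A.CNL j => l.1) Subtype.val_injective
    (fun l (ρ : GS.Coin k (A.nonlin l.1).circuit) => evaluatorPost (.pair (.unary A.bits)
      (.pair (evaluatorPads t l.1) (ToData.toData ((GS.garble k (A.nonlin l.1).circuit ρ).1, fun i =>
        (GS.garble k (A.nonlin l.1).circuit ρ).2 i (circuitInput M x t l.1 i))))))
    (enum _) (nodup_enum _))
  refine congrArg (fun f => PMF.map f _) (funext fun ρ => ?_)
  rw [Function.comp_apply, evaluatorView_eq]
  simp only [circuitInput_congr hHE hGS M x (t := setGarbleCoin t ρ) (t' := t) rfl rfl rfl]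
  rfl

set_option synthInstance.maxSize 1000 in
-- Each circuit output is masked by its own `r`, so the outputs and the strings of the transfers are
-- jointly uniform. The dependence on `M` and `x` disappears.
theorem bind_evaluatorIdeal (hHE : HE.Correct) (hGS : GS.Correct) (S : Code) (M : A.Model)
    (x : Vec (q k) A.n) (j : Fin A.P) :
    ((unif (Tape HE GS k A)).bind fun t => seqL ((enum (A.CNL j)).map fun l =>
      evaluatorIdeal S j l (evaluatorPads t l.1) (masked M x t (l.1.1 + 1)))) =
    seqL ((enum (A.CNL j)).map fun l => (unif (((Fin (A.bits + A.bits) → Bool) ×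
      (Fin (A.bits + A.bits) → Bool → GS.Label k)) × Vec (q k) A.n)).bind fun ρ =>
        evaluatorIdeal S j l (ToData.toData ρ.1) ρ.2) := by
  refine Eq.trans ?_ (unif_pi_bind_seqL (e := fun l : A.CNL j => l) (fun _ _ h => h)
    (fun l (ρ : ((Fin (A.bits + A.bits) → Bool) × (Fin (A.bits + A.bits) → Bool → GS.Label k)) ×
      Vec (q k) A.n) => evaluatorIdeal S j l (ToData.toData ρ.1) ρ.2) (enum _) (nodup_enum _))
  rw [← unif_map_get _ (setEvaluatorSeen (HE := HE) M x j) (evaluatorSeen_set hHE hGS _ _ _)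
      (setEvaluatorSeen_set hHE hGS _ _ _), PMF.bind_map]
  rfl

end

/-- The simulator of the view of an evaluator in one layer. -/
noncomputable def evaluatorLayerSim (GS : GarblingScheme) (S : Code) (d : Data) : PMF Data :=
  (prodP (prodP (repS (sampU Bool) (d.snd.snd.snd.append d.snd.snd.snd))
    (padS GS.labelLen d.fst.fst (d.snd.snd.snd.append d.snd.snd.snd)))
      (vecS d.fst.snd.fst d.fst.snd.snd.fst)).bind fun e =>
    (S.out (.pair d.fst.fst (.pair d.snd (vecBits d.fst.snd.fst e.snd)))).map fun g =>
      evaluatorPost (.pair d.snd.snd.snd (.pair e.fst g))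

theorem ppt_evaluatorLayerSim (GS : GarblingScheme) {S : Code} (hS : S.PolyTime) :
    PPT (evaluatorLayerSim GS S) := by
  have hl : PT fun d => d.snd.snd.snd.append d.snd.snd.snd :=
    PT.append PT.id.snd.snd.snd PT.id.snd.snd.snd
  refine PPT.bind' (((PPT.bool.rep hl).prodP (PPT.pad _ PT.id.fst.fst hl)).prodP
    (PPT.vec PT.id.fst.snd.fst PT.id.fst.snd.snd.fst)) (PPT.bind' (hS.ppt.comp
      (PT.id.fst.fst.fst.pair (PT.id.fst.snd.pair (PT.vecBits PT.id.fst.fst.snd.fst PT.id.snd.snd))))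
      (pt_evaluatorPost.comp (PT.id.fst.fst.snd.snd.snd.pair (PT.id.fst.snd.fst.pair PT.id.snd))))

variable [∀ k, NeZero (q k)]

set_option synthInstance.maxSize 1000 in
theorem evaluatorLayerSim_eq {k : ℕ} {A : Arch (q k)} (S : Code) (j : Fin A.P) (l : A.CNL j)
    (R : Data) :
    evaluatorLayerSim GS S (.pair (.pair (.unary k) (.pair (.num (q k)) (.pair (.unary A.n) R)))
      (A.nonlin l.1).circuit.sizeData) =
    (unif (((Fin (A.bits + A.bits) → Bool) ×
      (Fin (A.bits + A.bits) → Bool → GS.Label k)) × Vec (q k) A.n)).bind fun ρ =>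
        evaluatorIdeal S j l (ToData.toData ρ.1) ρ.2 := by
  have h : (A.nonlin l.1).circuit.sizeData.snd.snd = .unary A.bits := rfl
  simp only [evaluatorLayerSim, Data.fst_pair, Data.snd_pair, h, Data.append_unary, padS_unary,
    vecS_unary]
  rw [← sampU_fin_pi, ← sampU_prod, ← sampU_prod, sampU, PMF.bind_map]
  refine congrArg _ (funext fun ρ => ?_)
  have h1 : ToData.toData ρ = .pair (ToData.toData ρ.1) (ToData.toData ρ.2) := rfl
  simp only [Function.comp_apply, h1, Data.fst_pair, Data.snd_pair, vecBits_toData]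
  rfl

set_option synthInstance.maxSize 1000 in
theorem secureEvaluator (hHE : HE.Correct) (hGS : GS.Secure) :
    (protocol HE GS).SecureEvaluator := by
  obtain ⟨S, hS, hpriv⟩ := hGS.priv
  obtain ⟨c, hc, hout⟩ : PPT fun d => Data.mapP (fun sz => evaluatorLayerSim GS S (.pair d sz))
    d.snd.snd.snd := (ppt_evaluatorLayerSim GS hS).mapP PT.id PT.id.snd.snd.snd
  refine ⟨c, hc, fun A M x j hA => ?_⟩
  have hbits : PolyBounded fun k => (A k).bits := (hA.mul hA).mono fun k => (A k).bits_le_size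
  have hlab : PolyBounded fun k => GS.labelLen.eval k := PolyBounded.self.eval _
  have hpads : ∀ t : ∀ k, Tape HE GS k (A k), PolyBounded fun k =>
      2 * (A k).bits * (2 * GS.labelLen.eval k + 10) + 3 := fun t =>
    (((PolyBounded.const 2).mul hbits).mul (((PolyBounded.const 2).mul hlab).add (.const 10))).add
      (.const 3)
  refine CompIndist.congr (X := fun k => (unif (Tape HE GS k (A k))).bind fun t =>
      seqL ((enum ((A k).CNL (j k))).map fun l => evaluatorReal (M k) (x k) (j k) t l))
    (Y := fun k => (unif (Tape HE GS k (A k))).bind fun t => seqL ((enum ((A k).CNL (j k))).map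
      fun l => evaluatorIdeal S (j k) l (evaluatorPads t l.1) (masked (M k) (x k) t (l.1.1 + 1))))
    (CompIndist.bind _ fun t _ => ?_)
    (fun k => (map_evaluatorView hHE hGS.correct _ _ _).symm) fun k => ?_
  · obtain ⟨p₁, hp₁⟩ := hGS.efficient.size_garble_le
    obtain ⟨p₂, hp₂⟩ := pt_evaluatorPost.size_le
    obtain ⟨p₃, hp₃⟩ := hS.ppt.size_le
    have hdata : ∀ (k : ℕ) (l : (A k).NL) (v : Vec (q k) (A k).n),
        (ToData.toData (Data.unary k, (A k).nonlin l |>.circuit.sizeData, toBits v)).size ≤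
          2 * k + 2 * (A k).size + 3 * (A k).bits + 9 := by
      intro k l v
      have h1 := ((A k).nonlin l).circuit.size_sizeData_le
      have h2 := (A k).descLen_le_size l
      have h3 := size_toData_fin_pi (toBits v) fun i => size_toData_bool _
      have h4 : (ToData.toData (Data.unary k, (A k).nonlin l |>.circuit.sizeData, toBits v)).size =
        (2 * k + 1) + (((A k).nonlin l).circuit.sizeData.size +
          (ToData.toData (toBits v)).size + 1) + 1 := by
        rw [← Data.size_unary]; rfl
      change _ ≤ (A k).bits * _ + 1 at h3
      omega
    refine CompIndist.seqL_map (B := fun k => p₂.eval ((2 * (A k).bits + 1) +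
        ((2 * (A k).bits * (2 * GS.labelLen.eval k + 10) + 3) +
          (p₁.eval (k + (A k).size) +
            p₃.eval (2 * k + 2 * (A k).size + 3 * (A k).bits + 9)) + 1) + 1))
      _ ?_ ?_ ?_ ?_ fun i => ?_
    · exact hA.mono fun k => by
        rw [length_enum]
        exact ((A k).card_CNL_le _).trans (A k).L_le_size
    · have h1 : PolyBounded fun k => 2 * k + 2 * (A k).size + 3 * (A k).bits + 9 :=
        ((((PolyBounded.const 2).mul .self).add ((PolyBounded.const 2).mul hA)).add
          ((PolyBounded.const 3).mul hbits)).add (.const 9)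
      exact (((((PolyBounded.const 2).mul hbits).add (.const 1)).add (((hpads t).add
        (((PolyBounded.self.add hA).eval p₁).add (h1.eval p₃))).add (.const 1))).add
          (.const 1)).eval p₂
    · intro k l d hd
      obtain ⟨ρ, _, rfl⟩ := (PMF.mem_support_map_iff _ _ _).1 hd
      refine (hp₂ _).trans (p₂.eval_nat_mono ?_)
      have h1 := hp₁ k _ _ _ ρ (circuitInput (M k) (x k) (t k) l.1)
      have h2 := p₁.eval_nat_mono (Nat.add_le_add_left ((A k).descLen_le_size l.1) k)
      have h3 := size_evaluatorPads_le (t k) l.1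
      simp only [Data.size, Data.size_unary] at h1 h2 h3 ⊢
      omega
    · intro k l d hd
      obtain ⟨g, hg, rfl⟩ := (PMF.mem_support_map_iff _ _ _).1 hd
      refine (hp₂ _).trans (p₂.eval_nat_mono ?_)
      have h1 := hp₃ _ g hg
      have h2 := p₃.eval_nat_mono (hdata k l.1 (masked (M k) (x k) (t k) (l.1.1 + 1)))
      have h3 := size_evaluatorPads_le (t k) l.1
      simp only [Data.size, Data.size_unary] at h1 h2 h3 ⊢
      omega
    -- Privacy of garbling speaks of one circuit for each `k`. Take the layer `i k`, and an empty
    -- circuit where the index is out of range; there both sides agree trivially.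
    · let C : ∀ k, Option ((A k).CNL (j k)) →
          Circuit ((A k).bits + ((A k).bits + (A k).bits)) (A k).bits := fun k o =>
        o.elim ⟨[], fun _ => 0⟩ fun l => ((A k).nonlin l.1).circuit
      let inp : ∀ k, Option ((A k).CNL (j k)) →
          Fin ((A k).bits + ((A k).bits + (A k).bits)) → Bool := fun k o =>
        o.elim (fun _ => false) fun l => circuitInput (M k) (x k) (t k) l.1
      let post : ∀ k, Option ((A k).CNL (j k)) → Data → Data := fun k o d =>
        evaluatorPost (.pair (.unary (A k).bits)
          (.pair (o.elim (.num 0) fun l => evaluatorPads (t k) l.1) d))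
      have hC : PolyBounded fun k => (C k (i k)).descLen := by
        refine ((((PolyBounded.const 6).mul hbits).add (.const 2)).add hA).mono fun k => ?_
        rcases i k with _ | l
        · have h1 := size_toData_fin_pi (fun _ : Fin (A k).bits => 0) (B := 1) fun _ => le_rfl
          have h2 : (C k none).descLen = ((A k).bits + ((A k).bits + (A k).bits)) + 1 +
              (ToData.toData fun _ : Fin (A k).bits => 0).size := rfl
          change _ ≤ (A k).bits * _ + 1 at h1
          omega
        · have h1 := (A k).descLen_le_size l.1
          simp only [C, Option.elim]
          omega
      have := (hpriv _ _ (fun k => C k (i k)) (fun k => inp k (i k)) hC).map (f := fun d =>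
          evaluatorPost (.pair d.snd.fst.fst (.pair d.snd.fst.snd d.snd.snd)))
          (a := fun k => .pair (.unary (A k).bits) ((i k).elim (.num 0) fun l =>
            evaluatorPads (t k) l.1))
          (pt_evaluatorPost.comp (PT.id.snd.fst.fst.pair (PT.id.snd.fst.snd.pair PT.id.snd.snd)))
          (((hbits.unary_size.add (hpads t)).add (.const 1)).mono fun k => by
            have h1 : ((i k).elim (.num 0) fun l => evaluatorPads (t k) l.1).size ≤
                2 * (A k).bits * (2 * GS.labelLen.eval k + 10) + 3 := by
              rcases i k with _ | l
              · simp [Data.size]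
              · exact size_evaluatorPads_le _ _
            simp only [Data.size]
            omega)
      have key : ∀ k (o : Option ((A k).CNL (j k))),
          (o = none ∨ ((o.elim (PMF.pure (.num 0)) (evaluatorReal (M k) (x k) (j k) (t k)) =
            ((unif (GS.Coin k (C k o))).map fun ρ => ToData.toData ((GS.garble k (C k o) ρ).1,
              fun i => (GS.garble k (C k o) ρ).2 i (inp k o i))).map (post k o)) ∧
          (o.elim (PMF.pure (.num 0)) (fun l => evaluatorIdeal S (j k) l (evaluatorPads (t k) l.1)
              (masked (M k) (x k) (t k) (l.1.1 + 1))) =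
            (S.out (ToData.toData
              (Data.unary k, (C k o).sizeData, (C k o).eval (inp k o)))).map (post k o)))) := by
        rintro k (_ | l)
        · exact Or.inl rfl
        · refine Or.inr ⟨?_, ?_⟩
          · simp only [Option.elim, evaluatorReal, PMF.map_comp]
            rfl
          · simp only [Option.elim, evaluatorIdeal, C, inp]
            rw [eval_circuitInput hGS.correct]
            rfl
      refine this.of_eq_or fun k => ?_
      rcases key k (i k) with h | h
      · exact Or.inl (by rw [h]; rfl)
      · exact Or.inr h
  · rw [bind_evaluatorIdeal hHE hGS.correct, hout]
    have h : infoEvaluator k (A k) (j k) = .pair (.unary k) (.pair (.num (q k))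
      (.pair (.unary (A k).n)
        (ToData.toData fun l : (A k).CNL (j k) => ((A k).nonlin l.1).circuit.sizeData))) := rfl
    simp only [h, Data.snd_pair]
    rw [mapP_toData_pi]
    exact congrArg _ (List.map_congr_left fun l _ => (evaluatorLayerSim_eq S (j k) l _).symm)

end PrivateMDI

/-! ### Semantic security for lists under one key -/

namespace LHE

variable {q : ℕ → ℕ}

/-- Encryption with fresh coins by the program `c`, on the security parameter, the public key and the
message. -/
noncomputable def encS (HE : LHE q) (c : Code) (d : Data) : PMF Data :=
  (bitsS HE.coins d.fst).bind fun ρ => c.out (.pair d.fst (.pair d.snd.fst (.pair d.snd.snd ρ)))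

theorem ppt_encS (HE : LHE q) {c : Code} (hc : c.PolyTime) : PPT (HE.encS c) :=
  PPT.bind' (PPT.bits _ PT.id.fst) (hc.ppt.comp
    (PT.id.fst.fst.pair (PT.id.fst.snd.fst.pair (PT.id.fst.snd.snd.pair PT.id.snd))))

/-- Encryption of the members of a list. -/
noncomputable def encListS (HE : LHE q) (c : Code) (d : Data) : PMF Data :=
  Data.mapP (fun m => HE.encS c (.pair d.fst (.pair d.snd.fst m))) d.snd.snd

theorem ppt_encListS (HE : LHE q) {c : Code} (hc : c.PolyTime) : PPT (HE.encListS c) :=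
  (PPT.mapP (F := fun d => HE.encS c (.pair d.fst.fst (.pair d.fst.snd d.snd)))
    ((HE.ppt_encS hc).comp (PT.id.fst.fst.pair (PT.id.fst.snd.pair PT.id.snd)))
    (PT.id.fst.pair PT.id.snd.fst) PT.id.snd.snd).congr fun _ => rfl

/-- The distribution of the public key. -/
noncomputable def pkS (HE : LHE q) (k : ℕ) : PMF Data :=
  (unif (HE.Coin k)).map fun ω => (HE.keygen k ω).1

/-- The program `c` computes encryptions. -/
def ComputesEnc (HE : LHE q) (c : Code) : Prop :=
  ∀ (k : ℕ) (pk : Data) (m : ZMod (q k)) (ρ : HE.Coin k),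
    c.out (ToData.toData (Data.unary k, pk, m, ρ)) = PMF.pure (ToData.toData (HE.enc k pk m ρ))

variable {HE : LHE q} {c : Code}

theorem ComputesEnc.encS_eq (hc : HE.ComputesEnc c) (k : ℕ) (pk : Data) (m : ZMod (q k)) :
    HE.encS c (.pair (.unary k) (.pair pk (ToData.toData m))) =
      (unif (HE.Coin k)).map fun ρ => ToData.toData (HE.enc k pk m ρ) := by
  simp only [encS, Data.fst_pair, Data.snd_pair, bitsS_unary, sampU, PMF.bind_map]
  exact congrArg _ (funext fun ρ => hc k pk m ρ)

theorem ComputesEnc.encListS_eq (hc : HE.ComputesEnc c) (k : ℕ) (pk : Data) {n : ℕ}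
    (v : Vec (q k) n) :
    HE.encListS c (.pair (.unary k) (.pair pk (ToData.toData v))) =
      (unif (Fin n → HE.Coin k)).map fun ρ =>
        ToData.toData fun i => HE.enc k pk (v i) (ρ i) := by
  simp only [encListS, Data.fst_pair, Data.snd_pair, PrivateMDI.mapP_toData_pi, hc.encS_eq]
  exact (unif_pi_map_ofList (α := fun _ : Fin n => HE.Coin k) (e := fun i : Fin n => i)
    (fun _ _ h => h) (fun i ρ => ToData.toData (HE.enc k pk (v i) ρ)) (enum _)
    (nodup_enum _)).symm

/-- Encryptions of lists of messages under the same key are indistinguishable. -/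
theorem SemanticallySecure.encListS [∀ k, NeZero (q k)] (h : HE.SemanticallySecure)
    (hcp : c.PolyTime) (hc : HE.ComputesEnc c) {n : ℕ → ℕ} (hn : PolyBounded n)
    (hq : PolyBounded fun k => (q k).size) (v w : ∀ k, Vec (q k) (n k)) :
    CompIndist
      (fun k => (HE.pkS k).bind fun pk =>
        (HE.encListS c (.pair (.unary k) (.pair pk (ToData.toData (v k))))).map (.pair pk))
      (fun k => (HE.pkS k).bind fun pk =>
        (HE.encListS c (.pair (.unary k) (.pair pk (ToData.toData (w k))))).map (.pair pk)) := by
  let X : (∀ k, Vec (q k) (n k)) → ℕ → List Data := fun v k =>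
    (enum (Fin (n k))).map fun i => ToData.toData (v k i)
  have hX : ∀ (v : ∀ k, Vec (q k) (n k)) (k : ℕ) (pk : Data),
      HE.encListS c (.pair (.unary k) (.pair pk (ToData.toData (v k)))) =
        seqL ((X v k).map fun m => HE.encS c (.pair (.unary k) (.pair pk m))) := by
    intro v k pk
    simp only [LHE.encListS, Data.fst_pair, Data.snd_pair, PrivateMDI.mapP_toData_pi, X,
      List.map_map]
    rfl
  have hB : ∀ (v : ∀ k, Vec (q k) (n k)) (k : ℕ), ∀ d ∈ X v k, d.size ≤ (q k).size + 1 := by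
    intro v k d hd
    obtain ⟨i, _, rfl⟩ := List.mem_map.1 hd
    exact size_toData_zmod _
  simp only [hX]
  -- The public key is the common value: given it, the other ciphertexts of a hybrid can be produced
  -- afresh.
  refine CompIndist.seqL_of_common (HE.ppt_encS hcp) HE.pkS (by simp [X]) (by simpa [X] using hn)
    (hq.add (.const 1)) (hB v) (hB w) fun i => ?_
  -- The default `num 0` beyond the end is itself the encoding of the message `0`, so every index
  -- yields a message.
  have hget : ∀ (v : ∀ k, Vec (q k) (n k)) (k : ℕ), ∃ m : ZMod (q k),
      (X v k).getD (i k) (.num 0) = ToData.toData m := by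
    intro v k
    rw [List.getD_eq_getElem?_getD, List.getElem?_map]
    rcases (enum (Fin (n k)))[i k]? with _ | j
    · refine ⟨0, ?_⟩
      simp [ToData.toData]
    · exact ⟨v k j, rfl⟩
  choose m hm using hget
  refine (h (m v) (m w)).congr (fun k => ?_) fun k => ?_ <;>
  · rw [hm, unif_prod, PMF.map_bind, pkS, PMF.bind_map]
    refine congrArg _ (funext fun ω => ?_)
    rw [Function.comp_apply, hc.encS_eq, PMF.map_comp, PMF.map_comp]
    rfl

/-- Encryptions of lists of vectors under the same key are indistinguishable. -/
theorem SemanticallySecure.encListS_list [∀ k, NeZero (q k)] (h : HE.SemanticallySecure)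
    (hcp : c.PolyTime) (hc : HE.ComputesEnc c) {n : ℕ → ℕ} (hn : PolyBounded n)
    (hq : PolyBounded fun k => (q k).size) {V W : ∀ k, List (Vec (q k) (n k))}
    (hlen : ∀ k, (V k).length = (W k).length) (hN : PolyBounded fun k => (V k).length) :
    CompIndist
      (fun k => (HE.pkS k).bind fun pk => (seqL ((V k).map fun v =>
        HE.encListS c (.pair (.unary k) (.pair pk (ToData.toData v))))).map (.pair pk))
      (fun k => (HE.pkS k).bind fun pk => (seqL ((W k).map fun v =>
        HE.encListS c (.pair (.unary k) (.pair pk (ToData.toData v))))).map (.pair pk)) := by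
  have hB : ∀ (V : ∀ k, List (Vec (q k) (n k))) (k : ℕ), ∀ d ∈ (V k).map ToData.toData,
      d.size ≤ n k * ((q k).size + 1 + 1) + 1 := by
    intro V k d hd
    obtain ⟨v, _, rfl⟩ := List.mem_map.1 hd
    exact size_toData_fin_pi v fun i => size_toData_zmod _
  refine (CompIndist.seqL_of_common (HE.ppt_encListS hcp) HE.pkS
    (X := fun k => (V k).map ToData.toData) (Y := fun k => (W k).map ToData.toData)
    (by simpa using hlen) (by simpa using hN)
    ((hn.mul ((hq.add (.const 1)).add (.const 1))).add (.const 1)) (hB V) (hB W)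
    fun i => ?_).congr (fun k => by simp only [List.map_map]; rfl)
    (fun k => by simp only [List.map_map]; rfl)
  -- A second hybrid argument, now over the vectors, whose single steps are the statement for one
  -- vector.
  refine (h.encListS hcp hc hn hq (fun k => (V k).getD (i k) 0)
    fun k => (W k).getD (i k) 0).of_eq_or fun k => ?_
  by_cases hi : i k < (V k).length
  · have hi' : i k < (W k).length := hlen k ▸ hi
    right
    constructor <;>
    simp only [List.getD_eq_getElem?_getD, List.getElem?_map, List.getElem?_eq_getElem hi,
      List.getElem?_eq_getElem hi', Option.map_some, Option.getD_some]
  · have hi' : ¬ i k < (W k).length := hlen k ▸ hi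
    left
    simp only [List.getD_eq_getElem?_getD, List.getElem?_map,
      List.getElem?_eq_none (not_lt.1 hi), List.getElem?_eq_none (not_lt.1 hi'), Option.map_none]

end LHE

/-- The zero vector and `1^n` are the same datum, so the simulators can use the public dimension as
a zero vector. -/
theorem toData_zero_vec (q n : ℕ) [NeZero q] : ToData.toData (0 : Vec q n) = .unary n := by
  have h : ToData.toData (0 : ZMod q) = .num 0 := by simp [ToData.toData]
  rw [toData_pi, Data.unary_eq_ofList]
  simp only [Pi.zero_apply, h, enum_map_const, Fintype.card_fin]

/-- As many copies of `c` as there are true members of the list `l`. -/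
def Data.selectCopies (c l : Data) : Data :=
  (mapD (fun a => if a.truth then pair c (num 0) else num 0) l).flatten

theorem PT.selectCopies {c l : Data → Data} (hc : PT c) (hl : PT l) :
    PT fun d => Data.selectCopies (c d) (l d) :=
  PT.flatten ((PT.mapD (f := fun d => if d.snd.truth then .pair d.fst (.num 0) else .num 0)
    (PT.ite PT.id.snd (PT.id.fst.pair (PT.num 0)) (PT.num 0)) hc hl).congr fun _ => rfl)

theorem Data.selectCopies_toData {ι : Type*} [Fintype ι] [LinearOrder ι] (c : Data) (f : ι → Bool) :
    selectCopies c (ToData.toData f) =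
      ofList (List.replicate (Fintype.card {i // f i = true}) c) := by
  have h1 : ∀ i, (if (ToData.toData (f i)).truth then pair c (num 0) else num 0) =
      ofList (if f i then [c] else []) := by
    intro i
    cases f i <;> rfl
  have h2 : ∀ l : List ι, (l.map fun i => if f i then [c] else []).flatten =
      List.replicate (l.countP fun i => f i) c := by
    intro l
    induction l with
    | nil => rfl
    | cons a l ih =>
      rw [List.map_cons, List.flatten_cons, ih]
      cases h : f a <;> simp [h, List.replicate_succ]
  have h3 : (enum ι).countP (fun i => f i) = Fintype.card {i // f i = true} := by
    rw [Fintype.card_subtype, ← List.toFinset_card_of_nodup ((nodup_enum ι).filter _)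
      |>.trans (List.countP_eq_length_filter ..).symm]
    congr 1
    ext i
    simp
  rw [selectCopies, toData_pi, mapD_ofList, List.map_map]
  have h4 : ((fun a => if a.truth then pair c (num 0) else num 0) ∘ fun i => ToData.toData (f i)) =
      fun i => ofList (if f i then [c] else []) := funext h1
  have h5 := flatten_ofList ((enum ι).map fun i => if f i then [c] else [])
  rw [List.map_map] at h5
  rw [h4, ← h3, ← h2, ← h5]
  rfl

/-- Elements that can be sampled in polynomial time have polynomial length. -/
theorem polyBounded_of_sampU {α : ℕ → Type*} [∀ k, Fintype (α k)] [∀ k, Nonempty (α k)]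
    [∀ k, ToData (α k)] {F : Data → PMF Data} (hF : PPT F) {d : ℕ → Data}
    (hd : PolyBounded fun k => (d k).size) (h : ∀ k, F (d k) = sampU (α k)) (a : ∀ k, α k) :
    PolyBounded fun k => (ToData.toData (a k)).size := by
  obtain ⟨p, hp⟩ := hF.size_le
  exact (hd.eval p).mono fun k => hp (d k) _ (h k ▸ mem_support_sampU _)

namespace PrivateMDI

variable {q : ℕ → ℕ} {HE : LHE q} {GS : GarblingScheme}

/-! ### Cloud -/

/-- The sampler of the randomness of the cloud. -/
noncomputable def cloudTapeS (HE : LHE q) (d : Data) : PMF Data :=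
  prodP (repS (vecS d.snd.fst d.snd.snd.fst) d.snd.snd.snd.snd) <|
  prodP (repS (repS (matS d.snd.fst d.snd.snd.fst) d.snd.snd.snd.fst) d.snd.snd.snd.snd) <|
  prodP (repS (repS (vecS d.snd.fst d.snd.snd.fst) d.snd.snd.snd.fst) d.snd.snd.snd.snd) <|
  prodP (repS (repS (bitsS HE.coins d.fst) d.snd.snd.fst) d.snd.snd.snd.snd)
    (repS (repS (repS (bitsS HE.coins d.fst) d.snd.snd.fst) d.snd.snd.fst) d.snd.snd.snd.snd)

theorem ppt_cloudTapeS (HE : LHE q) : PPT (cloudTapeS HE) := by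
  have hv : PPT fun d => vecS d.snd.fst d.snd.snd.fst := PPT.vec PT.id.snd.fst PT.id.snd.snd.fst
  have hm : PPT fun d => matS d.snd.fst d.snd.snd.fst := PPT.mat PT.id.snd.fst PT.id.snd.snd.fst
  have hb : PPT fun d => bitsS HE.coins d.fst := PPT.bits _ PT.id.fst
  have hL : PT fun d => d.snd.snd.snd.snd := PT.id.snd.snd.snd.snd
  have hT : PT fun d => d.snd.snd.snd.fst := PT.id.snd.snd.snd.fst
  have hn : PT fun d => d.snd.snd.fst := PT.id.snd.snd.fst
  exact (hv.rep hL).prodP (((hm.rep hT).rep hL).prodP (((hv.rep hT).rep hL).prodP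
    (((hb.rep hn).rep hL).prodP (((hb.rep hn).rep hn).rep hL))))

theorem size_infoCloud_le (k : ℕ) (A : Arch (q k)) :
    (infoCloud k A).size ≤ 2 * k + 10 * A.size + 20 := by
  have h : (infoCloud k A).size = (2 * k + 1) + (((q k).size + 1) + ((2 * A.n + 1) +
      ((2 * A.T + 1) + (ToData.toData fun l : Fin A.L => (A.layer l).isSome).size + 1) + 1) + 1)
      + 1 := by
    rw [← Data.size_unary, ← Data.size_unary, ← Data.size_unary]
    rfl
  have h1 := size_toData_fin_pi (fun l : Fin A.L => (A.layer l).isSome)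
    fun _ => size_toData_bool _
  have h2 := A.n_le_size
  have h3 := A.T_le_size
  have h4 := A.L_le_size
  have h5 := A.natSize_le_size
  omega

/-- The simulator of the view of the cloud. -/
noncomputable def cloudSim (HE : LHE q) (key enc : Code) (d : Data) : PMF Data :=
  (cloudTapeS HE d.fst).bind fun ct =>
    ((bitsS HE.coins d.fst.fst).bind fun ω => key.out (.pair d.fst.fst ω)).bind fun ks =>
      (Data.mapP (fun v => HE.encListS enc (.pair d.fst.fst (.pair ks.fst v)))
        (.pair d.fst.snd.snd.fst
          (Data.selectCopies d.fst.snd.snd.fst d.fst.snd.snd.snd.snd))).map fun e =>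
        .pair d.snd (.pair ct (.pair ks.fst e))

theorem ppt_cloudSim (HE : LHE q) {key enc : Code} (hk : key.PolyTime) (he : enc.PolyTime) :
    PPT (cloudSim HE key enc) := by
  refine PPT.bind' ((ppt_cloudTapeS HE).comp PT.id.fst) (PPT.bind' (PPT.bind'
    (PPT.bits _ PT.id.fst.fst.fst) (hk.ppt.comp (PT.id.fst.fst.fst.fst.pair PT.id.snd)))
    (PPT.bind' ?_ (PT.id.fst.fst.fst.snd.pair (PT.id.fst.fst.snd.pair
      (PT.id.fst.snd.fst.pair PT.id.snd)))))
  refine (PPT.mapP (F := fun d => HE.encListS enc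
    (.pair d.fst.fst.fst.fst.fst (.pair d.fst.snd.fst d.snd)))
    ((HE.ppt_encListS he).comp (PT.id.fst.fst.fst.fst.fst.pair (PT.id.fst.snd.fst.pair PT.id.snd)))
    PT.id (l := fun d => .pair d.fst.fst.fst.snd.snd.fst
      (Data.selectCopies d.fst.fst.fst.snd.snd.fst d.fst.fst.fst.snd.snd.snd.snd))
    (PT.id.fst.fst.fst.snd.snd.fst.pair (PT.selectCopies PT.id.fst.fst.fst.snd.snd.fst
      PT.id.fst.fst.fst.snd.snd.snd.snd))).congr fun _ => rfl

variable [∀ k, NeZero (q k)]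

set_option synthInstance.maxSize 1000 in
theorem cloudTapeS_info (k : ℕ) (A : Arch (q k)) :
    cloudTapeS HE (infoCloud k A) = sampU (CloudTape HE k A) := by
  have h : infoCloud k A = .pair (.unary k) (.pair (.num (q k)) (.pair (.unary A.n)
    (.pair (.unary A.T) (ToData.toData fun l : Fin A.L => (A.layer l).isSome)))) := rfl
  simp only [h, cloudTapeS, Data.fst_pair, Data.snd_pair, repS_toData_pi, Fintype.card_fin,
    vecS_unary, matS_unary, bitsS_unary, ← sampU_fin_pi, ← sampU_prod]

theorem polyBounded_model {A : ∀ k, Arch (q k)} (hA : PolyBounded fun k => (A k).size)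
    (M : ∀ k, (A k).Model) : PolyBounded fun k => (ToData.toData (M k)).size := by
  have hn : PolyBounded fun k => (A k).n := hA.mono fun k => (A k).n_le_size
  have hL : PolyBounded fun k => (A k).L := hA.mono fun k => (A k).L_le_size
  have hq : PolyBounded fun k => (q k).size := hA.mono fun k => (A k).natSize_le_size
  exact ((hL.mul (((hn.mul (((hn.mul ((hq.add (.const 1)).add (.const 1))).add (.const 1)).add
    (.const 1))).add (.const 1)).add (.const 1))).add (.const 1)).mono fun k =>
      size_toData_fin_pi (M k) fun l =>
        size_toData_fin_pi (fun i : Fin (A k).n => fun j => M k l i j) fun i =>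
          size_toData_fin_pi (fun j => M k l i j) fun j => size_toData_zmod _

theorem polyBounded_cloudTape {A : ∀ k, Arch (q k)} (hA : PolyBounded fun k => (A k).size)
    (c : ∀ k, CloudTape HE k (A k)) : PolyBounded fun k => (ToData.toData (c k)).size :=
  polyBounded_of_sampU (ppt_cloudTapeS HE)
    (((((PolyBounded.const 2).mul .self).add ((PolyBounded.const 10).mul hA)).add
      (.const 20)).mono fun k => size_infoCloud_le k (A k))
    (fun k => cloudTapeS_info k (A k)) c

/-- The masks chosen by the client. -/
def clientMasks {k : ℕ} {A : Arch (q k)} (t : Tape HE GS k A) : List (Vec (q k) A.n) :=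
  rFirst t :: (enum A.NL).map (r t)

/-- The run with other coins of the client. -/
def setClientCoins {k : ℕ} {A : Arch (q k)} (t : Tape HE GS k A)
    (ρ : HE.Coin k × (Fin A.n → HE.Coin k) × (A.NL → Fin A.n → HE.Coin k)) : Tape HE GS k A :=
  (t.1, (ρ.1, (rFirst t, ρ.2.1), fun l => (r t l, ρ.2.2 l)), t.2.2)

set_option synthInstance.maxSize 1000 in
-- The coins of the client occur in the cloud's view only in the key and in the encryptions.
-- Redrawing them separates these from the masks, which are kept as fixed messages.
theorem map_cloudView {c : Code} (hc : HE.ComputesEnc c) {k : ℕ} {A : Arch (q k)} (M : A.Model) :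
    (unif (Tape HE GS k A)).map (cloudView M) = (unif (Tape HE GS k A)).bind fun t =>
      ((HE.pkS k).bind fun pk => (seqL ((clientMasks t).map fun v =>
        HE.encListS c (.pair (.unary k) (.pair pk (ToData.toData v))))).map (.pair pk)).map fun d =>
          Data.pair (ToData.toData M) (.pair (ToData.toData (cloudT t)) d) := by
  conv_lhs => rw [unif_resample (T := Tape HE GS k A)
    (R := HE.Coin k × (Fin A.n → HE.Coin k) × (A.NL → Fin A.n → HE.Coin k))
    (fun t => (keyCoin t, encFirstCoin t, encRCoin t)) setClientCoins (fun _ _ => rfl)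
    (fun _ _ => rfl), PMF.map_bind]
  refine congrArg _ (funext fun t => ?_)
  have h1 : ∀ pk : Data, seqL ((clientMasks t).map fun v =>
      HE.encListS c (.pair (.unary k) (.pair pk (ToData.toData v)))) =
      (unif ((Fin A.n → HE.Coin k) × (A.NL → Fin A.n → HE.Coin k))).map fun ρ =>
        .pair (ToData.toData fun i => HE.enc k pk (rFirst t i) (ρ.1 i))
          (ToData.toData fun l => fun i => HE.enc k pk (r t l i) (ρ.2 l i)) := by
    intro pk
    rw [unif_prod_map_pair (fun ρ : Fin A.n → HE.Coin k =>
      ToData.toData fun i => HE.enc k pk (rFirst t i) (ρ i))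
      (fun ρ : A.NL → Fin A.n → HE.Coin k =>
        ToData.toData fun l => fun i => HE.enc k pk (r t l i) (ρ l i)), ← hc.encListS_eq]
    have h2 := unif_pi_map_ofList (α := fun _ : A.NL => Fin A.n → HE.Coin k)
      (e := fun l : A.NL => l) (fun _ _ h => h)
      (fun l ρ => ToData.toData fun i => HE.enc k pk (r t l i) (ρ i)) (enum _) (nodup_enum _)
    simp only [← hc.encListS_eq] at h2
    refine Eq.trans ?_ (congrArg _ h2.symm)
    rw [clientMasks, List.map_cons, List.map_map]
    rfl
  simp only [h1, LHE.pkS, PMF.bind_map]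
  rw [unif_prod, PMF.map_bind, PMF.map_bind, PMF.map_bind]
  refine congrArg _ (funext fun ω => ?_)
  simp only [Function.comp_apply, PMF.map_comp]
  rfl

set_option synthInstance.maxSize 1000 in
-- For fixed masks semantic security replaces every message by zero. What is left is the model and
-- the cloud's own randomness, which is uniform.
theorem secureCloud (hHE : HE.Secure) : (protocol HE GS).SecureCloud := by
  obtain ⟨⟨key, hkey, hkey'⟩, ⟨enc, henc, hc⟩, _⟩ := hHE.efficient
  obtain ⟨c, hcS, hout⟩ := ppt_cloudSim HE hkey henc
  refine ⟨c, hcS, fun A M x hA => ?_⟩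
  refine CompIndist.congr (Y := fun k => (unif (Tape HE GS k (A k))).bind fun t =>
      ((HE.pkS k).bind fun pk => (seqL ((List.replicate (Fintype.card (A k).NL + 1)
        (0 : Vec (q k) (A k).n)).map fun v =>
        HE.encListS enc (.pair (.unary k) (.pair pk (ToData.toData v))))).map (.pair pk)).map fun d =>
          Data.pair (ToData.toData (M k)) (.pair (ToData.toData (cloudT t)) d))
    (CompIndist.bind _ fun t _ => ?_) (fun k => (map_cloudView hc (M k)).symm) fun k => ?_
  · refine CompIndist.map (f := fun d =>
      .pair d.snd.fst.fst (.pair d.snd.fst.snd d.snd.snd))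
      (a := fun k => .pair (ToData.toData (M k)) (ToData.toData (cloudT (t k))))
      (hHE.semanticallySecure.encListS_list henc hc
        (hA.mono fun k => (A k).n_le_size) (hA.mono fun k => (A k).natSize_le_size)
        (fun k => by simp [clientMasks]) ?_)
      (PT.id.snd.fst.fst.pair (PT.id.snd.fst.snd.pair PT.id.snd.snd))
      (((polyBounded_model hA M).add (polyBounded_cloudTape hA fun k => cloudT (t k))).add
        (.const 1))
    refine (hA.add (.const 1)).mono fun k => ?_
    have := (A k).card_NL_le.trans (A k).L_le_size
    simp only [clientMasks, List.length_cons, List.length_map, length_enum]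
    omega
  · have h : ToData.toData (infoCloud k (A k), M k) = .pair (infoCloud k (A k))
      (ToData.toData (M k)) := rfl
    have h' : infoCloud k (A k) = .pair (.unary k) (.pair (.num (q k)) (.pair (.unary (A k).n)
      (.pair (.unary (A k).T) (ToData.toData fun l => ((A k).layer l).isSome)))) := rfl
    -- One zero vector for the first mask and one for each non-linear layer.
    have h1 : Data.pair (.unary (A k).n) (Data.selectCopies (.unary (A k).n)
        (ToData.toData fun l => ((A k).layer l).isSome)) =
        .ofList ((List.replicate (Fintype.card (A k).NL + 1) (0 : Vec (q k) (A k).n)).map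
          ToData.toData) := by
      rw [Data.selectCopies_toData, List.map_replicate, toData_zero_vec]
      rfl
    have h2 : (unif (Tape HE GS k (A k))).map cloudT = unif (CloudTape HE k (A k)) :=
      unif_map_get _ (fun t c => (c, t.2)) (fun _ _ => rfl) (fun _ _ => rfl)
    rw [hout, h, cloudSim]
    simp only [Data.fst_pair, Data.snd_pair]
    rw [cloudTapeS_info]
    simp only [h', Data.fst_pair, Data.snd_pair]
    rw [h1, sampU, ← h2, PMF.map_comp, PMF.bind_map]
    refine congrArg _ (funext fun t => ?_)
    simp only [Data.mapP_ofList, List.map_map, bitsS_unary, sampU, PMF.bind_map, PMF.bind_bind,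
      LHE.pkS, PMF.map_bind, Function.comp_apply, PMF.map_comp]
    refine congrArg _ (funext fun ω => ?_)
    have h3 := hkey' k ω
    change key.out (.pair (.unary k) (ToData.toData ω)) = _ at h3
    rw [h3, PMF.pure_bind]
    rfl

end PrivateMDI

/-- The last member of a list. -/
def Data.last (l : Data) : Data := foldD (fun d => d.snd.fst) (num 0) l (num 0)

theorem PT.last {l : Data → Data} (hl : PT l) : PT fun d => (l d).last :=
  PT.foldD (f := fun d => d.snd.fst) PT.id.snd.fst
    ⟨Polynomial.X, fun c a acc => by
      simp only [Data.snd_pair, Data.fst_pair, Polynomial.eval_X]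
      omega⟩ (PT.num 0) hl (PT.num 0)

theorem Data.last_ofList (l : List Data) (a : Data) : (ofList (l ++ [a])).last = a := by
  have h : ∀ (l : List Data) (acc : Data),
      foldD (fun d => d.snd.fst) (num 0) (ofList (l ++ [a])) acc = a := by
    intro l
    induction l with
    | nil => intro acc; rfl
    | cons b l ih => intro acc; exact ih _
  exact h l _

/-! ### The layers in which the client receives a ciphertext -/

namespace Arch

variable {q : ℕ}

/-- The client receives a ciphertext in layer `l`. -/
abbrev IsOut (A : Arch q) (l : Fin A.L) : Prop := A.IsNL l ∨ l = A.last

/-- The layers in which the client receives a ciphertext. -/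
abbrev Out (A : Arch q) : Type := {l : Fin A.L // A.IsOut l}

/-- The layers in which the client receives a ciphertext: the non-linear ones, and the last one. -/
def outLayers (A : Arch q) : List A.Out :=
  (enum A.NL).map (fun l => ⟨l.1, Or.inl l.2⟩) ++
    if A.IsNL A.last then [] else [⟨A.last, Or.inr rfl⟩]

theorem nodup_outLayers (A : Arch q) : A.outLayers.Nodup := by
  have h1 : ((enum A.NL).map fun l => (⟨l.1, Or.inl l.2⟩ : A.Out)).Nodup :=
    (nodup_enum A.NL).map fun l l' h => Subtype.ext (congrArg (fun c : A.Out => c.1) h)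
  rw [outLayers]
  split
  · rwa [List.append_nil]
  · rename_i hn
    refine h1.append (List.nodup_singleton _) ?_
    intro c hc hc'
    obtain ⟨l, _, rfl⟩ := List.mem_map.1 hc
    have : l.1 = A.last := congrArg (fun c : A.Out => c.1) (List.mem_singleton.1 hc')
    exact hn (this ▸ l.2)

theorem length_outLayers_le (A : Arch q) : A.outLayers.length ≤ A.size + 1 := by
  have := A.card_NL_le.trans A.L_le_size
  rw [outLayers, List.length_append, List.length_map, length_enum]
  split <;> simp <;> omega

theorem last_succ (A : Arch q) : (A.last : ℕ) + 1 = A.L := Nat.succ_pred_eq_of_pos A.L_pos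

end Arch

/-- The last index. -/
def lastIdx {n : ℕ} (i : Fin n) : Fin n := ⟨n - 1, by have := i.2; omega⟩

theorem finRange_eq_append {n : ℕ} (i : Fin n) :
    List.finRange n = (List.finRange n).dropLast ++ [lastIdx i] := by
  have hne : List.finRange n ≠ [] := fun h => by
    have := List.mem_finRange i
    rw [h] at this
    exact List.not_mem_nil this
  conv_lhs => rw [← List.dropLast_append_getLast hne]
  congr 2
  rw [List.getLast_eq_getElem]
  ext
  simp [lastIdx]

namespace PrivateMDI

variable {q : ℕ → ℕ} {HE : LHE q} {GS : GarblingScheme}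

/-! ### Client -/

section

variable {k : ℕ} {A : Arch (q k)}

/-- The result of the homomorphic evaluations of all but the last term of row `i`. -/
def linPre (M : A.Model) (t : Tape HE GS k A) (l : Fin A.L) (i : Fin A.n) : HE.Ct k :=
  (List.finRange A.n).dropLast.foldl
    (fun acc i' => HE.eval k (pk t) acc (cEnc M t l i') (1, M l i i') (evalCoin t l i i'))
    (HE.enc k (pk t) (s t l i) (encSCoin t l i))

/-- The ciphertexts of `M_l · c_l + s_l`. -/
def outEnc (M : A.Model) (t : Tape HE GS k A) (l : Fin A.L) : Fin A.n → HE.Ct k :=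
  linEnc M t l (cEnc M t l)

theorem outEnc_eq (M : A.Model) (t : Tape HE GS k A) (l : Fin A.L) (i : Fin A.n) :
    outEnc M t l i = HE.eval k (pk t) (linPre M t l i) (cEnc M t l (lastIdx i))
      (1, M l i (lastIdx i)) (evalCoin t l i (lastIdx i)) := by
  rw [outEnc, linEnc, finRange_eq_append i, List.foldl_append]
  rfl

/-- The two inputs of the last evaluation are valid ciphertexts, and its value is the entry of `M c
+ s`. This is the form in which function privacy applies. -/
theorem exists_encrypts_linPre (M : A.Model) (t : Tape HE GS k A) (l : Fin A.L) (i : Fin A.n) :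
    ∃ m, HE.Encrypts k (pk t) (linPre M t l i) m ∧
      1 * m + M l i (lastIdx i) * mask M t l (lastIdx i) = shifted M t l i := by
  refine ⟨_, encrypts_foldl M t l (encrypts_cEnc M t l) i (List.finRange A.n).dropLast
    (LHE.Encrypts.enc (s t l i) (encSCoin t l i)), ?_⟩
  have h : shifted M t l i = (∑ i', M l i i' * mask M t l i') + s t l i := rfl
  rw [h, Fin.sum_univ_def, finRange_eq_append i, List.map_append, List.sum_append]
  simp only [← finRange_eq_append i, List.map_cons, List.map_nil, List.sum_cons, List.sum_nil]
  ring

/-- The run with other coins of the last evaluation in each row of the layers in which the client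
receives a ciphertext. -/
def setOutCoins (t : Tape HE GS k A) (ρ : A.Out → Fin A.n → HE.Coin k) : Tape HE GS k A :=
  ((s t, randM t, randS t, encSCoin t, overwrite (P := A.IsOut) (evalCoin t)
    fun l i i' => if i' = lastIdx i then ρ l i else evalCoin t l.1 i i'), t.2)

/-- The coins that are replaced by `setOutCoins`. -/
def outCoins (t : Tape HE GS k A) : A.Out → Fin A.n → HE.Coin k :=
  fun l i => evalCoin t l.1 i (lastIdx i)

theorem evalCoin_setOutCoins (t : Tape HE GS k A) (ρ : A.Out → Fin A.n → HE.Coin k) (l : A.Out)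
    (i i' : Fin A.n) : evalCoin (setOutCoins t ρ) l.1 i i' =
      if i' = lastIdx i then ρ l i else evalCoin t l.1 i i' :=
  congrFun (congrFun (overwrite_apply (P := A.IsOut) (evalCoin t)
    (fun l i i' => if i' = lastIdx i then ρ l i else evalCoin t l.1 i i') l) i) i'

theorem evalCoin_setOutCoins_of_not (t : Tape HE GS k A) (ρ : A.Out → Fin A.n → HE.Coin k)
    {l : Fin A.L} (hl : ¬A.IsOut l) : evalCoin (setOutCoins t ρ) l = evalCoin t l :=
  overwrite_of_not (P := A.IsOut) (evalCoin t)
    (fun l i i' => if i' = lastIdx i then ρ l i else evalCoin t l.1 i i') hl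

theorem outCoins_set (t : Tape HE GS k A) (ρ : A.Out → Fin A.n → HE.Coin k) :
    outCoins (setOutCoins t ρ) = ρ := by
  funext l i
  rw [outCoins, evalCoin_setOutCoins, if_pos rfl]

theorem setOutCoins_set (t : Tape HE GS k A) (ρ : A.Out → Fin A.n → HE.Coin k) :
    setOutCoins (setOutCoins t ρ) (outCoins t) = t := by
  have h : evalCoin (setOutCoins (setOutCoins t ρ) (outCoins t)) = evalCoin t := by
    funext l i i'
    by_cases hl : A.IsOut l
    · rw [evalCoin_setOutCoins _ _ ⟨l, hl⟩]
      split
      · rename_i h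
        rw [h]
        rfl
      · rename_i h
        rw [evalCoin_setOutCoins _ _ ⟨l, hl⟩, if_neg h]
    · rw [evalCoin_setOutCoins_of_not _ _ hl, evalCoin_setOutCoins_of_not _ _ hl]
  exact congrArg (fun e => (((s t, randM t, randS t, encSCoin t, e), t.2) : Tape HE GS k A)) h

/-- A ciphertext sent to the client is never evaluated further: after a non-linear layer the cloud
continues with a fresh encryption, and the last layer has no successor. So its last coins influence
no earlier or later input. -/
theorem cEnc_setOutCoins (M : A.Model) (t : Tape HE GS k A) (ρ : A.Out → Fin A.n → HE.Coin k)
    {l : ℕ} (hl : l < A.L) : cEnc M (setOutCoins t ρ) l = cEnc M t l := by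
  induction l with
  | zero => rfl
  | succ l ih =>
    have hl' : l < A.L := by omega
    rw [cEnc, cEnc, dif_pos hl', dif_pos hl', ih hl']
    split
    · rfl
    · rename_i hn
      have hne : ¬A.IsOut ⟨l, hl'⟩ := by
        rintro (h | h)
        · exact hn h
        · have h1 : l = A.last := congrArg Fin.val h
          have := A.last_succ
          omega
      funext i
      simp only [linEnc, evalCoin_setOutCoins_of_not t ρ hne]
      rfl

/-- The last column is reached only in the last evaluation, so the ciphertext before it keeps its
value. -/
theorem outEnc_setOutCoins (M : A.Model) (t : Tape HE GS k A) (ρ : A.Out → Fin A.n → HE.Coin k)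
    (l : A.Out) (i : Fin A.n) :
    outEnc M (setOutCoins t ρ) l.1 i = HE.eval k (pk t) (linPre M t l.1 i)
      (cEnc M t l.1 (lastIdx i)) (1, M l.1 i (lastIdx i)) (ρ l i) := by
  have h : linPre M (setOutCoins t ρ) l.1 i = linPre M t l.1 i := by
    rw [linPre, linPre, cEnc_setOutCoins M t ρ l.1.2]
    refine List.foldl_ext _ _ _ fun acc i' hi' => ?_
    have hne : i' ≠ lastIdx i := by
      rintro rfl
      have := List.nodup_finRange A.n
      rw [finRange_eq_append i] at this
      exact (List.nodup_append.1 this).2.2 _ hi' _ (List.mem_singleton_self _) rfl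
    rw [evalCoin_setOutCoins, if_neg hne]
    rfl
  rw [outEnc_eq, h, cEnc_setOutCoins M t ρ l.1.2, evalCoin_setOutCoins, if_pos rfl]
  rfl

/-- The view of the client, from the values other than ciphertexts and from the list of
ciphertexts. -/
def clientPost (a E : Data) : Data :=
  .pair a.snd.snd.fst (.pair a.snd.snd.snd.fst (.pair a.snd.snd.snd.snd.fst
    (.pair (.take a.fst E) (.pair a.snd.snd.snd.snd.snd.fst
      (.pair (if a.snd.fst.truth then .num 0 else .pair (.num 1) E.last)
        a.snd.snd.snd.snd.snd.snd)))))

theorem pt_clientPost {a E : Data → Data} (ha : PT a) (hE : PT E) :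
    PT fun d => clientPost (a d) (E d) :=
  ha.snd.snd.fst.pair (ha.snd.snd.snd.fst.pair (ha.snd.snd.snd.snd.fst.pair
    ((PT.take ha.fst hE).pair (ha.snd.snd.snd.snd.snd.fst.pair
      ((PT.ite ha.snd.fst (PT.num 0) ((PT.num 1).pair hE.last)).pair
        ha.snd.snd.snd.snd.snd.snd)))))

/-- The values in the view of the client other than ciphertexts. -/
def clientValues (M : A.Model) (x : Vec (q k) A.n) (t : Tape HE GS k A) : Data :=
  ToData.toData (Data.unary (Fintype.card A.NL), (A.layer A.last).isSome, x, clientT t, b t,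
    ot₂ M t, masked M x t A.L)

theorem clientView_eq (M : A.Model) (x : Vec (q k) A.n) (t : Tape HE GS k A) :
    clientView M x t = clientPost (clientValues M x t)
      (.ofList (A.outLayers.map fun l => ToData.toData (outEnc M t l.1))) := by
  have h1 : Data.take (.unary (Fintype.card A.NL))
      (.ofList (A.outLayers.map fun l => ToData.toData (outEnc M t l.1))) =
      ToData.toData (zEnc M t) := by
    have := Data.take_append ((enum A.NL).map fun l => ToData.toData (outEnc M t l.1))
      ((if A.IsNL A.last then [] else [(⟨A.last, Or.inr rfl⟩ : A.Out)]).map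
        fun l => ToData.toData (outEnc M t l.1))
    rw [List.length_map, length_enum] at this
    rw [Arch.outLayers, List.map_append, List.map_map]
    exact this
  have h2 : (if (ToData.toData (A.layer A.last).isSome).truth then Data.num 0 else
      .pair (.num 1) (Data.ofList (A.outLayers.map
        fun l => ToData.toData (outEnc M t l.1))).last) = ToData.toData (finalEnc M t) := by
    by_cases hn : A.IsNL A.last
    · have h : (A.layer A.last).isSome = true := hn
      rw [finalEnc, if_pos hn, h]
      rfl
    · have h : (A.layer A.last).isSome = false := by simpa using hn
      have hc : cEnc M t A.L = outEnc M t A.last := by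
        rw [← A.last_succ, cEnc, dif_pos A.last.2]
        exact dif_neg hn
      rw [finalEnc, if_neg hn, h, hc, Arch.outLayers, if_neg hn, List.map_append, List.map_singleton,
        Data.last_ofList]
      rfl
  have h3 : clientValues M x t = .pair (.unary (Fintype.card A.NL))
    (.pair (ToData.toData (A.layer A.last).isSome) (.pair (ToData.toData x)
      (.pair (ToData.toData (clientT t)) (.pair (ToData.toData (b t))
        (.pair (ToData.toData (ot₂ M t)) (ToData.toData (masked M x t A.L))))))) := rfl
  simp only [h3, clientPost, Data.fst_pair, Data.snd_pair, h1, h2]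
  rfl

theorem ot₂_congr (hHE : HE.Correct) (M : A.Model) {t t' : Tape HE GS k A}
    (hs : s t = s t') (h : t.2 = t'.2) : ot₂ M t = ot₂ M t' := by
  have h1 : rFirst t = rFirst t' := by rw [rFirst, h]; rfl
  have h2 : r t = r t' := by funext l; rw [r, h]; rfl
  have hb : b t = b t' := by rw [b, h]; rfl
  have hu : u t = u t' := by rw [u, h]; rfl
  have hc : ∀ l, clientLabels t l = clientLabels t' l := by
    intro l
    have : garbleCoin t l = garbleCoin t' l := by rw [garbleCoin, h]; rfl
    funext i i'
    change (GS.garble k (A.nonlin l).circuit (garbleCoin t l)).2 _ _ =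
      (GS.garble k (A.nonlin l).circuit (garbleCoin t' l)).2 _ _
    rw [this]
  funext l i
  rw [ot₂, ot₂, ot₁, ot₁, hc, hb, hu, clientBits_congr hHE M hs h1 h2]

variable [NeZero (q k)]

theorem clientValues_congr (hHE : HE.Correct) (hGS : GS.Correct) (M : A.Model)
    (x : Vec (q k) A.n) {t t' : Tape HE GS k A} (hs : s t = s t') (h : t.2 = t'.2) :
    clientValues M x t = clientValues M x t' := by
  have h1 : rFirst t = rFirst t' := by rw [rFirst, h]; rfl
  have h2 : r t = r t' := by funext l; rw [r, h]; rfl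
  have hb : b t = b t' := by rw [b, h]; rfl
  have hc : clientT t = clientT t' := by rw [clientT, h]; rfl
  rw [clientValues, clientValues, hb, hc, ot₂_congr hHE M hs h, masked_eq hHE hGS,
    masked_eq hHE hGS, mask_congr M (fun l _ => congrFun hs l) h1 h2]

/-- A ciphertext that the client receives, for fixed randomness except for the coins of the last
evaluation. -/
noncomputable def clientRow (M : A.Model) (t : Tape HE GS k A) (l : Fin A.L) (i : Fin A.n) :
    PMF Data :=
  (unif (HE.Coin k)).map fun ρ => ToData.toData (HE.eval k (pk t) (linPre M t l i)
    (cEnc M t l (lastIdx i)) (1, M l i (lastIdx i)) ρ)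

set_option synthInstance.maxSize 1000 in
-- Fresh coins in the last evaluations make the ciphertexts independent samples, while all other
-- values in the view stay fixed.
theorem map_clientView (hHE : HE.Correct) (hGS : GS.Correct) (M : A.Model) (x : Vec (q k) A.n) :
    (unif (Tape HE GS k A)).map (clientView M x) = (unif (Tape HE GS k A)).bind fun t =>
      (seqL (A.outLayers.map fun l => seqL ((enum (Fin A.n)).map fun i =>
        clientRow M t l.1 i))).map (clientPost (clientValues M x t)) := by
  conv_lhs => rw [unif_resample (T := Tape HE GS k A) outCoins setOutCoins outCoins_set
    setOutCoins_set, PMF.map_bind]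
  refine congrArg _ (funext fun t => ?_)
  have h1 : ∀ l : A.Out, seqL ((enum (Fin A.n)).map fun i => clientRow M t l.1 i) =
      (unif (Fin A.n → HE.Coin k)).map fun ρ => ToData.toData fun i =>
        HE.eval k (pk t) (linPre M t l.1 i) (cEnc M t l.1 (lastIdx i)) (1, M l.1 i (lastIdx i))
          (ρ i) := fun l =>
    (unif_pi_map_ofList (α := fun _ : Fin A.n => HE.Coin k) (e := fun i : Fin A.n => i)
      (fun _ _ h => h) (fun i ρ => ToData.toData (HE.eval k (pk t) (linPre M t l.1 i)
        (cEnc M t l.1 (lastIdx i)) (1, M l.1 i (lastIdx i)) ρ)) (enum _) (nodup_enum _)).symm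
  have h2 := unif_pi_map_ofList (α := fun _ : A.Out => Fin A.n → HE.Coin k)
    (e := fun l : A.Out => l) (fun _ _ h => h) (fun l ρ => ToData.toData fun i =>
        HE.eval k (pk t) (linPre M t l.1 i) (cEnc M t l.1 (lastIdx i)) (1, M l.1 i (lastIdx i))
          (ρ i)) A.outLayers A.nodup_outLayers
  simp only [h1, ← h2, PMF.map_comp]
  refine congrArg (fun f => PMF.map f _) (funext fun ρ => ?_)
  rw [Function.comp_apply, clientView_eq, clientValues_congr hHE hGS M x (t := setOutCoins t ρ) (t' := t)
    rfl rfl]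
  have h3 : ∀ l : A.Out, outEnc M (setOutCoins t ρ) l.1 = fun i => HE.eval k (pk t)
      (linPre M t l.1 i) (cEnc M t l.1 (lastIdx i)) (1, M l.1 i (lastIdx i)) (ρ l i) :=
    fun l => funext fun i => outEnc_setOutCoins M t ρ l i
  simp only [h3]
  rfl

end

end PrivateMDI

/-- Used for the layers with a non-linear component: when the last layer is one of them, its mask is
the last member of the client's list. -/
theorem enum_eq_append {ι : Type*} [Fintype ι] [LinearOrder ι] (m : ι) (hm : ∀ i, i ≤ m) :
    ∃ l, enum ι = l ++ [m] := by
  obtain ⟨l₁, l₂, h⟩ := List.append_of_mem ((Finset.mem_sort _).2 (Finset.mem_univ m) : m ∈ enum ι)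
  have hs : (enum ι).Pairwise (fun a b => a ≤ b) := Finset.pairwise_sort _ _
  have hn := nodup_enum ι
  change enum ι = _ at h
  refine ⟨l₁, ?_⟩
  rw [h] at hs hn
  have h1 := (List.pairwise_cons.1 (List.pairwise_append.1 hs).2.1).1
  have h2 := (List.nodup_cons.1 (List.nodup_append.1 hn).2.1).1
  rcases l₂ with _ | ⟨a, l₂⟩
  · exact h
  · refine absurd ?_ h2
    rw [le_antisymm (h1 a List.mem_cons_self) (hm a)]
    exact List.mem_cons_self

/-- The difference of two vectors over `ℤ_q`. -/
def subVec (q v w : Data) : Data :=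
  Data.mapD (fun d => .num ((d.fst.val + (q.val - d.snd.val)) % q.val)) (.zip v w)

theorem PT.subVec {q v w : Data → Data} (hq : PT q) (hv : PT v) (hw : PT w) :
    PT fun d => _root_.subVec (q d) (v d) (w d) := by
  have h : PTNat fun d : Data =>
      (d.snd.fst.val + (d.fst.val - d.snd.snd.val)) % d.fst.val :=
    ((PTNat.val PT.id.snd.fst).add ((PTNat.val PT.id.fst).sub (PTNat.val PT.id.snd.snd))).mod
      (PTNat.val PT.id.fst)
  exact (PT.mapD (f := fun d =>
    .num ((d.snd.fst.val + (d.fst.val - d.snd.snd.val)) % d.fst.val)) h hq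
      (PT.zip hv hw)).congr fun _ => rfl

/-- Subtraction on natural numbers is truncated, so `q - w` is added instead; it is exact since
residues are below `q`. -/
theorem subVec_toData {q n : ℕ} [NeZero q] (v w : Vec q n) :
    subVec (.num q) (ToData.toData v) (ToData.toData w) = ToData.toData (v - w) := by
  rw [subVec, toData_pi v, toData_pi w, Data.zip_ofList_map, Data.mapD_ofList, List.map_map,
    toData_pi]
  congr 1
  refine List.map_congr_left fun i _ => ?_
  have h : (v - w) i = (((v i).val + (q - (w i).val) : ℕ) : ZMod q) := by
    rw [Nat.cast_add, Nat.cast_sub (ZMod.val_lt _).le]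
    simp [sub_eq_add_neg]
  change Data.num (((v i).val + (q - (w i).val)) % q) = .num ((v - w) i).val
  rw [h, ZMod.val_natCast]

/-! ### Uniformity of the client's other values -/

namespace PrivateMDI

variable {q : ℕ → ℕ} {HE : LHE q} {GS : GarblingScheme}

section

variable {k : ℕ} {A : Arch (q k)}

/-- A non-linear layer discards `s_l` from the mask, and the last layer affects only the final one.
Hence `s` can be altered in the layers where the client decrypts without changing any mask before
the end. -/
theorem mask_congr_of_lt (M : A.Model) {t t' : Tape HE GS k A}
    (hs : ∀ l, ¬A.IsOut l → s t l = s t' l) (h1 : rFirst t = rFirst t') (h2 : r t = r t') {l : ℕ}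
    (hl : l < A.L) : mask M t l = mask M t' l := by
  induction l with
  | zero => exact h1
  | succ l ih =>
    have hl' : l < A.L := by omega
    rw [mask, mask, dif_pos hl', dif_pos hl', ih hl', h2]
    split
    · rfl
    · rename_i hn
      rw [hs]
      rintro (h | h)
      · exact hn h
      · have h1 : l = A.last := congrArg Fin.val h
        have := A.last_succ
        omega

/-- The run with other strings `u`, such that the answers of the garbler in the oblivious transfers
are `o`. -/
def setOt₂ (M : A.Model) (t : Tape HE GS k A)
    (o : A.NL → Fin (A.bits + A.bits) → GS.Label k × GS.Label k) : Tape HE GS k A :=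
  (t.1, t.2.1, t.2.2.1, b t, fun l i e =>
    if e = ot₁ M t l i then clientLabels t l i false ^^^ (o l i).1
    else clientLabels t l i true ^^^ (o l i).2)

theorem xor_xor_cancel {κ : ℕ} (v w : BitVec κ) : v ^^^ (v ^^^ w) = w := by
  rw [← BitVec.xor_assoc, BitVec.xor_self, BitVec.zero_xor]

theorem ot₁_setOt₂ (hHE : HE.Correct) (M : A.Model) (t : Tape HE GS k A)
    (o : A.NL → Fin (A.bits + A.bits) → GS.Label k × GS.Label k) :
    ot₁ M (setOt₂ M t o) = ot₁ M t := by
  funext l i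
  rw [ot₁, ot₁, clientBits_congr hHE M (t := setOt₂ M t o) (t' := t) rfl rfl rfl]
  rfl

/-- The two labels are masked by the two different strings `u_0`, `u_1`, so both answers can be
prescribed at once. The bit that decides the order does not depend on `u`. -/
theorem ot₂_set (hHE : HE.Correct) (M : A.Model) (t : Tape HE GS k A)
    (o : A.NL → Fin (A.bits + A.bits) → GS.Label k × GS.Label k) :
    ot₂ M (setOt₂ M t o) = o := by
  funext l i
  have hu : ∀ e, u (setOt₂ M t o) l i e =
    if e = ot₁ M t l i then clientLabels t l i false ^^^ (o l i).1
    else clientLabels t l i true ^^^ (o l i).2 := fun e => rfl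
  have hl : clientLabels (setOt₂ M t o) l i = clientLabels t l i := rfl
  rw [ot₂, OT.msg₂, ot₁_setOt₂ hHE, hu, hu, hl, if_pos rfl, if_neg (by simp), xor_xor_cancel,
    xor_xor_cancel]

theorem setOt₂_set (hHE : HE.Correct) (M : A.Model) (t : Tape HE GS k A)
    (o : A.NL → Fin (A.bits + A.bits) → GS.Label k × GS.Label k) :
    setOt₂ M (setOt₂ M t o) (ot₂ M t) = t := by
  have h : (fun l i e => if e = ot₁ M t l i then clientLabels t l i false ^^^ (ot₂ M t l i).1
      else clientLabels t l i true ^^^ (ot₂ M t l i).2) = u t := by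
    funext l i e
    split
    · rename_i h
      rw [ot₂, OT.msg₂, xor_xor_cancel, h]
    · rename_i h
      have h' : (!ot₁ M t l i) = e := by
        revert h
        cases e <;> cases ot₁ M t l i <;> simp
      rw [ot₂, OT.msg₂, xor_xor_cancel, h']
  have h1 : setOt₂ M (setOt₂ M t o) (ot₂ M t) = (t.1, t.2.1, t.2.2.1, b t, fun l i e =>
      if e = ot₁ M t l i then clientLabels t l i false ^^^ (ot₂ M t l i).1
      else clientLabels t l i true ^^^ (ot₂ M t l i).2) := by
    rw [setOt₂, ot₁_setOt₂ hHE]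
    rfl
  rw [h1, h]
  rfl

/-- The run with other masks `s`, such that the values decrypted by the client are `ζ`. -/
def setShifted (M : A.Model) (t : Tape HE GS k A) (ζ : A.Out → Vec (q k) A.n) : Tape HE GS k A :=
  ((overwrite (P := A.IsOut) (s t) (fun l => ζ l - (M l.1).mulVec (mask M t l.1)), t.1.2), t.2)

theorem mask_setShifted (M : A.Model) (t : Tape HE GS k A) (ζ : A.Out → Vec (q k) A.n) {l : ℕ}
    (hl : l < A.L) : mask M (setShifted M t ζ) l = mask M t l :=
  mask_congr_of_lt M (t := setShifted M t ζ) (t' := t) (fun _ h => overwrite_of_not (P := A.IsOut) (s t)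
    (fun l => ζ l - (M l.1).mulVec (mask M t l.1)) h) rfl rfl hl

theorem shifted_set (M : A.Model) (t : Tape HE GS k A) (ζ : A.Out → Vec (q k) A.n) :
    (fun l : A.Out => shifted M (setShifted M t ζ) l.1) = ζ := by
  funext l
  have h : s (setShifted M t ζ) l.1 = ζ l - (M l.1).mulVec (mask M t l.1) :=
    overwrite_apply (P := A.IsOut) (s t) (fun l => ζ l - (M l.1).mulVec (mask M t l.1)) l
  rw [shifted, h, mask_setShifted M t ζ l.1.2, add_sub_cancel]

theorem setShifted_set (M : A.Model) (t : Tape HE GS k A) (ζ : A.Out → Vec (q k) A.n) :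
    setShifted M (setShifted M t ζ) (fun l : A.Out => shifted M t l.1) = t := by
  have h : overwrite (P := A.IsOut) (s (setShifted M t ζ)) (fun l => shifted M t l.1 -
      (M l.1).mulVec (mask M (setShifted M t ζ) l.1)) = s t := by
    have h1 : (fun l : A.Out => shifted M t l.1 -
        (M l.1).mulVec (mask M (setShifted M t ζ) l.1)) = fun l : A.Out => s t l.1 := by
      funext l
      rw [mask_setShifted M t ζ l.1.2, shifted, add_sub_cancel_left]
    rw [h1]
    exact overwrite_overwrite_self (s t) (fun l => ζ l - (M l.1).mulVec (mask M t l.1))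
  rw [setShifted, h]
  rfl

/-- The mask of the output, from the randomness of the client and the values that it decrypts. -/
def lastMask (c : ClientTape HE k A) (ζ : A.Out → Vec (q k) A.n) : Vec (q k) A.n :=
  if h : A.IsNL A.last then (c.2.2 ⟨A.last, h⟩).1 else ζ ⟨A.last, Or.inr rfl⟩

/-- The client knows the final mask: it drew it itself, or decrypts it. This is why the last message
can be simulated from `M(x)`. -/
theorem mask_L (M : A.Model) (t : Tape HE GS k A) :
    mask M t A.L = lastMask (clientT t) fun l => shifted M t l.1 := by
  have hL : mask M t A.L = mask M t (A.last + 1) := congrArg _ A.last_succ.symm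
  rw [hL, lastMask]
  split
  · rename_i h
    exact mask_succ_of_isNL M t ⟨A.last, h⟩
  · rename_i h
    exact mask_succ_of_not_isNL M t A.last h

/-- The view of the client for given random values, with simulated ciphertexts. -/
noncomputable def clientIdeal (S : Code) (x y : Vec (q k) A.n) (c : ClientTape HE k A)
    (b : TapeB A) (o : A.NL → Fin (A.bits + A.bits) → GS.Label k × GS.Label k)
    (ζ : A.Out → Vec (q k) A.n) : PMF Data :=
  (seqL (A.outLayers.map fun l => seqL ((enum (Fin A.n)).map fun i => S.out (ToData.toData
    (Data.unary k, (HE.keygen k c.1).1, (HE.keygen k c.1).2, ζ l i))))).map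
      (clientPost (ToData.toData (Data.unary (Fintype.card A.NL), (A.layer A.last).isSome, x, c, b,
        o, y - lastMask c ζ)))

variable [NeZero (q k)]

set_option synthInstance.maxSize 1000 in
-- The answers in the transfers are made uniform first, through `u`, which occurs nowhere else at
-- this stage. Then the decrypted values are made uniform through `s`. No trace of `M` remains
-- except in `y`.
theorem bind_clientIdeal (hHE : HE.Correct) (S : Code) (M : A.Model) (x y : Vec (q k) A.n) :
    ((unif (Tape HE GS k A)).bind fun t =>
      clientIdeal S x y (clientT t) (b t) (ot₂ M t) fun l => shifted M t l.1) =
    (unif (ClientTape HE k A × TapeB A)).bind fun p => (unif (A.Out → Vec (q k) A.n)).bind fun ζ =>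
      (unif (A.NL → Fin (A.bits + A.bits) → GS.Label k × GS.Label k)).bind fun o =>
        clientIdeal S x y p.1 p.2 o ζ := by
  have h1 : (unif (Tape HE GS k A)).map (fun t => (clientT t, b t)) =
      unif (ClientTape HE k A × TapeB A) :=
    unif_map_get _ (fun t p => (t.1, p.1, t.2.2.1, p.2, t.2.2.2.2)) (fun _ _ => rfl)
      (fun _ _ => rfl)
  rw [← h1, PMF.bind_map]
  calc _ = (unif (Tape HE GS k A)).bind fun t =>
        (unif (A.NL → Fin (A.bits + A.bits) → GS.Label k × GS.Label k)).bind fun o =>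
          clientIdeal S x y (clientT t) (b t) o fun l => shifted M t l.1 := by
        conv_lhs => rw [unif_resample _ (setOt₂ M) (ot₂_set hHE M) (setOt₂_set hHE M),
          PMF.bind_bind]
        refine congrArg _ (funext fun t => ?_)
        rw [PMF.bind_map]
        refine congrArg _ (funext fun o => ?_)
        have h2 : ∀ l, shifted M (setOt₂ M t o) l = shifted M t l := fun l => by
          rw [shifted, shifted, mask_congr M (t := setOt₂ M t o) (t' := t) (fun _ _ => rfl) rfl rfl]
          rfl
        simp only [Function.comp_apply, ot₂_set hHE, h2]
        rfl
    _ = _ := by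
        conv_lhs => rw [unif_resample _ (setShifted M) (shifted_set M) (setShifted_set M),
          PMF.bind_bind]
        refine congrArg _ (funext fun t => ?_)
        rw [PMF.bind_map]
        refine congrArg _ (funext fun ζ => ?_)
        simp only [Function.comp_apply, shifted_set]
        rfl

end

end PrivateMDI

/-- The supremum over all coins gives one bound for every run, as needed when the tape is fixed. -/
theorem LHE.Efficient.size_keygen_le {q : ℕ → ℕ} {HE : LHE q} (h : HE.Efficient) :
    PolyBounded fun k => Finset.univ.sup fun ω => (ToData.toData (HE.keygen k ω)).size := by
  obtain ⟨⟨c, hc, hout⟩, _⟩ := h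
  obtain ⟨p, hp⟩ := hc.ppt.size_le
  refine (((((PolyBounded.const 2).mul .self).add (PolyBounded.self.eval HE.coins)).add
    (.const 3)).eval p).mono fun k => Finset.sup_le fun ω _ => ?_
  refine (hp _ _ (by rw [hout, PMF.mem_support_pure_iff])).trans (p.eval_nat_mono ?_)
  have h1 := size_toData_bitVec ω
  have h2 : (ToData.toData (Data.unary k, ω)).size = (2 * k + 1) + (ToData.toData ω).size + 1 := by
    rw [← Data.size_unary]; rfl
  omega

theorem LHE.size_keygen_le_sup {q : ℕ → ℕ} (HE : LHE q) (k : ℕ) (ω : HE.Coin k) :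
    (HE.keygen k ω).1.size + (HE.keygen k ω).2.size + 1 ≤
      Finset.univ.sup fun ω => (ToData.toData (HE.keygen k ω)).size :=
  Finset.le_sup (f := fun ω => (ToData.toData (HE.keygen k ω)).size) (Finset.mem_univ ω)

/-! ### The simulator of the client -/

namespace PrivateMDI

variable {q : ℕ → ℕ} {HE : LHE q} {GS : GarblingScheme}

/-- The sampler of the randomness of the client and of the bits shared with the evaluator. -/
noncomputable def clientTapeS (HE : LHE q) (d : Data) : PMF Data :=
  prodP
    (prodP (bitsS HE.coins d.fst)
      (prodP (prodP (vecS d.snd.fst d.snd.snd.fst) (repS (bitsS HE.coins d.fst) d.snd.snd.fst))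
        (repS (prodP (vecS d.snd.fst d.snd.snd.fst) (repS (bitsS HE.coins d.fst) d.snd.snd.fst))
          d.snd.snd.snd.fst)))
    (repS (repS (sampU Bool) ((vecBits d.snd.fst d.snd.snd.fst).ulist.append
      (vecBits d.snd.fst d.snd.snd.fst).ulist)) d.snd.snd.snd.fst)

/-- The sampler of the answers of the garblers in the oblivious transfers. -/
noncomputable def otS (GS : GarblingScheme) (d : Data) : PMF Data :=
  repS (repS (prodP (bitsS GS.labelLen d.fst) (bitsS GS.labelLen d.fst))
    ((vecBits d.snd.fst d.snd.snd.fst).ulist.append (vecBits d.snd.fst d.snd.snd.fst).ulist))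
    d.snd.snd.snd.fst

/-- The sampler of the values that the client decrypts. -/
noncomputable def decryptedS (d : Data) : PMF Data :=
  repS (vecS d.snd.fst d.snd.snd.fst)
    (if d.snd.snd.snd.snd.truth then d.snd.snd.snd.fst else .pair (.num 0) d.snd.snd.snd.fst)

theorem ppt_clientTapeS (HE : LHE q) : PPT (clientTapeS HE) := by
  have hv : PPT fun d => vecS d.snd.fst d.snd.snd.fst := PPT.vec PT.id.snd.fst PT.id.snd.snd.fst
  have hb : PPT fun d => bitsS HE.coins d.fst := PPT.bits _ PT.id.fst
  have hN : PT fun d => d.snd.snd.snd.fst := PT.id.snd.snd.snd.fst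
  have hn : PT fun d => d.snd.snd.fst := PT.id.snd.snd.fst
  have hl : PT fun d => (vecBits d.snd.fst d.snd.snd.fst).ulist :=
    (PT.vecBits PT.id.snd.fst PT.id.snd.snd.fst).ulist
  exact (hb.prodP ((hv.prodP (hb.rep hn)).prodP ((hv.prodP (hb.rep hn)).rep hN))).prodP
    ((PPT.bool.rep (PT.append hl hl)).rep hN)

theorem ppt_otS (GS : GarblingScheme) : PPT (otS GS) := by
  have hb : PPT fun d => bitsS GS.labelLen d.fst := PPT.bits _ PT.id.fst
  have hl : PT fun d => (vecBits d.snd.fst d.snd.snd.fst).ulist :=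
    (PT.vecBits PT.id.snd.fst PT.id.snd.snd.fst).ulist
  exact ((hb.prodP hb).rep (PT.append hl hl)).rep PT.id.snd.snd.snd.fst

theorem ppt_decryptedS : PPT decryptedS :=
  (PPT.vec PT.id.snd.fst PT.id.snd.snd.fst).rep
    (PT.ite PT.id.snd.snd.snd.snd PT.id.snd.snd.snd.fst ((PT.num 0).pair PT.id.snd.snd.snd.fst))

theorem size_infoClient_le (k : ℕ) (A : Arch (q k)) :
    (infoClient k A).size ≤ 2 * k + 10 * A.size + 20 := by
  have h : (infoClient k A).size = (2 * k + 1) + (((q k).size + 1) + ((2 * A.n + 1) +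
      ((2 * Fintype.card A.NL + 1) + (ToData.toData (A.layer A.last).isSome).size + 1) + 1) + 1)
      + 1 := by
    rw [← Data.size_unary, ← Data.size_unary, ← Data.size_unary]
    rfl
  have h1 := size_toData_bool (A.layer A.last).isSome
  have h2 := A.n_le_size
  have h4 := A.card_NL_le.trans A.L_le_size
  have h5 := A.natSize_le_size
  omega

theorem infoClient_eq (k : ℕ) (A : Arch (q k)) :
    infoClient k A = .pair (.unary k) (.pair (.num (q k)) (.pair (.unary A.n)
      (.pair (.unary (Fintype.card A.NL)) (ToData.toData (A.layer A.last).isSome)))) := rfl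

/-- The simulator of the view of the client. -/
noncomputable def clientSim (HE : LHE q) (GS : GarblingScheme) (key S : Code) (d : Data) :
    PMF Data :=
  (prodP (clientTapeS HE d.fst) (prodP (decryptedS d.fst) (otS GS d.fst))).bind fun e =>
    (key.out (.pair d.fst.fst e.fst.fst.fst)).bind fun ks =>
      (Data.mapP (Data.mapP fun m => S.out (.pair d.fst.fst (.pair ks.fst (.pair ks.snd m))))
        e.snd.fst).map (clientPost (.pair d.fst.snd.snd.snd.fst (.pair d.fst.snd.snd.snd.snd
          (.pair d.snd.fst (.pair e.fst.fst (.pair e.fst.snd (.pair e.snd.snd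
            (subVec d.fst.snd.fst d.snd.snd (if d.fst.snd.snd.snd.snd.truth
              then e.fst.fst.snd.snd.last.fst else e.snd.fst.last)))))))))

theorem ppt_clientSim (HE : LHE q) (GS : GarblingScheme) {key S : Code} (hk : key.PolyTime)
    (hS : S.PolyTime) : PPT (clientSim HE GS key S) := by
  refine PPT.bind' (((ppt_clientTapeS HE).comp PT.id.fst).prodP
    ((ppt_decryptedS.comp PT.id.fst).prodP ((ppt_otS GS).comp PT.id.fst))) (PPT.bind'
      (hk.ppt.comp (PT.id.fst.fst.fst.pair PT.id.snd.fst.fst.fst)) (PPT.bind' ?_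
        (pt_clientPost (PT.id.fst.fst.fst.fst.snd.snd.snd.fst.pair
          (PT.id.fst.fst.fst.fst.snd.snd.snd.snd.pair (PT.id.fst.fst.fst.snd.fst.pair
            (PT.id.fst.fst.snd.fst.fst.pair (PT.id.fst.fst.snd.fst.snd.pair
              (PT.id.fst.fst.snd.snd.snd.pair (PT.subVec PT.id.fst.fst.fst.fst.snd.fst
                PT.id.fst.fst.fst.snd.snd (PT.ite PT.id.fst.fst.fst.fst.snd.snd.snd.snd
                  PT.id.fst.fst.snd.fst.fst.snd.snd.last.fst
                  PT.id.fst.fst.snd.snd.fst.last)))))))) PT.id.snd)))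
  have h1 : PPT fun d => S.out
      (.pair d.fst.fst.fst.fst.fst (.pair d.fst.snd.fst (.pair d.fst.snd.snd d.snd))) :=
    hS.ppt.comp (PT.id.fst.fst.fst.fst.fst.pair
      (PT.id.fst.snd.fst.pair (PT.id.fst.snd.snd.pair PT.id.snd)))
  exact ((h1.mapP PT.id.fst PT.id.snd).mapP PT.id PT.id.fst.snd.snd.fst).congr fun _ => rfl

variable [∀ k, NeZero (q k)]

/-- The number of bits of a vector is obtained by writing out the zero vector in binary. -/
theorem ulist_vecBits_zero (q n : ℕ) [NeZero q] :
    (vecBits (.num q) (.unary n)).ulist = .unary (n * bitLen q) := by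
  rw [← toData_zero_vec q n, vecBits_toData, ulist_toData_pi, Fintype.card_fin]

set_option synthInstance.maxSize 1000 in
theorem clientTapeS_info (k : ℕ) (A : Arch (q k)) :
    clientTapeS HE (infoClient k A) = sampU (ClientTape HE k A × TapeB A) := by
  simp only [infoClient_eq, clientTapeS, Data.fst_pair, Data.snd_pair, vecS_unary, bitsS_unary,
    ulist_vecBits_zero, Data.append_unary, ← sampU_fin_pi, ← sampU_prod, ← sampU_pi_eq_repS A.NL]

theorem otS_info (k : ℕ) (A : Arch (q k)) : otS GS (infoClient k A) =
    sampU (A.NL → Fin (A.bits + A.bits) → GS.Label k × GS.Label k) := by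
  simp only [infoClient_eq, otS, Data.fst_pair, Data.snd_pair, bitsS_unary,
    ulist_vecBits_zero, Data.append_unary, ← sampU_fin_pi, ← sampU_prod, ← sampU_pi_eq_repS A.NL]

theorem decryptedS_info (k : ℕ) (A : Arch (q k)) : decryptedS (infoClient k A) =
    (unif (A.Out → Vec (q k) A.n)).map fun ζ =>
      .ofList (A.outLayers.map fun l => ToData.toData (ζ l)) := by
  have h := unif_pi_map_ofList (α := fun _ : A.Out => Vec (q k) A.n) (e := fun l : A.Out => l)
    (fun _ _ h => h) (fun _ v => ToData.toData v) A.outLayers A.nodup_outLayers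
  have h1 : (if (ToData.toData (A.layer A.last).isSome).truth then
      Data.unary (Fintype.card A.NL) else .pair (.num 0) (.unary (Fintype.card A.NL))) =
      .unary A.outLayers.length := by
    rw [Arch.outLayers, List.length_append, List.length_map, length_enum]
    by_cases hn : A.IsNL A.last
    · have h : (A.layer A.last).isSome = true := hn
      rw [if_pos hn, h]
      rfl
    · have h : (A.layer A.last).isSome = false := by simpa using hn
      rw [if_neg hn, h]
      rfl
  refine Eq.trans ?_ h.symm
  change repS (vecS (.num (q k)) (.unary A.n)) (if (ToData.toData (A.layer A.last).isSome).truth then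
    Data.unary (Fintype.card A.NL) else .pair (.num 0) (.unary (Fintype.card A.NL))) = _
  rw [h1, vecS_unary, repS, mapP_unary, List.map_const']
  rfl

/-- Simulated ciphertexts are indistinguishable from the ones that the client receives. -/
theorem clientRows_indist (hHE : HE.Secure) {S : Code} (hS : S.PolyTime)
    (hfp : ∀ (ω : (k : ℕ) → HE.Coin k) (ct₁ ct₂ : (k : ℕ) → HE.Ct k)
      (m₁ m₂ a b : (k : ℕ) → ZMod (q k)),
      (∀ k, HE.Encrypts k (HE.keygen k (ω k)).1 (ct₁ k) (m₁ k)) →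
      (∀ k, HE.Encrypts k (HE.keygen k (ω k)).1 (ct₂ k) (m₂ k)) →
      CompIndist
        (fun k => (unif (HE.Coin k)).map fun ρ =>
          ToData.toData (HE.eval k (HE.keygen k (ω k)).1 (ct₁ k) (ct₂ k) (a k, b k) ρ))
        (fun k => S.out (ToData.toData
          (Data.unary k, (HE.keygen k (ω k)).1, (HE.keygen k (ω k)).2, a k * m₁ k + b k * m₂ k))))
    {A : ∀ k, Arch (q k)} (hA : PolyBounded fun k => (A k).size) (M : ∀ k, (A k).Model)
    (t : ∀ k, Tape HE GS k (A k)) :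
    CompIndist
      (fun k => seqL ((A k).outLayers.map fun l => seqL ((enum (Fin (A k).n)).map fun i =>
        clientRow (M k) (t k) l.1 i)))
      (fun k => seqL ((A k).outLayers.map fun l => seqL ((enum (Fin (A k).n)).map fun i =>
        S.out (ToData.toData (Data.unary k, pk (t k), sk (t k), shifted (M k) (t k) l.1 i))))) := by
  obtain ⟨p, hp⟩ := hS.ppt.size_le
  have hkey := hHE.efficient.size_keygen_le
  have hq : PolyBounded fun k => (q k).size := hA.mono fun k => (A k).natSize_le_size
  have hn : PolyBounded fun k => (A k).n := hA.mono fun k => (A k).n_le_size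
  let Bd : ℕ → ℕ := fun k => (HE.ctLen.eval k + 1) + p.eval (2 * k +
    (Finset.univ.sup fun ω => (ToData.toData (HE.keygen k ω)).size) + (q k).size + 10)
  have hBd : PolyBounded Bd := ((PolyBounded.self.eval HE.ctLen).add (.const 1)).add
    ((((((PolyBounded.const 2).mul .self).add hkey).add hq).add (.const 10)).eval p)
  have hX : ∀ k l i, ∀ d ∈ (clientRow (M k) (t k) l i).support, d.size ≤ Bd k := by
    intro k l i d hd
    obtain ⟨ρ, _, rfl⟩ := (PMF.mem_support_map_iff _ _ _).1 hd
    exact (size_toData_bitVec _).trans (Nat.le_add_right _ _)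
  have hY : ∀ k (m : ZMod (q k)), ∀ d ∈ (S.out (ToData.toData
      (Data.unary k, pk (t k), sk (t k), m))).support, d.size ≤ Bd k := by
    intro k m d hd
    refine (hp _ d hd).trans ((p.eval_nat_mono ?_).trans (Nat.le_add_left _ _))
    have h1 := HE.size_keygen_le_sup k (keyCoin (t k))
    have h2 := size_toData_zmod m
    have h3 : (ToData.toData (Data.unary k, pk (t k), sk (t k), m)).size =
        (2 * k + 1) + ((HE.keygen k (keyCoin (t k))).1.size +
          ((HE.keygen k (keyCoin (t k))).2.size + (ToData.toData m).size + 1) + 1) + 1 := by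
      rw [← Data.size_unary]; rfl
    omega
  have hlist : ∀ (k : ℕ) (F : Fin (A k).n → PMF Data), (∀ i, ∀ d ∈ (F i).support, d.size ≤ Bd k) →
      ∀ d ∈ (seqL ((enum (Fin (A k).n)).map F)).support, d.size ≤ (A k).n * (Bd k + 1) + 1 := by
    intro k F hF d hd
    have := size_le_of_mem_support_seqL (B := Bd k) (fun r hr => by
      obtain ⟨i, _, rfl⟩ := List.mem_map.1 hr
      exact hF i) d hd
    simpa using this
  refine CompIndist.seqL_map (fun k => (A k).outLayers) ((hA.add (.const 1)).mono fun k =>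
    (A k).length_outLayers_le) ((hn.mul (hBd.add (.const 1))).add (.const 1))
    -- The outer hybrid argument runs over the layers; a second one, over the rows of a layer,
    -- follows.
    (fun k l => hlist k _ fun i => hX k l.1 i) (fun k l => hlist k _ fun i => hY k _) fun o => ?_
  refine (CompIndist.seqL_map (ι := fun k => (A k).Out × Fin (A k).n)
    (fun k => (o k).elim [] fun l => (enum (Fin (A k).n)).map fun i => (l, i))
    (X := fun k c => clientRow (M k) (t k) c.1.1 c.2)
    (Y := fun k c => S.out (ToData.toData
      (Data.unary k, pk (t k), sk (t k), shifted (M k) (t k) c.1.1 c.2)))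
    (hn.mono fun k => ?_) hBd (fun k c => hX k _ _) (fun k c => hY k _) fun c => ?_).congr
    (fun k => ?_) fun k => ?_
  · rcases o k with _ | l <;> simp
  · choose m hm hm' using fun (k : ℕ) (c : (A k).Out × Fin (A k).n) =>
      exists_encrypts_linPre (M k) (t k) c.1.1 c.2
    -- Function privacy holds for fixed keys and ciphertexts, so the tape may be fixed. Out-of-range
    -- indices get an encryption of `0`, only to satisfy the hypotheses.
    refine (hfp (fun k => keyCoin (t k))
      (fun k => (c k).elim (HE.enc k (pk (t k)) 0 0) fun c => linPre (M k) (t k) c.1.1 c.2)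
      (fun k => (c k).elim (HE.enc k (pk (t k)) 0 0) fun c =>
        cEnc (M k) (t k) c.1.1 (lastIdx c.2))
      (fun k => (c k).elim 0 (m k))
      (fun k => (c k).elim 0 fun c => mask (M k) (t k) c.1.1 (lastIdx c.2)) 1
      (fun k => (c k).elim 0 fun c => M k c.1.1 c.2 (lastIdx c.2)) (fun k => ?_)
      fun k => ?_).of_eq_or fun k => ?_
    · rcases c k with _ | c
      · exact LHE.Encrypts.enc 0 0
      · exact hm k c
    · rcases c k with _ | c
      · exact LHE.Encrypts.enc 0 0
      · exact encrypts_cEnc (M k) (t k) _ _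
    · rcases c k with _ | c
      · exact Or.inl rfl
      · refine Or.inr ⟨rfl, ?_⟩
        simp only [Option.elim, Pi.one_apply, hm']
        rfl
  · rcases o k with _ | l
    · rfl
    · simp only [Option.elim, List.map_map]
      rfl
  · rcases o k with _ | l
    · rfl
    · simp only [Option.elim, List.map_map]
      rfl

theorem polyBounded_clientValues {A : ∀ k, Arch (q k)} (hA : PolyBounded fun k => (A k).size)
    (M : ∀ k, (A k).Model) (x : ∀ k, Vec (q k) (A k).n) (t : ∀ k, Tape HE GS k (A k)) :
    PolyBounded fun k => (clientValues (M k) (x k) (t k)).size := by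
  have hinfo : PolyBounded fun k => (infoClient k (A k)).size :=
    ((((PolyBounded.const 2).mul .self).add ((PolyBounded.const 10).mul hA)).add
      (.const 20)).mono fun k => size_infoClient_le k (A k)
  have hvec : ∀ v : ∀ k, Vec (q k) (A k).n, PolyBounded fun k => (ToData.toData (v k)).size := by
    intro v
    have hq : PolyBounded fun k => (q k).size := hA.mono fun k => (A k).natSize_le_size
    have hn : PolyBounded fun k => (A k).n := hA.mono fun k => (A k).n_le_size
    exact ((hn.mul ((hq.add (.const 1)).add (.const 1))).add (.const 1)).mono fun k =>
      size_toData_fin_pi (v k) fun i => size_toData_zmod _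
  have hct := polyBounded_of_sampU (ppt_clientTapeS HE) hinfo
    (fun k => clientTapeS_info k (A k)) fun k => (clientT (t k), b (t k))
  have hot := polyBounded_of_sampU (ppt_otS GS) hinfo (fun k => otS_info k (A k)) fun k =>
    ot₂ (M k) (t k)
  refine ((((((hA.unary_size.add (hvec x)).add hct).add hot).add
    (hvec fun k => masked (M k) (x k) (t k) (A k).L)).add (.const 10))).mono fun k => ?_
  have h1 := (A k).card_NL_le.trans (A k).L_le_size
  have h2 := size_toData_bool ((A k).layer (A k).last).isSome
  have h3 : (clientValues (M k) (x k) (t k)).size = (2 * Fintype.card (A k).NL + 1) +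
    ((ToData.toData ((A k).layer (A k).last).isSome).size + ((ToData.toData (x k)).size +
      ((ToData.toData (clientT (t k))).size + ((ToData.toData (b (t k))).size +
        ((ToData.toData (ot₂ (M k) (t k))).size +
          (ToData.toData (masked (M k) (x k) (t k) (A k).L)).size + 1) + 1) + 1) + 1) + 1) + 1 := by
    rw [← Data.size_unary]; rfl
  have h4 : (ToData.toData (clientT (t k), b (t k))).size =
    (ToData.toData (clientT (t k))).size + (ToData.toData (b (t k))).size + 1 := rfl
  have h5 := Data.size_unary (A k).size
  omega

end PrivateMDI

namespace PrivateMDI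

variable {q : ℕ → ℕ} {HE : LHE q} {GS : GarblingScheme}

theorem toData_lastMask {k : ℕ} {A : Arch (q k)} (c : ClientTape HE k A)
    (ζ : A.Out → Vec (q k) A.n) :
    (if (ToData.toData (A.layer A.last).isSome).truth then (ToData.toData c).snd.snd.last.fst
      else (Data.ofList (A.outLayers.map fun l => ToData.toData (ζ l))).last) =
      ToData.toData (lastMask c ζ) := by
  by_cases hn : A.IsNL A.last
  · have h : (A.layer A.last).isSome = true := hn
    obtain ⟨l, hl⟩ := enum_eq_append (⟨A.last, hn⟩ : A.NL) fun l => by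
      have h1 := l.1.2
      have h2 := A.last_succ
      exact (show (l.1 : ℕ) ≤ A.last by omega)
    have h1 : (ToData.toData c).snd.snd = .ofList ((enum A.NL).map fun l =>
      ToData.toData (c.2.2 l)) := rfl
    rw [lastMask, dif_pos hn, h, h1, hl, List.map_append, List.map_singleton, Data.last_ofList]
    rfl
  · have h : (A.layer A.last).isSome = false := by simpa using hn
    rw [lastMask, dif_neg hn, h, Arch.outLayers, if_neg hn, List.map_append, List.map_singleton,
      Data.last_ofList]
    rfl

variable [∀ k, NeZero (q k)]

set_option synthInstance.maxSize 1000 in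
theorem clientSim_eq {key : Code} (hkey : ∀ (k : ℕ) (ω : HE.Coin k),
      key.out (ToData.toData (Data.unary k, ω)) = PMF.pure (ToData.toData (HE.keygen k ω)))
    (S : Code) (k : ℕ) (A : Arch (q k)) (x y : Vec (q k) A.n) :
    clientSim HE GS key S (ToData.toData (infoClient k A, x, y)) =
    (unif (ClientTape HE k A × TapeB A)).bind fun p => (unif (A.Out → Vec (q k) A.n)).bind fun ζ =>
      (unif (A.NL → Fin (A.bits + A.bits) → GS.Label k × GS.Label k)).bind fun o =>
        clientIdeal S x y p.1 p.2 o ζ := by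
  have h0 : ToData.toData (infoClient k A, x, y) =
    .pair (infoClient k A) (.pair (ToData.toData x) (ToData.toData y)) := rfl
  have h1 : prodP (clientTapeS HE (infoClient k A)) (prodP (decryptedS (infoClient k A))
      (otS GS (infoClient k A))) =
      (unif (ClientTape HE k A × TapeB A)).bind fun p =>
        (unif (A.Out → Vec (q k) A.n)).bind fun ζ =>
          (unif (A.NL → Fin (A.bits + A.bits) → GS.Label k × GS.Label k)).map fun o =>
            .pair (.pair (ToData.toData p.1) (ToData.toData p.2))
              (.pair (.ofList (A.outLayers.map fun l => ToData.toData (ζ l)))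
                (ToData.toData o)) := by
    simp only [clientTapeS_info, otS_info, decryptedS_info, prodP, sampU, PMF.bind_map,
      PMF.map_bind, PMF.map_comp, Function.comp_def]
    rfl
  rw [h0, clientSim]
  simp only [Data.fst_pair, Data.snd_pair]
  rw [h1, PMF.bind_bind]
  refine congrArg _ (funext fun p => ?_)
  rw [PMF.bind_bind]
  refine congrArg _ (funext fun ζ => ?_)
  rw [PMF.bind_map]
  refine congrArg _ (funext fun o => ?_)
  have h2 : ToData.toData (y - lastMask p.1 ζ) = subVec (.num (q k)) (ToData.toData y)
      (if (ToData.toData (A.layer A.last).isSome).truth then (ToData.toData p.1).snd.snd.last.fst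
        else (Data.ofList (A.outLayers.map fun l => ToData.toData (ζ l))).last) := by
    rw [toData_lastMask, subVec_toData]
  have h3 : key.out (.pair (.unary k) (ToData.toData p.1.1)) =
    PMF.pure (ToData.toData (HE.keygen k p.1.1)) := hkey k p.1.1
  have h4 : clientIdeal S x y p.1 p.2 o ζ =
      (Data.mapP (Data.mapP fun m => S.out (.pair (.unary k) (.pair (HE.keygen k p.1.1).1
        (.pair (HE.keygen k p.1.1).2 m))))
        (.ofList (A.outLayers.map fun l => ToData.toData (ζ l)))).map
      (clientPost (.pair (.unary (Fintype.card A.NL)) (.pair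
        (ToData.toData (A.layer A.last).isSome) (.pair (ToData.toData x)
        (.pair (ToData.toData p.1) (.pair (ToData.toData p.2) (.pair (ToData.toData o)
          (ToData.toData (y - lastMask p.1 ζ))))))))) := by
    rw [Data.mapP_ofList, List.map_map]
    simp only [Function.comp_def, mapP_toData_pi]
    rfl
  rw [h4, h2]
  change (key.out (.pair (.unary k) (ToData.toData p.1.1))).bind _ = _
  rw [h3, PMF.pure_bind]
  rfl

set_option synthInstance.maxSize 1000 in
/-- The client's view as a function of its tape, with fresh coins for the last evaluations. -/
noncomputable def clientReal {k : ℕ} {A : Arch (q k)} (M : A.Model) (x : Vec (q k) A.n) :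
    PMF Data :=
  (unif (Tape HE GS k A)).bind fun t =>
    (seqL (A.outLayers.map fun l => seqL ((enum (Fin A.n)).map fun i =>
      clientRow M t l.1 i))).map (clientPost (clientValues M x t))

set_option synthInstance.maxSize 1000 in
/-- The client's view with the evaluated ciphertexts replaced by simulated ones. -/
noncomputable def clientHybrid (HE : LHE q) (GS : GarblingScheme) (S : Code) {k : ℕ}
    {A : Arch (q k)} (M : A.Model) (x : Vec (q k) A.n) : PMF Data :=
  (unif (Tape HE GS k A)).bind fun t =>
    (seqL (A.outLayers.map fun l => seqL ((enum (Fin A.n)).map fun i =>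
      S.out (ToData.toData (Data.unary k, pk t, sk t, shifted M t l.1 i))))).map
        (clientPost (clientValues M x t))

theorem viewClient_eq (hHE : HE.Correct) (hGS : GS.Correct) {k : ℕ} {A : Arch (q k)} (M : A.Model)
    (x : Vec (q k) A.n) :
    (protocol HE GS).viewClient k A M x = clientReal (HE := HE) (GS := GS) M x :=
  map_clientView hHE hGS M x

/-- By correctness the last message is `M(x)` minus the final mask, so with simulated ciphertexts
the view depends on the model only through `M(x)`. -/
theorem clientHybrid_eq {key : Code} (hkey : ∀ (k : ℕ) (ω : HE.Coin k),
      key.out (ToData.toData (Data.unary k, ω)) = PMF.pure (ToData.toData (HE.keygen k ω)))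
    (hHE : HE.Correct) (hGS : GS.Correct) (S : Code) {k : ℕ} {A : Arch (q k)} (M : A.Model)
    (x : Vec (q k) A.n) :
    clientHybrid HE GS S M x =
      clientSim HE GS key S (ToData.toData (infoClient k A, x, A.infer M x)) := by
  rw [clientSim_eq hkey, ← bind_clientIdeal hHE S M, clientHybrid]
  refine congrArg _ (funext fun t => ?_)
  have h : A.infer M x - lastMask (clientT t) (fun l => shifted M t l.1) =
      masked M x t A.L := by
    rw [masked_eq hHE hGS, mask_L]
    rfl
  rw [clientIdeal, h]
  rfl

theorem clientReal_indist (hHE : HE.Secure) {S : Code} (hS : S.PolyTime)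
    (hfp : ∀ (ω : (k : ℕ) → HE.Coin k) (ct₁ ct₂ : (k : ℕ) → HE.Ct k)
      (m₁ m₂ a b : (k : ℕ) → ZMod (q k)),
      (∀ k, HE.Encrypts k (HE.keygen k (ω k)).1 (ct₁ k) (m₁ k)) →
      (∀ k, HE.Encrypts k (HE.keygen k (ω k)).1 (ct₂ k) (m₂ k)) →
      CompIndist
        (fun k => (unif (HE.Coin k)).map fun ρ =>
          ToData.toData (HE.eval k (HE.keygen k (ω k)).1 (ct₁ k) (ct₂ k) (a k, b k) ρ))
        (fun k => S.out (ToData.toData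
          (Data.unary k, (HE.keygen k (ω k)).1, (HE.keygen k (ω k)).2, a k * m₁ k + b k * m₂ k))))
    {A : ∀ k, Arch (q k)} (hA : PolyBounded fun k => (A k).size) (M : ∀ k, (A k).Model)
    (x : ∀ k, Vec (q k) (A k).n) :
    CompIndist (fun k => clientReal (HE := HE) (GS := GS) (M k) (x k))
      (fun k => clientHybrid HE GS S (M k) (x k)) :=
  CompIndist.bind _ fun t _ =>
    CompIndist.map (f := fun d => clientPost d.snd.fst d.snd.snd)
      (clientRows_indist hHE hS hfp hA M t) (pt_clientPost PT.id.snd.fst PT.id.snd.snd)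
      (polyBounded_clientValues hA M x t)

theorem secureClient (hHE : HE.Secure) (hGS : GS.Correct) :
    (protocol HE GS).SecureClient := by
  obtain ⟨S, hS, hfp⟩ := hHE.functionPrivate
  obtain ⟨key, hkey, hkey'⟩ := hHE.efficient.1
  obtain ⟨c, hc, hout⟩ := ppt_clientSim HE GS hkey hS
  refine ⟨c, hc, fun A M x hA => ?_⟩
  refine (clientReal_indist hHE hS hfp hA M x).congr
    (fun k => (viewClient_eq hHE.correct hGS (M k) (x k)).symm) fun k => ?_
  rw [hout]
  exact clientHybrid_eq hkey' hHE.correct hGS S (M k) (x k)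

end PrivateMDI

/-! ### The main theorem -/

theorem theorem1 (q : ℕ → ℕ) [∀ k, Fact (q k).Prime]
    (HE : LHE q) (GS : GarblingScheme) (hHE : HE.Secure) (hGS : GS.Secure) :
    (PrivateMDI.protocol HE GS).Secure where
  correct := PrivateMDI.protocol_correct hHE.correct hGS.correct
  cloud := PrivateMDI.secureCloud hHE
  client := PrivateMDI.secureClient hHE hGS.correct
  computing := PrivateMDI.secureComputing hHE.correct hGS.correct
  garbler := PrivateMDI.secureGarbler hHE.correct hGS.correct
  evaluator := PrivateMDI.secureEvaluator hHE.correct hGS
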